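/- Fix an integer $k\ge 1$. For $n\ge 2k+1$ let $R_{n,k}$ be the regular ring lattice: the graph on $n$ cyclically ordered vertices in which $i$ is joined to $i\pm1,\dots,i\pm k$ (mod $n$). Let $0<p<q<1/2$. For an unknown $Y\in\{\pm1\}^V$ we observe independent edge measurements $X_{uv}$, equal to $Y_uY_v$ with probability $1-p$ and to $-Y_uY_v$ otherwise, and independent vertex measurements $Z_v$, equal to $Y_v$ with probability $1-q$ and to $-Y_v$ otherwise. The Hamming error of $\widehat Y$ is the number of $v$ with $\widehat Y_v\ne Y_v$. Let $\mathcal R(n,k,p,q)$ be the minimax expected Hamming error, i.e. the infimum over all (possibly randomized) estimators $\widehat Y=\widehat Y(X,Z)$ of the maximum over $Y$ of the expected Hamming error. There are $C, B>0$ depending only on $k$ such that the following hold. (1) (The optimal rate is $\widetilde\Theta(p^kn)$.) For all $n\ge 2k+1$ and $0<p<q<1/2$, $\mathcal R(n,k,p,q)\ge \frac{q}{C}\,p^kn$. For every $q\in(0,1/2)$ there is $C'$ (depending on $k,q$) such that $\mathcal R(n,k,p,q)\le C'\log(n)\,p^kn$ for all $n\ge2k+1$ and $1/n\le p<q$. (2)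 (Algorithm.) Number the vertices $0,\dots,n-1$ and let $E'$ be the set of edges $uv$ with $|u-v|\le k$ (the edges that do not pass over the seam between $n-1$ and $0$), $G'=(V,E')$. For $0\le i<\lceil n/(k+1)\rceil$ let the component $W_i$ be the closed neighborhood of $v_i=i(k+1)$ in $G'$, let the extended component $W_i^\star\supseteq W_i$ consist of all vertices at distance at most $2$ from $v_i$ in $G'$, and arrange the components in the path $T$ with edges $W_iW_{i+1}$. Then $T$ is a non-redundant tree decomposition of $G'$, each $G'(W_i^\star)$ is connected, and the maximum degree of $T$, the sizes $|W_i^\star|-1$, the numbers $|E'(W_i^\star)|$ and the number of $W_i^\star$ that contain a given edge of $E'$ are all at most $B$. The tree decomposition decoder with budget $L\in\mathbb N$ works as follows. For each $W=W_i$ choose a labeling of $W^\star$ that contradicts as few of the measurements $X_{uv}$, $uv\in E'(W^\star)$, as possible, and let $\widehat Y^{W}$ be its restriction to $W$; for $s=\pm1$ let $\mathrm{Cost}_W[s]$ be the number of $v\in W$ with $s\widehat Y^{W}_v\ne Z_v$; for each edge $W_1W_2$ of $T$ choose $v\in W_1\cap W_2$ and put $S(W_1,W_2)=\widehat Y^{W_1}_v\widehat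 Y^{W_2}_v$; let $\hat s$ minimize $\sum_W \mathrm{Cost}_W[s_W]$ among all $s\in\{\pm1\}^{\mathcal W}$ for which at most $L$ edges of $T$ have $s_{W_1}\ne s_{W_2}S(W_1,W_2)$; and for each $v$ put $\widehat Y_v=\hat s_W\widehat Y^W_v$ for some $W\ni v$. For $\delta\in(0,1)$ the budget is $L=\lfloor\deg(T)K_n\rfloor$ with $$K_n=2^{w+2+m}\sum_W p^{\lceil \mathrm{mincut}^\star(W)/2\rceil}+6\,d\,m\,\log(2/\delta),$$ where $w=\max_W|W^\star|-1$, $m=\max_W|E'(W^\star)|$, $d$ is the largest number of sets $E'(W^\star)$ that contain a given edge, and $\mathrm{mincut}^\star(W)$ is the least number of edges of $G'(W^\star)$ between $S$ and $W^\star\setminus S$ over all $S\subseteq W^\star$ that meet $W$ but do not contain it. For all $n\ge 2k+1$, $0<p<q<1/2$ and $\delta\in(0,1)$, and for every $Y$: with probability at least $1-\delta$, every output $\widehat Y$ of this decoder (however its arbitrary choices are made) has Hamming error at most $$\frac{C}{(1/2-q)^2}\,\bigl(p^kn+\log(2/\delta)\bigr)\log n .$$ Moreover, exhaustive search in the components and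 dynamic programming along the path compute, for all inputs $X,Z$, an output of this decoder in at most $C\,\bigl(\lceil p^kn\rceil+\log(1/\delta)\bigr)\,n$ steps. In particular the time is $O(\lceil p^kn\rceil n)$ whenever $\log(1/\delta)\le\lceil p^kn\rceil$, and $\widetilde O(\lceil p^kn\rceil n)$ for $\delta=1/n$. -/

import Mathlib

open scoped ENNReal

/-! ### The observation model

Labels `±1` are the units `ℤˣ` of the integers. -/

/-- The product `Y_u Y_v` of the labels of the two endpoints of the unordered pair `e = {u, v}`. -/
def edgeProd {V : Type*} (Y : V → ℤˣ) (e : Sym2 V) : ℤˣ :=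
  Sym2.lift ⟨fun u v => Y u * Y v, fun u v => mul_comm (Y u) (Y v)⟩ e

/-- Every set of signs is measurable for Mathlib's measurable structure on `ℤˣ`. -/
instance : MeasurableSingletonClass ℤˣ where
  measurableSet_singleton u := ⟨{(u : ℤ)}, MeasurableSet.singleton _, by
    ext w
    simp [Units.ext_iff]⟩

/-- The law of a noisy copy of the sign `y`: it equals `y` with probability `1 - r` and `-y` with
probability `r`. -/
noncomputable def noisySign (r : ℝ) (y : ℤˣ) : MeasureTheory.Measure ℤˣ :=
  ENNReal.ofReal (1 - r) • MeasureTheory.Measure.dirac y +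
    ENNReal.ofReal r • MeasureTheory.Measure.dirac (-y)

/-- What the statistician sees: the edge measurements `X` and the vertex measurements `Z`. -/
abbrev Observation {V : Type*} (G : SimpleGraph V) : Type _ := (G.edgeSet → ℤˣ) × (V → ℤˣ)

open scoped Classical in
/-- The law of `(X, Z)` when the ground truth is `Y`: all measurements are independent, `X_{uv}` is
`Y_u Y_v` flipped with probability `p`, and `Z_v` is `Y_v` flipped with probability `q`. -/
noncomputable def observationLaw {V : Type*} [Fintype V] (G : SimpleGraph V) (p q : ℝ)
    (Y : V → ℤˣ) : MeasureTheory.Measure (Observation G) :=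
  (MeasureTheory.Measure.pi fun e : G.edgeSet => noisySign p (edgeProd Y e)).prod
    (MeasureTheory.Measure.pi fun v : V => noisySign q (Y v))

open scoped Classical in
/-- The optimal (minimax) expected Hamming error: the infimum over all, possibly randomized,
estimators of the worst-case expected Hamming error. A randomized estimator maps the observation
to a probability distribution on labelings. -/
noncomputable def minimaxHammingError {V : Type*} [Fintype V] (G : SimpleGraph V) (p q : ℝ) :
    ℝ≥0∞ :=
  ⨅ est : Observation G → PMF (V → ℤˣ), ⨆ Y : V → ℤˣ,
    ∫⁻ o, ∑ y : V → ℤˣ, est o y * (hammingDist y Y : ℝ≥0∞) ∂(observationLaw G p q Y)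

/-! ### Tree decompositions and the decoder -/

/-- The parameters of the decoder: the graph `G' = (V, E')` of probed edges, the graph `T` on the
index set `ι` of the components, the components `W` and the extended components `W⋆`. -/
structure Decomposition (V ι : Type*) where
  /-- the probed graph `G'` -/
  probed : SimpleGraph V
  /-- the tree `T` -/
  tree : SimpleGraph ι
  /-- the component `W` -/
  bag : ι → Finset V
  /-- the extended component `W⋆` -/
  ext : ι → Finset V

/-- `T` with the components `W` is a (non-redundant) tree decomposition of `G'`. -/
structure Decomposition.IsTreeDecomposition {V ι : Type*} (D : Decomposition V ι) : Prop where
  isTree : D.tree.IsTree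
  vertex_mem : ∀ v, ∃ i, v ∈ D.bag i
  edge_mem : ∀ u v, D.probed.Adj u v → ∃ i, u ∈ D.bag i ∧ v ∈ D.bag i
  coherence : ∀ (i j : ι) (w : D.tree.Walk i j), w.IsPath → ∀ l ∈ w.support,
    ∀ v, v ∈ D.bag i → v ∈ D.bag j → v ∈ D.bag l
  nonredundant : ∀ i j, D.tree.Adj i j → ¬ D.bag j ⊆ D.bag i

open scoped Classical in
/-- The edge set `E'(W⋆)`, as a set of edges of `G`. -/
noncomputable def Decomposition.localEdges {V ι : Type*} [Fintype V] (G : SimpleGraph V)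
    (D : Decomposition V ι) (i : ι) : Finset G.edgeSet :=
  Finset.univ.filter fun e => (e : Sym2 V) ∈ D.probed.edgeSet ∧ ∀ v ∈ (e : Sym2 V), v ∈ D.ext i

/-- The maximum degree of `T`. -/
noncomputable def Decomposition.treeDegree {V ι : Type*} [Fintype ι] (D : Decomposition V ι) : ℕ :=
  Finset.univ.sup fun i => (D.tree.neighborSet i).ncard

/-- `wid⋆(T)`, the largest size of an extended component, minus one. -/
def Decomposition.widthStar {V ι : Type*} [Fintype ι] (D : Decomposition V ι) : ℕ :=
  (Finset.univ.sup fun i => (D.ext i).card) - 1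

/-- The largest number of edges `E'(W⋆)` in an extended component. -/
noncomputable def Decomposition.maxLocalEdges {V ι : Type*} [Fintype V] [Fintype ι]
    (G : SimpleGraph V) (D : Decomposition V ι) : ℕ :=
  Finset.univ.sup fun i => (D.localEdges G i).card

open scoped Classical in
/-- The largest number of extended components in which an edge occurs. -/
noncomputable def Decomposition.edgeDegreeStar {V ι : Type*} [Fintype V] [Fintype ι]
    (G : SimpleGraph V) (D : Decomposition V ι) : ℕ :=
  Finset.univ.sup fun e : G.edgeSet =>
    (Finset.univ.filter fun i => e ∈ D.localEdges G i).card

open scoped Classical in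
/-- `mincut⋆(W)`: the least number of edges of `G'(W⋆)` between `S` and `W⋆ \ S`, over all
`S ⊆ W⋆` that meet `W` and do not contain `W`. -/
noncomputable def Decomposition.mincutStar {V ι : Type*} [Fintype V]
    (G : SimpleGraph V) (D : Decomposition V ι) (i : ι) : ℕ :=
  sInf {c | ∃ S : Finset V, S ⊆ D.ext i ∧ (∃ v ∈ D.bag i, v ∈ S) ∧ (∃ v ∈ D.bag i, v ∉ S) ∧
    c = ((D.localEdges G i).filter fun e : G.edgeSet =>
      ∃ u ∈ S, ∃ v ∉ S, (e : Sym2 V) = s(u, v)).card}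

/-- Admissibility of the decomposition, with all quantities that have to be constant bounded
by `B`. -/
structure Decomposition.IsAdmissible {V ι : Type*} [Fintype V] [Fintype ι] (G : SimpleGraph V)
    (D : Decomposition V ι) (B : ℕ) : Prop where
  probed_le : D.probed ≤ G
  isTreeDecomposition : D.IsTreeDecomposition
  bag_subset_ext : ∀ i, D.bag i ⊆ D.ext i
  treeDegree_le : D.treeDegree ≤ B
  edgeDegreeStar_le : D.edgeDegreeStar G ≤ B
  maxLocalEdges_le : D.maxLocalEdges G ≤ B
  widthStar_le : D.widthStar ≤ B
  ext_connected : ∀ i, (D.probed.induce (D.ext i : Set V)).Connected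

/-- The bound `K_n` on the number of components that are decoded wrongly, for failure
probability `δ`; note that `(c + 1) / 2 = ⌈c / 2⌉`. The factor `2 ^ maxLocalEdges` accounts for the
choice of the `⌈c / 2⌉` flipped edges in a cut with `c` edges. -/
noncomputable def Decomposition.componentBudget {V ι : Type*} [Fintype V] [Fintype ι]
    (G : SimpleGraph V) (D : Decomposition V ι) (p δ : ℝ) : ℝ :=
  2 ^ (D.widthStar + 2 + D.maxLocalEdges G) * ∑ i, p ^ ((D.mincutStar G i + 1) / 2) +
    6 * D.edgeDegreeStar G * D.maxLocalEdges G * Real.log (2 / δ)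

/-- The bound `L_n = deg(T) K_n` on the number of violated edges of `T`. The number of violated
edges is an integer, so that the integer part can be taken. -/
noncomputable def Decomposition.treeBudget {V ι : Type*} [Fintype V] [Fintype ι]
    (G : SimpleGraph V) (D : Decomposition V ι) (p δ : ℝ) : ℕ :=
  ⌊D.treeDegree * D.componentBudget G p δ⌋₊

open scoped Classical in
/-- The number of edge measurements in `E'(W⋆)` that the labeling `y` contradicts. Only the
restriction of `y` to `W⋆` matters. -/
noncomputable def Decomposition.localCost {V ι : Type*} [Fintype V] (G : SimpleGraph V)
    (D : Decomposition V ι) (X : G.edgeSet → ℤˣ) (i : ι) (y : V → ℤˣ) : ℕ :=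
  ((D.localEdges G i).filter fun e : G.edgeSet => edgeProd y e ≠ X e).card

/-- The number `Cost_W[s]` of vertices of `W` at which `s` times the component estimator differs
from the vertex measurement. -/
def Decomposition.vertexCost {V ι : Type*} (D : Decomposition V ι) (Z : V → ℤˣ)
    (est : ι → V → ℤˣ) (i : ι) (s : ℤˣ) : ℕ :=
  ((D.bag i).filter fun v => s * est i v ≠ Z v).card

open scoped Classical in
/-- The number of edges `(W₁, W₂)` of `T` with `s_{W₁} ≠ s_{W₂} S(W₁, W₂)`, that is, with
`s_{W₁} s_{W₂} ≠ S(W₁, W₂)`, for `S(W₁, W₂)` the product of the two component estimators at the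
vertex `pivot` chosen in `W₁ ∩ W₂`. -/
noncomputable def Decomposition.violations {V ι : Type*} [Fintype ι] (D : Decomposition V ι)
    (est : ι → V → ℤˣ) (pivot : Sym2 ι → V) (s : ι → ℤˣ) : ℕ :=
  (Finset.univ.filter fun e : D.tree.edgeSet =>
    edgeProd s e ≠ edgeProd (fun i => est i (pivot e)) e).card

/-- `Yhat` is a possible output of the tree decomposition decoder with budget `L` on input
`(X, Z)`. Each arbitrary choice of the algorithm (which minimizer, which vertex in `W₁ ∩ W₂`,
which component containing a vertex) is existentially quantified. -/
def Decomposition.IsDecoderOutput {V ι : Type*} [Fintype V] [Fintype ι] (G : SimpleGraph V)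
    (D : Decomposition V ι) (L : ℕ) (X : G.edgeSet → ℤˣ) (Z : V → ℤˣ) (Yhat : V → ℤˣ) : Prop :=
  ∃ (est : ι → V → ℤˣ) (pivot : Sym2 ι → V) (s : ι → ℤˣ) (home : V → ι),
    (∀ i y, D.localCost G X i (est i) ≤ D.localCost G X i y) ∧
    (∀ i j, D.tree.Adj i j → pivot s(i, j) ∈ D.bag i ∧ pivot s(i, j) ∈ D.bag j) ∧
    D.violations est pivot s ≤ L ∧
    (∀ s' : ι → ℤˣ, D.violations est pivot s' ≤ L →
      ∑ i, D.vertexCost Z est i (s i) ≤ ∑ i, D.vertexCost Z est i (s' i)) ∧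
    (∀ v, v ∈ D.bag (home v)) ∧
    (∀ v, Yhat v = s (home v) * est (home v) v)

/-! ### Running time

A timed computation is a value together with the number of steps spent on it. In the programs
below each call of a recursive function performs a bounded number of elementary operations
(arithmetic and comparisons on numbers and signs, access to the first cell of a linked list, one
access to the input or the output array) besides the calls it makes, and is charged one step.
`map`, `foldl` or any other hidden loop is not used. -/

/-- A value with a step count. -/
structure Timed (α : Type*) where
  /-- the result -/
  val : α
  /-- the number of steps -/
  time : ℕ

instance : Monad Timed where
  pure a := ⟨a, 0⟩
  bind x f := ⟨(f x.val).val, x.time + (f x.val).time⟩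

/-- Spend one step. -/
def tick : Timed Unit := ⟨(), 1⟩

/-- The data of one component, as linked lists: the vertices of `W`, the vertices of `W⋆`, and the
edges in `E'(W⋆)`. -/
structure ComponentData (V : Type*) where
  /-- the vertices of `W` -/
  core : List V
  /-- the vertices of `W⋆` -/
  ext : List V
  /-- the edges in `E'(W⋆)` -/
  edges : List (V × V)

section Programs

variable {V : Type} [DecidableEq V]

/-- The label of `v`, when the vertices `vs` carry the labels `ys`. -/
def lookupT : List V → List ℤˣ → V → Timed ℤˣ
  | a :: vs, y :: ys, v => do
    tick
    if a = v then pure y else lookupT vs ys v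
  | _, _, _ => do
    tick
    pure 1

/-- Count the edges whose measurement contradicts the labels `ys` of the vertices `vs`. -/
def edgeMismatchT (x : V → V → ℤˣ) (vs : List V) (ys : List ℤˣ) : List (V × V) → Timed ℕ
  | [] => do
    tick
    pure 0
  | e :: es => do
    tick
    let a ← lookupT vs ys e.1
    let b ← lookupT vs ys e.2
    let c ← edgeMismatchT x vs ys es
    pure (if a * b ≠ x e.1 e.2 then c + 1 else c)

/-- Exhaustive search: the cheapest extension of `ys` by `m` further signs, with its cost. -/
def bestLabelsT (cost : List ℤˣ → Timed ℕ) : ℕ → List ℤˣ → Timed (ℕ × List ℤˣ)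
  | 0, ys => do
    tick
    let c ← cost ys
    pure (c, ys)
  | m + 1, ys => do
    tick
    let a ← bestLabelsT cost m (1 :: ys)
    let b ← bestLabelsT cost m (-1 :: ys)
    pure (if a.1 ≤ b.1 then a else b)

/-- The length of a list. -/
def lengthT : List V → Timed ℕ
  | [] => do
    tick
    pure 0
  | _ :: vs => do
    tick
    let m ← lengthT vs
    pure (m + 1)

/-- The component estimator: a labeling of `W⋆` that contradicts as few edge measurements in
`E'(W⋆)` as possible. -/
def localEstimateT (x : V → V → ℤˣ) (W : ComponentData V) : Timed (List ℤˣ) := do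
  tick
  let m ← lengthT W.ext
  let b ← bestLabelsT (fun ys => edgeMismatchT x W.ext ys W.edges) m []
  pure b.2

/-- `Cost[+1]` and `Cost[-1]`, summed over a list of vertices. -/
def vertexCostsT (Z : V → ℤˣ) (W : ComponentData V) (ys : List ℤˣ) : List V → Timed (ℕ × ℕ)
  | [] => do
    tick
    pure (0, 0)
  | v :: vs => do
    tick
    let a ← lookupT W.ext ys v
    let c ← vertexCostsT Z W ys vs
    pure (if a = Z v then (c.1, c.2 + 1) else (c.1 + 1, c.2))

/-- Membership in a list. -/
def memT (v : V) : List V → Timed Bool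
  | [] => do
    tick
    pure false
  | w :: ws => do
    tick
    if v = w then pure true else memT v ws

/-- The product of two component estimators at the first vertex of the list that also lies in the
second component. -/
def linkT (W₁ W₂ : ComponentData V) (ys₁ ys₂ : List ℤˣ) : List V → Timed ℤˣ
  | [] => do
    tick
    pure 1
  | v :: vs => do
    tick
    let b ← memT v W₂.core
    if b then
      let a₁ ← lookupT W₁.ext ys₁ v
      let a₂ ← lookupT W₂.ext ys₂ v
      pure (a₁ * a₂)
    else linkT W₁ W₂ ys₁ ys₂ vs

/-- A component with the labels found for it, its two costs, and the sign `S` on the edge of the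
path to the preceding component (irrelevant for the first one). -/
structure DecodedComponent (V : Type) where
  /-- the component -/
  comp : ComponentData V
  /-- the labels of `W⋆` -/
  labels : List ℤˣ
  /-- `Cost[+1]` and `Cost[-1]` -/
  costs : ℕ × ℕ
  /-- the sign `S` -/
  link : ℤˣ

/-- The component estimators, the costs and the signs `S` of all components along the path;
`prev` is the preceding component with its labels. -/
def decodeComponentsT (x : V → V → ℤˣ) (Z : V → ℤˣ) :
    Option (ComponentData V × List ℤˣ) → List (ComponentData V) →
      Timed (List (DecodedComponent V))
  | _, [] => do
    tick
    pure []
  | prev, W :: Ws => do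
    tick
    let ys ← localEstimateT x W
    let c ← vertexCostsT Z W ys W.core
    let t ← match prev with
      | none => pure 1
      | some P => linkT P.1 W P.2 ys P.1.core
    let rest ← decodeComponentsT x Z (some (W, ys)) Ws
    pure (⟨W, ys, c, t⟩ :: rest)

/-- A row of the table of the dynamic program has one entry for each budget `0, 1, …, L` and for a
fixed sign of the last component treated so far. An entry consists of the least cost within that
budget and the signs, last component first, that attain it. Here is the first row. -/
def initialRowT (s : ℤˣ) (c : ℕ) : ℕ → Timed (List (ℕ × List ℤˣ))
  | 0 => do
    tick
    pure [(c, [s])]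
  | L + 1 => do
    tick
    let r ← initialRowT s c L
    pure ((c, [s]) :: r)

/-- The next row, for the sign `s` with cost `c`: either the edge is not violated, and the entry of
`same` for the same budget is extended, or it is violated, and the entry of `diff` for a budget
smaller by one (`carry`) is extended. -/
def nextRowT (s : ℤˣ) (c : ℕ) :
    List (ℕ × List ℤˣ) → List (ℕ × List ℤˣ) → Option (ℕ × List ℤˣ) →
      Timed (List (ℕ × List ℤˣ))
  | a :: same, b :: diff, carry => do
    tick
    let rest ← nextRowT s c same diff (some b)
    let e := match carry with
      | none => a
      | some d => if a.1 ≤ d.1 then a else d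
    pure ((e.1 + c, s :: e.2) :: rest)
  | _, _, _ => do
    tick
    pure []

/-- The last entry of a row. -/
def lastEntryT : List (ℕ × List ℤˣ) → Timed (ℕ × List ℤˣ)
  | [] => do
    tick
    pure (0, [])
  | [a] => do
    tick
    pure a
  | _ :: as => do
    tick
    lastEntryT as

/-- The dynamic program over the remaining components, from the rows for the two signs of the
preceding component. It returns the optimal signs, last component first. -/
def pathProgramT : List (ℕ × List ℤˣ) → List (ℕ × List ℤˣ) → List (DecodedComponent V) →
    Timed (List ℤˣ)
  | rowP, rowM, [] => do
    tick
    let a ← lastEntryT rowP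
    let b ← lastEntryT rowM
    pure (if a.1 ≤ b.1 then a.2 else b.2)
  | rowP, rowM, W :: Ws => do
    tick
    let rP ← if W.link = 1 then nextRowT 1 W.costs.1 rowP rowM none
      else nextRowT 1 W.costs.1 rowM rowP none
    let rM ← if W.link = 1 then nextRowT (-1) W.costs.2 rowM rowP none
      else nextRowT (-1) W.costs.2 rowP rowM none
    pathProgramT rP rM Ws

/-- `TreeDecoder` on a path, with budget `L`. The signs are returned last component first. -/
def pathDecoderT (L : ℕ) : List (DecodedComponent V) → Timed (List ℤˣ)
  | [] => do
    tick
    pure []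
  | W :: Ws => do
    tick
    let rP ← initialRowT 1 W.costs.1 L
    let rM ← initialRowT (-1) W.costs.2 L
    pathProgramT rP rM Ws

/-- Reverse a list of signs. -/
def reverseT : List ℤˣ → List ℤˣ → Timed (List ℤˣ)
  | [], acc => do
    tick
    pure acc
  | s :: ss, acc => do
    tick
    reverseT ss (s :: acc)

/-- Write the signed labels of a list of vertices of a component into the output array. -/
def writeComponentT (s : ℤˣ) (W : ComponentData V) (ys : List ℤˣ) :
    List V → (V → ℤˣ) → Timed (V → ℤˣ)
  | [], out => do
    tick
    pure out
  | v :: vs, out => do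
    tick
    let a ← lookupT W.ext ys v
    writeComponentT s W ys vs (Function.update out v (s * a))

/-- Write the signed labels of all components into the output array. -/
def writeAllT : List ℤˣ → List (DecodedComponent V) → (V → ℤˣ) → Timed (V → ℤˣ)
  | s :: ss, W :: Ws, out => do
    tick
    let out' ← writeComponentT s W.comp W.labels W.comp.core out
    writeAllT ss Ws out'
  | _, _, out => do
    tick
    pure out

/-- The tree decomposition decoder for components arranged in a path, as a timed program. The
input array `x` holds the edge measurements and the input array `Z` the vertex measurements. -/
def decoderT (L : ℕ) (Ws : List (ComponentData V)) (x : V → V → ℤˣ) (Z : V → ℤˣ) :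
    Timed (V → ℤˣ) := do
  tick
  let Ds ← decodeComponentsT x Z none Ws
  let ss ← pathDecoderT L Ds
  let ss' ← reverseT ss []
  writeAllT ss' Ds (fun _ => 1)

end Programs

/-- The components of a decomposition as linked lists, in the order of their indices. -/
noncomputable def Decomposition.componentList {V : Type} [Fintype V] {m : ℕ} (G : SimpleGraph V)
    (D : Decomposition V (Fin m)) : List (ComponentData V) :=
  List.ofFn fun i => ⟨(D.bag i).toList, (D.ext i).toList,
    (D.localEdges G i).toList.map fun e => Quot.out (e : Sym2 V)⟩

open scoped Classical in
/-- The decoder, run on a decomposition whose components are arranged in a path in the order of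
their indices. -/
noncomputable def Decomposition.runDecoder {V : Type} [Fintype V] {m : ℕ}
    (G : SimpleGraph V) (D : Decomposition V (Fin m)) (L : ℕ) (X : G.edgeSet → ℤˣ)
    (Z : V → ℤˣ) : Timed (V → ℤˣ) :=
  decoderT L (D.componentList G)
    (fun u v => if h : G.Adj u v then X ⟨s(u, v), h⟩ else 1) Z

/-! ### The ring lattice -/

/-- The regular ring lattice `R_{n,k}`, with vertices `0, …, n - 1`. -/
def ringLattice (n k : ℕ) : SimpleGraph (Fin n) where
  Adj i j := i ≠ j ∧ ∃ d, 1 ≤ d ∧ d ≤ k ∧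
    ((j : ℕ) = (i + d) % n ∨ (i : ℕ) = (j + d) % n)
  symm := ⟨by
    rintro i j ⟨h, d, h1, h2, h3⟩
    exact ⟨h.symm, d, h1, h2, h3.symm⟩⟩
  loopless := ⟨fun _ h => h.1 rfl⟩

/-- The edges of the ring lattice that do not pass over the seam between `n - 1` and `0`. -/
def ringProbed (n k : ℕ) : SimpleGraph (Fin n) where
  Adj i j := i ≠ j ∧ (i : ℕ) ≤ j + k ∧ (j : ℕ) ≤ i + k
  symm := ⟨fun _ _ h => ⟨h.1.symm, h.2.2, h.2.1⟩⟩
  loopless := ⟨fun _ h => h.1 rfl⟩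

open scoped Classical in
/-- The closed neighborhood of a set of vertices. -/
noncomputable def closedNeighborhood {V : Type*} [Fintype V] (H : SimpleGraph V) (S : Finset V) :
    Finset V :=
  Finset.univ.filter fun u => u ∈ S ∨ ∃ v ∈ S, H.Adj v u

/-- The number `⌈n / (k + 1)⌉` of components. -/
def ringComponents (n k : ℕ) : ℕ := (n + k) / (k + 1)

/-- The center of the `i`-th component; consecutive centers are `k + 1` apart. -/
def ringCenter (n k : ℕ) (i : Fin (ringComponents n k)) : Fin n :=
  ⟨i * (k + 1), by
    have h : (i : ℕ) + 1 ≤ (n + k) / (k + 1) := i.2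
    have h2 := (Nat.le_div_iff_mul_le (Nat.succ_pos k)).1 h
    have h3 : ((i : ℕ) + 1) * (k + 1) = i * (k + 1) + (k + 1) := by ring
    simp only [Nat.succ_eq_add_one] at h2
    omega⟩

/-- The decomposition of the ring lattice: the components are the closed neighborhoods of the
centers, they are extended by their neighbors, and are arranged in a path. -/
noncomputable def ringDecomposition (n k : ℕ) :
    Decomposition (Fin n) (Fin (ringComponents n k)) where
  probed := ringProbed n k
  tree := SimpleGraph.pathGraph (ringComponents n k)
  bag i := closedNeighborhood (ringProbed n k) {ringCenter n k i}
  ext i := closedNeighborhood (ringProbed n k)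
    (closedNeighborhood (ringProbed n k) {ringCenter n k i})

/-! Lower bound. The `2k` edges at a vertex `v` split into `k` forward and `k` backward ones. If the
forward measurements all speak for one label of `v` and the backward ones for the other, then
exactly `k` of them are flipped whichever label is true, so they say nothing about `v`. This has
probability `p ^ k * (1 - p) ^ k`, and `Z v` misleads with probability `q`. `balancedWeight` is a
common minorant of the two laws for `Y` and `flipVertex v Y`; pairing these two ground truths and
summing over `v` gives `le_minimaxHammingError_of_balanced`.

Upper bounds, edge measurements. If an optimal labeling of `W⋆` is neither `Y` nor `-Y` on `W`, then
it differs from `Y` across a cut that separates `W`, and optimality forces at least half of that cut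
to be flipped (`Decomposition.IsBad.exists_halfCut`). Away from the seam such cuts have at least `2k
- 1` edges (`le_mincutStar`), so `k` flips are needed and a component is bad with probability `O(p ^
k)`. The at most `4k` components near the seam cost only a constant. Components whose indices agree
mod 4 use disjoint edges, which gives an exponential moment of the number of bad components and
hence its concentration (`Decomposition.expect_exp_badCount_sub_le`).

Upper bounds, signs. A good component is known up to a sign. Let `A` be the set of good components
that receive the wrong sign. A boundary of `A` on the path is a violated edge or touches a bad
component, and correcting the signs on `A` changes the vertex cost by exactly `agreement`
(`Decomposition.exists_wrong_components`). The agreement has a positive drift proportional to the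
size of `A`. A bound for all `A` at once comes from weighting `A` by `n⁻¹` to the number of its
boundaries: a set is determined by its boundaries and one bit, so the total weight is at most `2e <
6`, and the weighted exponential penalty has expectation at most 6. Hence `A` has size at most its
agreement plus a multiple of `log n` per boundary, up to constants depending on `q`
(`card_le_of_agreementPenalty`). The budgeted decoder has nonpositive agreement on `A`, and the
number of boundaries is at most `4 K`; this is where the factor `log n` arises.

For the expected error the budget is replaced by a price `lam` per violated edge, and the components
use all edges of the ring, so that no component is exceptional (`hammingDist_penalized_le`). The
error is then linear in the number of bad components, except for a remainder of expectation `O(n⁻¹ ^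
k)`, which the hypothesis `1 / n ≤ p` absorbs.

The program is verified separately: exhaustive search by induction on the number of free signs, the
dynamic program by an invariant for the rows of its table (`EntrySpec.extend`), and the number of
steps by adding up the recursions. -/

/-! ### Expectations as finite sums -/

/-- The probability of the outcome `x`, when each sign of `y` is flipped with probability `r`. -/
noncomputable def flipWeight {α : Type*} [Fintype α] (r : ℝ) (y x : α → ℤˣ) : ℝ :=
  ∏ a, if x a = y a then 1 - r else r

theorem Int.units_sum_eq {M : Type*} [AddCommMonoid M] (y : ℤˣ) (f : ℤˣ → M) :
    ∑ u, f u = f y + f (-y) := by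
  have h : (Finset.univ : Finset ℤˣ) = {1, -1} := rfl
  rw [h, Finset.sum_pair (by decide)]
  rcases Int.units_eq_one_or y with rfl | rfl
  · rfl
  · rw [neg_neg, add_comm]

theorem Int.units_ne_neg (y : ℤˣ) : y ≠ -y := by
  rcases Int.units_eq_one_or y with rfl | rfl <;> decide

theorem flipWeight_nonneg {α : Type*} [Fintype α] {r : ℝ} (h0 : 0 ≤ r) (h1 : r ≤ 1)
    (y x : α → ℤˣ) : 0 ≤ flipWeight r y x :=
  Finset.prod_nonneg fun a _ => by split_ifs <;> linarith

/-- Independence in the form used for the upper bounds: the weight is a product over coordinates,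
and distributing product over sum leaves one two-point expectation per coordinate. -/
theorem sum_flipWeight_mul_prod {α : Type*} [Fintype α] [DecidableEq α] (r : ℝ) (y : α → ℤˣ)
    (g : α → ℤˣ → ℝ) :
    ∑ x, flipWeight r y x * ∏ a, g a (x a) =
      ∏ a, ((1 - r) * g a (y a) + r * g a (-y a)) := by
  have h : ∀ a, (1 - r) * g a (y a) + r * g a (-y a) =
      ∑ u, (if u = y a then 1 - r else r) * g a u := fun a => by
    rw [Int.units_sum_eq (y a), if_pos rfl, if_neg (Int.units_ne_neg _).symm]
  simp_rw [h, Finset.prod_univ_sum, flipWeight, ← Finset.prod_mul_distrib]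
  rw [Fintype.piFinset_univ]

theorem sum_flipWeight {α : Type*} [Fintype α] [DecidableEq α] (r : ℝ) (y : α → ℤˣ) :
    ∑ x, flipWeight r y x = 1 := by
  have h := sum_flipWeight_mul_prod r y fun _ _ => 1
  simpa using h

theorem noisySign_singleton (r : ℝ) (y u : ℤˣ) :
    noisySign r y {u} = ENNReal.ofReal (if u = y then 1 - r else r) := by
  rcases Int.units_eq_one_or y with rfl | rfl <;> rcases Int.units_eq_one_or u with rfl | rfl <;>
    simp [noisySign, show (-1 : ℤˣ) ≠ 1 by decide, show (1 : ℤˣ) ≠ -1 by decide]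

instance noisySign_isFinite (r : ℝ) (y : ℤˣ) : MeasureTheory.IsFiniteMeasure (noisySign r y) :=
  ⟨by simp [noisySign, ENNReal.ofReal_lt_top]⟩

theorem pi_noisySign_singleton {α : Type*} [Fintype α] {r : ℝ} (h0 : 0 ≤ r) (h1 : r ≤ 1)
    (y x : α → ℤˣ) :
    MeasureTheory.Measure.pi (fun a => noisySign r (y a)) {x} =
      ENNReal.ofReal (flipWeight r y x) := by
  rw [MeasureTheory.Measure.pi_singleton, flipWeight, ENNReal.ofReal_prod_of_nonneg]
  · exact Finset.prod_congr rfl fun a _ => noisySign_singleton r _ _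
  · intro a _
    split_ifs <;> linarith

open scoped Classical in
/-- The expectation of a function of the observation. -/
noncomputable def expect {V : Type*} [Fintype V] (G : SimpleGraph V) (p q : ℝ) (Y : V → ℤˣ)
    (f : Observation G → ℝ) : ℝ :=
  ∑ o : Observation G,
    flipWeight p (fun e : G.edgeSet => edgeProd Y e) o.1 * flipWeight q Y o.2 * f o

section Expect

variable {V : Type*} [Fintype V] {G : SimpleGraph V} {p q : ℝ} {Y : V → ℤˣ}

/-- The observation space is finite, so the law is determined by its singletons, where the product
measures factor. Afterwards only finite sums remain. -/
theorem lintegral_observationLaw (hp0 : 0 ≤ p) (hp1 : p ≤ 1) (hq0 : 0 ≤ q) (hq1 : q ≤ 1)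
    {f : Observation G → ℝ} (hf : ∀ o, 0 ≤ f o) :
    ∫⁻ o, ENNReal.ofReal (f o) ∂(observationLaw G p q Y) =
      ENNReal.ofReal (expect G p q Y f) := by
  classical
  rw [MeasureTheory.lintegral_fintype, expect, ENNReal.ofReal_sum_of_nonneg]
  · refine Finset.sum_congr rfl fun o _ => ?_
    obtain ⟨X, Z⟩ := o
    rw [observationLaw, ← Set.singleton_prod_singleton, MeasureTheory.Measure.prod_prod,
      pi_noisySign_singleton hp0 hp1, pi_noisySign_singleton hq0 hq1,
      ← ENNReal.ofReal_mul (flipWeight_nonneg hp0 hp1 _ _), mul_comm,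
      ← ENNReal.ofReal_mul
        (mul_nonneg (flipWeight_nonneg hp0 hp1 _ _) (flipWeight_nonneg hq0 hq1 _ _))]
  · intro o _
    exact mul_nonneg (mul_nonneg (flipWeight_nonneg hp0 hp1 _ _)
      (flipWeight_nonneg hq0 hq1 _ _)) (hf o)

theorem expect_mono (hp0 : 0 ≤ p) (hp1 : p ≤ 1) (hq0 : 0 ≤ q) (hq1 : q ≤ 1)
    {f g : Observation G → ℝ} (h : ∀ o, f o ≤ g o) : expect G p q Y f ≤ expect G p q Y g := by
  classical
  exact Finset.sum_le_sum fun o _ => mul_le_mul_of_nonneg_left (h o)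
    (mul_nonneg (flipWeight_nonneg hp0 hp1 _ _) (flipWeight_nonneg hq0 hq1 _ _))

theorem expect_add (f g : Observation G → ℝ) :
    expect G p q Y (fun o => f o + g o) = expect G p q Y f + expect G p q Y g := by
  simp only [expect, mul_add, Finset.sum_add_distrib]

theorem expect_const_mul (c : ℝ) (f : Observation G → ℝ) :
    expect G p q Y (fun o => c * f o) = c * expect G p q Y f := by
  simp only [expect, Finset.mul_sum]
  exact Finset.sum_congr rfl fun o _ => by ring

open scoped Classical in
theorem expect_mul (f : (G.edgeSet → ℤˣ) → ℝ) (g : (V → ℤˣ) → ℝ) :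
    expect G p q Y (fun o => f o.1 * g o.2) =
      (∑ X, flipWeight p (fun e : G.edgeSet => edgeProd Y e) X * f X) *
        ∑ Z, flipWeight q Y Z * g Z := by
  rw [expect, Fintype.sum_prod_type, Finset.sum_mul_sum]
  exact Finset.sum_congr rfl fun X _ => Finset.sum_congr rfl fun Z _ => by ring

open scoped Classical in
theorem expect_fst (f : (G.edgeSet → ℤˣ) → ℝ) :
    expect G p q Y (fun o => f o.1) =
      ∑ X, flipWeight p (fun e : G.edgeSet => edgeProd Y e) X * f X := by
  have h := expect_mul (G := G) (p := p) (q := q) (Y := Y) f fun _ => 1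
  simpa [sum_flipWeight] using h

open scoped Classical in
theorem expect_snd (g : (V → ℤˣ) → ℝ) :
    expect G p q Y (fun o => g o.2) = ∑ Z, flipWeight q Y Z * g Z := by
  have h := expect_mul (G := G) (p := p) (q := q) (Y := Y) (fun _ => 1) g
  simpa [sum_flipWeight] using h

/-- Markov's inequality for a function that dominates the indicator of `S`. A union bound is
obtained by taking for `f` a sum of several penalties. -/
theorem observationLaw_le_expect (hp0 : 0 ≤ p) (hp1 : p ≤ 1) (hq0 : 0 ≤ q) (hq1 : q ≤ 1)
    {S : Set (Observation G)} {f : Observation G → ℝ} (hf : ∀ o, 0 ≤ f o)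
    (hS : ∀ o ∈ S, 1 ≤ f o) : observationLaw G p q Y S ≤ ENNReal.ofReal (expect G p q Y f) := by
  rw [← lintegral_observationLaw hp0 hp1 hq0 hq1 hf, ← MeasureTheory.lintegral_indicator_one
    (Set.toFinite S).measurableSet]
  refine MeasureTheory.lintegral_mono fun o => ?_
  by_cases ho : o ∈ S
  · simpa [ho] using hS o ho
  · simp [ho]

end Expect

/-- A deterministic estimator bounds the minimax error. -/
theorem minimaxHammingError_le {V : Type*} [Fintype V] {G : SimpleGraph V} {p q c : ℝ}
    (hp0 : 0 ≤ p) (hp1 : p ≤ 1) (hq0 : 0 ≤ q) (hq1 : q ≤ 1) (est : Observation G → V → ℤˣ)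
    (h : ∀ Y : V → ℤˣ, expect G p q Y (fun o => hammingDist (est o) Y) ≤ c) :
    minimaxHammingError G p q ≤ ENNReal.ofReal c := by
  classical
  refine (iInf_le _ fun o => PMF.pure (est o)).trans (iSup_le fun Y => ?_)
  refine le_trans (le_of_eq ?_) (ENNReal.ofReal_le_ofReal (h Y))
  rw [← lintegral_observationLaw hp0 hp1 hq0 hq1 fun o => Nat.cast_nonneg _]
  refine MeasureTheory.lintegral_congr fun o => ?_
  rw [Finset.sum_eq_single (est o)]
  · simp only [PMF.pure_apply, if_true, one_mul, ENNReal.ofReal_natCast]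
  · intro y _ hy
    simp [PMF.pure_apply, hy]
  · simp

/-- An average over the ground truth is a lower bound for the minimax error. -/
theorem le_minimaxHammingError {V : Type*} [Fintype V] [DecidableEq V] {G : SimpleGraph V}
    {p q c : ℝ} (hp0 : 0 ≤ p) (hp1 : p ≤ 1) (hq0 : 0 ≤ q) (hq1 : q ≤ 1)
    (h : ∀ est : Observation G → (V → ℤˣ) → ℝ, (∀ o y, 0 ≤ est o y) → (∀ o, ∑ y, est o y = 1) →
      ∑ _Y : V → ℤˣ, c ≤
        ∑ Y : V → ℤˣ, expect G p q Y (fun o => ∑ y, est o y * (hammingDist y Y : ℝ))) :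
    ENNReal.ofReal c ≤ minimaxHammingError G p q := by
  refine le_iInf fun est => ?_
  have hne : (Finset.univ : Finset (V → ℤˣ)).Nonempty := ⟨fun _ => 1, Finset.mem_univ _⟩
  obtain ⟨Y, -, hY⟩ := Finset.exists_le_of_sum_le hne (h (fun o y => (est o y).toReal)
    (fun o y => ENNReal.toReal_nonneg) fun o => by
      have h1 := (est o).tsum_coe
      rw [tsum_fintype] at h1
      rw [← ENNReal.toReal_sum fun y _ => (est o).apply_ne_top y, h1, ENNReal.toReal_one])
  refine le_iSup_of_le Y ((ENNReal.ofReal_le_ofReal hY).trans ?_)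
  rw [← lintegral_observationLaw hp0 hp1 hq0 hq1 fun o => Finset.sum_nonneg fun y _ =>
    mul_nonneg ENNReal.toReal_nonneg (Nat.cast_nonneg _)]
  refine le_of_eq (MeasureTheory.lintegral_congr fun o => ?_)
  rw [ENNReal.ofReal_sum_of_nonneg fun y _ =>
    mul_nonneg ENNReal.toReal_nonneg (Nat.cast_nonneg _)]
  simp only [ENNReal.ofReal_mul ENNReal.toReal_nonneg, ENNReal.ofReal_natCast,
    ENNReal.ofReal_toReal ((est o).apply_ne_top _)]
  congr!

/-! ### The lower bound -/

section FlipVertex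

variable {V : Type*} [DecidableEq V]

/-- The labeling `Y` with the label of `v` negated. -/
def flipVertex (v : V) (Y : V → ℤˣ) : V → ℤˣ := Function.update Y v (-Y v)

theorem flipVertex_self (v : V) (Y : V → ℤˣ) : flipVertex v Y v = -Y v := by simp [flipVertex]

theorem flipVertex_of_ne {v u : V} (h : u ≠ v) (Y : V → ℤˣ) : flipVertex v Y u = Y u := by
  simp [flipVertex, h]

theorem flipVertex_flipVertex (v : V) (Y : V → ℤˣ) : flipVertex v (flipVertex v Y) = Y := by
  simp [flipVertex]

theorem edgeProd_mk {V : Type*} (Y : V → ℤˣ) (u v : V) : edgeProd Y s(u, v) = Y u * Y v := rfl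

theorem edgeProd_flipVertex_of_mem {v : V} {e : Sym2 V} (hv : v ∈ e) (he : ¬ e.IsDiag)
    (Y : V → ℤˣ) : edgeProd (flipVertex v Y) e = -edgeProd Y e := by
  obtain ⟨w, rfl⟩ := hv
  have hw : w ≠ v := fun h => he (by simp [h])
  rw [edgeProd_mk, edgeProd_mk, flipVertex_self, flipVertex_of_ne hw, neg_mul]

theorem edgeProd_flipVertex_of_notMem {v : V} {e : Sym2 V} (hv : v ∉ e) (Y : V → ℤˣ) :
    edgeProd (flipVertex v Y) e = edgeProd Y e := by
  induction e with
  | h a b =>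
    simp only [Sym2.mem_iff, not_or] at hv
    rw [edgeProd_mk, edgeProd_mk, flipVertex_of_ne (Ne.symm hv.1), flipVertex_of_ne (Ne.symm hv.2)]

end FlipVertex

section LowerBound

open scoped Classical

variable {V : Type*} [Fintype V] {G : SimpleGraph V} {p q : ℝ}

/-- The value that the measurement of an edge at `v` takes if it carries a signal in favour of
the label `1` of `v` (for edges in `fwd`) or of the label `-1` (for the other edges). -/
noncomputable def balancedValue (fwd : V → G.edgeSet → Prop) (v : V) (Y : V → ℤˣ)
    (e : G.edgeSet) : ℤˣ :=
  (if fwd v e then Y v else -Y v) * edgeProd Y e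

/-- A common lower bound for the probabilities of the observation under `Y` and under
`flipVertex v Y`: it charges only balanced measurements at `v`. -/
noncomputable def balancedWeight (fwd : V → G.edgeSet → Prop) (k : ℕ) (p q : ℝ) (v : V)
    (Y : V → ℤˣ) (o : Observation G) : ℝ :=
  (p ^ k * (1 - p) ^ k * ∏ e : G.edgeSet, if v ∈ (e : Sym2 V) then
      (if o.1 e = balancedValue fwd v Y e then 1 else 0)
      else (if o.1 e = edgeProd Y e then 1 - p else p)) *
    ∏ u, if u = v then q else (if o.2 u = Y u then 1 - q else q)

/-- At an edge containing `v` both `Y v` and `edgeProd Y e` change sign, so the prescribed value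
stays the same; all other factors do not involve the label of `v`. -/
theorem balancedWeight_flipVertex (fwd : V → G.edgeSet → Prop) (k : ℕ) (p q : ℝ) (v : V)
    (Y : V → ℤˣ) (o : Observation G) :
    balancedWeight fwd k p q v (flipVertex v Y) o = balancedWeight fwd k p q v Y o := by
  unfold balancedWeight
  refine congrArg₂ (· * ·) (congrArg _ ?_) ?_
  · refine Finset.prod_congr rfl fun e _ => ?_
    by_cases hv : v ∈ (e : Sym2 V)
    · have h : balancedValue fwd v (flipVertex v Y) e = balancedValue fwd v Y e := by
        rw [balancedValue, balancedValue, edgeProd_flipVertex_of_mem hv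
          (G.not_isDiag_of_mem_edgeSet e.2), flipVertex_self]
        split_ifs <;> simp
      rw [h]
      simp [hv]
    · simp only [if_neg hv, edgeProd_flipVertex_of_notMem hv]
  · refine Finset.prod_congr rfl fun u _ => ?_
    by_cases hu : u = v
    · simp [hu]
    · simp only [if_neg hu, flipVertex_of_ne hu]

/-- If some measurement at `v` is not balanced, the left side vanishes. Otherwise `k` measurements
at `v` are right and `k` are wrong, which accounts for `p ^ k * (1 - p) ^ k` exactly. The only loss
is `q ≤ 1 - q` at the vertex measurement of `v`. -/
theorem balancedWeight_le {fwd : V → G.edgeSet → Prop} {k : ℕ} (hp0 : 0 ≤ p) (hp1 : p ≤ 1)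
    (hq0 : 0 ≤ q) (hq1 : q ≤ 1 / 2) (v : V)
    (hfwd : (Finset.univ.filter fun e : G.edgeSet => v ∈ (e : Sym2 V) ∧ fwd v e).card = k)
    (hbwd : (Finset.univ.filter fun e : G.edgeSet => v ∈ (e : Sym2 V) ∧ ¬ fwd v e).card = k)
    (Y : V → ℤˣ) (o : Observation G) :
    balancedWeight fwd k p q v Y o ≤
      flipWeight p (fun e : G.edgeSet => edgeProd Y e) o.1 * flipWeight q Y o.2 := by
  obtain ⟨X, Z⟩ := o
  have hp : 0 ≤ 1 - p := by linarith
  have hW := flipWeight_nonneg hp0 hp1 (fun e : G.edgeSet => edgeProd Y e) X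
  refine mul_le_mul ?_ ?_ (Finset.prod_nonneg fun u _ => by split_ifs <;> linarith) hW
  · by_cases hX : ∀ e : G.edgeSet, v ∈ (e : Sym2 V) → X e = balancedValue fwd v Y e
    -- `a` and `b` are the probabilities of the prescribed value on forward and backward edges. The
    -- label of `v` decides which of them is `p`, but the product of their `k`-th powers does not
    -- depend on it.
    · set a : ℝ := if Y v = 1 then 1 - p else p with ha
      set b : ℝ := if Y v = 1 then p else 1 - p with hb
      have hab : p ^ k * (1 - p) ^ k = a ^ k * b ^ k := by
        rw [ha, hb]
        split_ifs
        · rw [mul_comm]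
        · rfl
      have h1 : flipWeight p (fun e : G.edgeSet => edgeProd Y e) X =
          ∏ e : G.edgeSet, ((if v ∈ (e : Sym2 V) ∧ fwd v e then a else 1) *
            (if v ∈ (e : Sym2 V) ∧ ¬ fwd v e then b else 1)) *
            (if v ∈ (e : Sym2 V) then 1 else (if X e = edgeProd Y e then 1 - p else p)) := by
        refine Finset.prod_congr rfl fun e _ => ?_
        by_cases hv : v ∈ (e : Sym2 V)
        · have h2 := hX e hv
          rw [balancedValue] at h2
          rw [h2, ha, hb]
          rcases Int.units_eq_one_or (Y v) with hY | hY <;> by_cases hf : fwd v e <;>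
            simp [hv, hf, hY, (Int.units_ne_neg _).symm]
        · simp [hv]
      clear_value a b
      rw [h1, Finset.prod_mul_distrib, Finset.prod_mul_distrib, hab]
      refine le_of_eq ?_
      congr 1
      · rw [Finset.prod_ite, Finset.prod_ite]
        simp [hfwd, hbwd]
      · refine Finset.prod_congr rfl fun e _ => ?_
        by_cases hv : v ∈ (e : Sym2 V)
        · simp [hv, hX e hv]
        · simp [hv]
    · push Not at hX
      obtain ⟨e, he, hne⟩ := hX
      rw [Finset.prod_eq_zero (Finset.mem_univ e) (by simp [he, hne]), mul_zero]
      exact hW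
  · refine Finset.prod_le_prod (fun u _ => by split_ifs <;> linarith) fun u _ => ?_
    split_ifs <;> linarith

/-- Edges at `v` have a single admissible value, all other coordinates except `Z v` are normalized,
and `Z v` contributes `q` for each of its two values. -/
theorem sum_balancedWeight (fwd : V → G.edgeSet → Prop) (k : ℕ) (p q : ℝ) (v : V) (Y : V → ℤˣ) :
    ∑ o, balancedWeight fwd k p q v Y o = p ^ k * (1 - p) ^ k * (2 * q) := by
  have h1 : ∑ X : G.edgeSet → ℤˣ, ∏ e : G.edgeSet, (if v ∈ (e : Sym2 V) then
      (if X e = balancedValue fwd v Y e then (1 : ℝ) else 0)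
      else (if X e = edgeProd Y e then 1 - p else p)) = 1 := by
    have h := (Finset.prod_univ_sum (fun _ : G.edgeSet => (Finset.univ : Finset ℤˣ))
      fun e x => if v ∈ (e : Sym2 V) then
        (if x = balancedValue fwd v Y e then (1 : ℝ) else 0)
        else (if x = edgeProd Y e then 1 - p else p)).symm
    rw [Fintype.piFinset_univ] at h
    rw [h]
    refine Finset.prod_eq_one fun e _ => ?_
    by_cases hv : v ∈ (e : Sym2 V)
    · simp only [if_pos hv]
      rw [Int.units_sum_eq (balancedValue fwd v Y e)]
      simp [(Int.units_ne_neg _).symm]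
    · simp only [if_neg hv]
      rw [Int.units_sum_eq (edgeProd Y e)]
      simp [(Int.units_ne_neg _).symm]
  have h2 : ∑ Z : V → ℤˣ, ∏ u, (if u = v then q else (if Z u = Y u then 1 - q else q)) =
      2 * q := by
    have h := (Finset.prod_univ_sum (fun _ : V => (Finset.univ : Finset ℤˣ))
      fun u z => if u = v then q else (if z = Y u then 1 - q else q)).symm
    rw [Fintype.piFinset_univ] at h
    rw [h, Finset.prod_eq_single v]
    · simp only [if_true]
      rw [Int.units_sum_eq 1]
      ring
    · intro u _ hu
      simp only [if_neg hu]
      rw [Int.units_sum_eq (Y u)]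
      simp [(Int.units_ne_neg _).symm]
    · simp
  calc ∑ o, balancedWeight fwd k p q v Y o
      = ∑ X : G.edgeSet → ℤˣ, ∑ Z : V → ℤˣ, balancedWeight fwd k p q v Y (X, Z) :=
        Fintype.sum_prod_type (balancedWeight fwd k p q v Y)
    _ = (∑ X : G.edgeSet → ℤˣ, p ^ k * (1 - p) ^ k * ∏ e : G.edgeSet, (if v ∈ (e : Sym2 V) then
          (if X e = balancedValue fwd v Y e then (1 : ℝ) else 0)
          else (if X e = edgeProd Y e then 1 - p else p))) *
        ∑ Z : V → ℤˣ, ∏ u, (if u = v then q else (if Z u = Y u then 1 - q else q)) := by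
        rw [Finset.sum_mul_sum]
        rfl
    _ = _ := by rw [← Finset.mul_sum, h1, h2, mul_one]

/-- Two-point argument: of the two ground truths `Y` and `flipVertex v Y` the guess `y` is wrong at
`v` for exactly one, and both have weight at least `balancedWeight`. The factor 2 appears since one
copy of the sum is reindexed by the flip. -/
theorem sum_balancedWeight_le {fwd : V → G.edgeSet → Prop} {k : ℕ} (hp0 : 0 ≤ p) (hp1 : p ≤ 1)
    (hq0 : 0 ≤ q) (hq1 : q ≤ 1 / 2) (v : V)
    (hfwd : (Finset.univ.filter fun e : G.edgeSet => v ∈ (e : Sym2 V) ∧ fwd v e).card = k)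
    (hbwd : (Finset.univ.filter fun e : G.edgeSet => v ∈ (e : Sym2 V) ∧ ¬ fwd v e).card = k)
    (y : V → ℤˣ) (o : Observation G) :
    ∑ Y : V → ℤˣ, balancedWeight fwd k p q v Y o ≤
      2 * ∑ Y : V → ℤˣ, flipWeight p (fun e : G.edgeSet => edgeProd Y e) o.1 *
        flipWeight q Y o.2 * (if y v ≠ Y v then 1 else 0) := by
  set P : (V → ℤˣ) → ℝ := fun Y =>
    flipWeight p (fun e : G.edgeSet => edgeProd Y e) o.1 * flipWeight q Y o.2 with hP
  have hle : ∀ Y, balancedWeight fwd k p q v Y o ≤ P Y :=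
    fun Y => balancedWeight_le hp0 hp1 hq0 hq1 v hfwd hbwd Y o
  have h1 : ∑ Y : V → ℤˣ, P Y * (if y v ≠ Y v then 1 else 0) =
      ∑ Y : V → ℤˣ, P (flipVertex v Y) * (if y v ≠ flipVertex v Y v then 1 else 0) :=
    (Equiv.sum_comp (Function.Involutive.toPerm _ (flipVertex_flipVertex (V := V) v))
      fun Y => P Y * (if y v ≠ Y v then 1 else 0)).symm
  rw [two_mul]
  nth_rw 2 [h1]
  rw [← Finset.sum_add_distrib]
  refine Finset.sum_le_sum fun Y _ => ?_
  by_cases hy : y v = Y v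
  · rw [flipVertex_self, hy]
    simp only [ne_eq, not_true, if_false, mul_zero, zero_add, Int.units_ne_neg, not_false_iff,
      if_true, mul_one]
    rw [← balancedWeight_flipVertex]
    exact hle _
  · have hy' : y v = -Y v := by
      rcases Int.units_eq_one_or (y v) with h | h <;>
      rcases Int.units_eq_one_or (Y v) with h' | h' <;> simp_all
    rw [flipVertex_self, hy']
    simp only [ne_eq, not_true, if_false, mul_zero, add_zero, (Int.units_ne_neg _).symm,
      not_false_iff, if_true, mul_one]
    exact hle _

/-- If at each vertex there are `2k` edges, then with probability of order `p ^ k` they carry no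
information on its label. -/
theorem le_minimaxHammingError_of_balanced {fwd : V → G.edgeSet → Prop} {k : ℕ}
    (hp0 : 0 ≤ p) (hp1 : p ≤ 1) (hq0 : 0 ≤ q) (hq1 : q ≤ 1 / 2)
    (hfwd : ∀ v, (Finset.univ.filter fun e : G.edgeSet => v ∈ (e : Sym2 V) ∧ fwd v e).card = k)
    (hbwd : ∀ v,
      (Finset.univ.filter fun e : G.edgeSet => v ∈ (e : Sym2 V) ∧ ¬ fwd v e).card = k) :
    ENNReal.ofReal (Fintype.card V * (p ^ k * (1 - p) ^ k * q)) ≤ minimaxHammingError G p q := by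
  refine le_minimaxHammingError hp0 hp1 hq0 (by linarith) fun est hest0 hest1 => ?_
  set P : (V → ℤˣ) → Observation G → ℝ := fun Y o =>
    flipWeight p (fun e : G.edgeSet => edgeProd Y e) o.1 * flipWeight q Y o.2 with hP
  have h1 : ∑ Y : V → ℤˣ, expect G p q Y (fun o => ∑ y, est o y * (hammingDist y Y : ℝ)) =
      ∑ v, ∑ o, ∑ y, est o y * ∑ Y : V → ℤˣ, P Y o * (if y v ≠ Y v then 1 else 0) := by
    have h2 : ∀ y Y : V → ℤˣ, (hammingDist y Y : ℝ) = ∑ v, if y v ≠ Y v then 1 else 0 :=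
      fun y Y => by
      rw [hammingDist, Finset.card_filter, Nat.cast_sum]
      exact Finset.sum_congr rfl fun v _ => by split_ifs <;> simp
    simp only [expect, h2, Finset.mul_sum]
    rw [Finset.sum_comm' (t' := Finset.univ) (s' := fun _ => Finset.univ) (by simp)]
    rw [Finset.sum_comm' (s := (Finset.univ : Finset V)) (t' := Finset.univ)
      (s' := fun _ => Finset.univ) (by simp)]
    refine Finset.sum_congr rfl fun o _ => ?_
    rw [Finset.sum_comm]
    conv_rhs => rw [Finset.sum_comm]
    refine Finset.sum_congr rfl fun y _ => ?_
    rw [Finset.sum_comm]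
    refine Finset.sum_congr rfl fun v _ => Finset.sum_congr rfl fun Y _ => ?_
    simp only [hP]
    ring
  rw [h1]
  have h3 : ∀ v, ∑ _Y : V → ℤˣ, p ^ k * (1 - p) ^ k * q ≤
      ∑ o, ∑ y, est o y * ∑ Y : V → ℤˣ, P Y o * (if y v ≠ Y v then 1 else 0) := by
    intro v
    have h4 : ∀ o, (∑ Y : V → ℤˣ, balancedWeight fwd k p q v Y o) / 2 ≤
        ∑ y, est o y * ∑ Y : V → ℤˣ, P Y o * (if y v ≠ Y v then 1 else 0) := fun o => by
      calc (∑ Y : V → ℤˣ, balancedWeight fwd k p q v Y o) / 2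
          = ∑ y, est o y * ((∑ Y : V → ℤˣ, balancedWeight fwd k p q v Y o) / 2) := by
            rw [← Finset.sum_mul, hest1, one_mul]
        _ ≤ _ := Finset.sum_le_sum fun y _ => mul_le_mul_of_nonneg_left (by
            have := sum_balancedWeight_le hp0 hp1 hq0 hq1 v (hfwd v) (hbwd v) y o
            linarith) (hest0 o y)
    refine le_trans (le_of_eq ?_) (Finset.sum_le_sum fun o _ => h4 o)
    rw [← Finset.sum_div, Finset.sum_comm]
    simp only [sum_balancedWeight]
    rw [Finset.sum_div]
    exact Finset.sum_congr rfl fun Y _ => by ring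
  calc ∑ _Y : V → ℤˣ, Fintype.card V * (p ^ k * (1 - p) ^ k * q)
      = ∑ _v : V, ∑ _Y : V → ℤˣ, p ^ k * (1 - p) ^ k * q := by
        simp only [Finset.sum_const, nsmul_eq_mul, Finset.card_univ]
        ring
    _ ≤ _ := Finset.sum_le_sum fun v _ => h3 v

end LowerBound

/-! ### The ring lattice: neighborhoods -/

theorem Nat.add_mod_cases {n a d : ℕ} (ha : a < n) (hd : d ≤ n) :
    (a + d) % n = a + d ∧ a + d < n ∨ (a + d) % n = a + d - n ∧ n ≤ a + d := by
  rcases Nat.lt_or_ge (a + d) n with h | h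
  · exact Or.inl ⟨Nat.mod_eq_of_lt h, h⟩
  · rw [Nat.mod_eq_sub_mod h, Nat.mod_eq_of_lt (by omega)]
    exact Or.inr ⟨rfl, h⟩

/-- The vertex `d` steps after `v` on the ring. -/
def ringShift {n : ℕ} (v : Fin n) (d : ℕ) : Fin n :=
  ⟨(v + d) % n, Nat.mod_lt _ (Nat.zero_lt_of_lt v.2)⟩

theorem ringShift_inj {n : ℕ} {v : Fin n} {d e : ℕ} (hd : d < n) (he : e < n)
    (h : ringShift v d = ringShift v e) : d = e := by
  have h1 : ((v : ℕ) + d) % n = (v + e) % n := congrArg Fin.val h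
  have := v.2
  rcases Nat.add_mod_cases this hd.le with h2 | h2 <;>
    rcases Nat.add_mod_cases this he.le with h3 | h3 <;> omega

theorem ringShift_zero {n : ℕ} (v : Fin n) : ringShift v 0 = v :=
  Fin.ext (Nat.mod_eq_of_lt v.2)

/-- A step of `d` backwards is a step of `n - d` forwards. The shift in `[0, n)` is unique by
`ringShift_inj`, and as `2 * k + 1 ≤ n` the two ranges are disjoint, so the edges at a vertex can be
counted by shifts. -/
theorem ringLattice_adj_iff {n k : ℕ} (hn : 2 * k + 1 ≤ n) (v w : Fin n) :
    (ringLattice n k).Adj v w ↔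
      ∃ d, (1 ≤ d ∧ d ≤ k ∨ n - k ≤ d ∧ d < n) ∧ w = ringShift v d := by
  have hv := v.2
  have hw := w.2
  constructor
  · rintro ⟨-, d, h1, h2, h | h⟩
    · exact ⟨d, Or.inl ⟨h1, h2⟩, Fin.ext h⟩
    · refine ⟨n - d, Or.inr ⟨by omega, by omega⟩, Fin.ext ?_⟩
      change (w : ℕ) = (v + (n - d)) % n
      rcases Nat.add_mod_cases hw (show d ≤ n by omega) with h3 | h3 <;>
        rcases Nat.add_mod_cases hv (show n - d ≤ n by omega) with h4 | h4 <;> omega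
  · rintro ⟨d, hd, rfl⟩
    have hne : v ≠ ringShift v d := fun h => by
      have := ringShift_inj (by omega) (by omega) ((ringShift_zero v).trans h)
      omega
    refine ⟨hne, ?_⟩
    rcases hd with hd | hd
    · exact ⟨d, hd.1, hd.2, Or.inl rfl⟩
    · refine ⟨n - d, by omega, by omega, Or.inr ?_⟩
      change (v : ℕ) = ((v + d) % n + (n - d)) % n
      rcases Nat.add_mod_cases hv (show d ≤ n by omega) with h3 | h3 <;>
        rcases Nat.add_mod_cases (Nat.mod_lt (v + d) (by omega : 0 < n))
          (show n - d ≤ n by omega) with h4 | h4 <;> omega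

open scoped Classical in
theorem card_ringLattice_edges {n k : ℕ} (hn : 2 * k + 1 ≤ n) (v : Fin n) (S : Finset ℕ)
    (hS : ∀ d ∈ S, 1 ≤ d ∧ d ≤ k ∨ n - k ≤ d ∧ d < n) :
    (Finset.univ.filter fun e : (ringLattice n k).edgeSet =>
      ∃ d ∈ S, (e : Sym2 (Fin n)) = s(v, ringShift v d)).card = S.card := by
  symm
  refine Finset.card_bij (fun d hd => ⟨s(v, ringShift v d),
    (ringLattice_adj_iff hn _ _).2 ⟨d, hS d hd, rfl⟩⟩) ?_ ?_ ?_
  · intro d hd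
    exact Finset.mem_filter.2 ⟨Finset.mem_univ _, d, hd, rfl⟩
  · intro d hd e he h
    have h1 := hS d hd
    have h2 := hS e he
    refine ringShift_inj (v := v) (by omega) (by omega) ?_
    exact Sym2.congr_right.1 (congrArg Subtype.val h)
  · intro e he
    obtain ⟨-, d, hd, h⟩ := Finset.mem_filter.1 he
    exact ⟨d, hd, Subtype.ext h.symm⟩

/-- The lower bound on the minimax error of the ring lattice. -/
theorem ringLattice_le_minimaxHammingError {n k : ℕ} (hn : 2 * k + 1 ≤ n) {p q : ℝ} (hp0 : 0 ≤ p)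
    (hp1 : p ≤ 1) (hq0 : 0 ≤ q) (hq1 : q ≤ 1 / 2) :
    ENNReal.ofReal (n * (p ^ k * (1 - p) ^ k * q)) ≤
      minimaxHammingError (ringLattice n k) p q := by
  classical
  have h := le_minimaxHammingError_of_balanced (G := ringLattice n k) (k := k)
    (fwd := fun v e => ∃ d ∈ Finset.Icc 1 k, (e : Sym2 (Fin n)) = s(v, ringShift v d))
    hp0 hp1 hq0 hq1 ?_ ?_
  · rwa [Fintype.card_fin] at h
  · intro v
    have h1 := card_ringLattice_edges hn v (Finset.Icc 1 k)
      fun d hd => Or.inl (Finset.mem_Icc.1 hd)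
    rw [Nat.card_Icc, Nat.add_sub_cancel] at h1
    refine Eq.trans (congrArg Finset.card (Finset.ext fun e => ?_)) h1
    simp only [Finset.mem_filter, Finset.mem_univ, true_and, and_iff_right_iff_imp]
    rintro ⟨d, -, h⟩
    rw [h]
    exact Sym2.mem_mk_left _ _
  · intro v
    have h1 := card_ringLattice_edges hn v (Finset.Ico (n - k) n)
      fun d hd => Or.inr (Finset.mem_Ico.1 hd)
    rw [Nat.card_Ico, show n - (n - k) = k by omega] at h1
    refine Eq.trans (congrArg Finset.card (Finset.ext fun ⟨e, he⟩ => ?_)) h1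
    simp only [Finset.mem_filter, Finset.mem_univ, true_and]
    constructor
    · rintro ⟨⟨w, rfl⟩, h⟩
      obtain ⟨d, hd | hd, rfl⟩ := (ringLattice_adj_iff hn v w).1 he
      · exact absurd ⟨d, Finset.mem_Icc.2 hd, rfl⟩ h
      · exact ⟨d, Finset.mem_Ico.2 hd, rfl⟩
    · rintro ⟨d, hd, rfl⟩
      refine ⟨Sym2.mem_mk_left _ _, ?_⟩
      rintro ⟨d', hd', h⟩
      have h2 := Finset.mem_Ico.1 hd
      have h3 := Finset.mem_Icc.1 hd'
      have := ringShift_inj (v := v) (by omega) (by omega) (Sym2.congr_right.1 h)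
      omega

/-! ### Closed neighborhoods and their sizes. -/

theorem mem_closedNeighborhood {V : Type*} [Fintype V] {H : SimpleGraph V} {S : Finset V} {u : V} :
    u ∈ closedNeighborhood H S ↔ u ∈ S ∨ ∃ v ∈ S, H.Adj v u := by
  simp [closedNeighborhood]

theorem subset_closedNeighborhood {V : Type*} [Fintype V] (H : SimpleGraph V) (S : Finset V) :
    S ⊆ closedNeighborhood H S :=
  fun _ hu => mem_closedNeighborhood.2 (Or.inl hu)

theorem mem_closedNeighborhood_singleton {V : Type*} [Fintype V] {H : SimpleGraph V} {u v : V} :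
    u ∈ closedNeighborhood H {v} ↔ u = v ∨ H.Adj v u := by
  simp [mem_closedNeighborhood]

theorem mem_closedNeighborhood_singleton_comm {V : Type*} [Fintype V] {H : SimpleGraph V}
    {u v : V} : u ∈ closedNeighborhood H {v} ↔ v ∈ closedNeighborhood H {u} := by
  rw [mem_closedNeighborhood_singleton, mem_closedNeighborhood_singleton, eq_comm,
    SimpleGraph.adj_comm]

theorem mem_closedNeighborhood_iff {V : Type*} [Fintype V] {H : SimpleGraph V} {S : Finset V}
    {u : V} : u ∈ closedNeighborhood H S ↔ ∃ v ∈ S, u ∈ closedNeighborhood H {v} := by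
  simp only [mem_closedNeighborhood_singleton]
  rw [mem_closedNeighborhood]
  constructor
  · rintro (h | ⟨v, h, h'⟩)
    exacts [⟨u, h, Or.inl rfl⟩, ⟨v, h, Or.inr h'⟩]
  · rintro ⟨v, h, rfl | h'⟩
    exacts [Or.inl h, Or.inr ⟨v, h, h'⟩]

/-- The relation of being at distance at most `2` is symmetric. -/
theorem mem_closedNeighborhood_twice_comm {V : Type*} [Fintype V] {H : SimpleGraph V} {u v : V} :
    u ∈ closedNeighborhood H (closedNeighborhood H {v}) ↔
      v ∈ closedNeighborhood H (closedNeighborhood H {u}) := by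
  rw [mem_closedNeighborhood_iff, mem_closedNeighborhood_iff]
  constructor <;>
  · rintro ⟨w, h1, h2⟩
    exact ⟨w, mem_closedNeighborhood_singleton_comm.1 h2,
      mem_closedNeighborhood_singleton_comm.1 h1⟩

theorem card_closedNeighborhood_le {n k : ℕ} (hn : 2 * k + 1 ≤ n) {H : SimpleGraph (Fin n)}
    (hH : H ≤ ringLattice n k) (S : Finset (Fin n)) :
    (closedNeighborhood H S).card ≤ S.card * (2 * k + 1) := by
  classical
  have h1 : ∀ v, (closedNeighborhood H {v}).card ≤ 2 * k + 1 := fun v => by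
    have h2 : closedNeighborhood H {v} ⊆
        (Finset.Icc 0 k ∪ Finset.Ico (n - k) n).image (ringShift v) := fun u hu => by
      rcases mem_closedNeighborhood_singleton.1 hu with rfl | hu
      · exact Finset.mem_image.2 ⟨0, by simp, ringShift_zero u⟩
      · obtain ⟨d, hd, rfl⟩ := (ringLattice_adj_iff hn _ _).1 (hH hu)
        refine Finset.mem_image.2 ⟨d, ?_, rfl⟩
        rw [Finset.mem_union, Finset.mem_Icc, Finset.mem_Ico]
        omega
    refine (Finset.card_le_card h2).trans (Finset.card_image_le.trans
      ((Finset.card_union_le _ _).trans ?_))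
    rw [Nat.card_Icc, Nat.card_Ico]
    omega
  have h3 : closedNeighborhood H S = S.biUnion fun v => closedNeighborhood H {v} := by
    ext u
    rw [mem_closedNeighborhood_iff, Finset.mem_biUnion]
  rw [h3]
  exact Finset.card_biUnion_le_card_mul _ _ _ fun v _ => h1 v

theorem ringProbed_le {n k : ℕ} : ringProbed n k ≤ ringLattice n k := by
  rintro u v ⟨hne, h1, h2⟩
  have hne' : (u : ℕ) ≠ v := fun h => hne (Fin.ext h)
  rcases Nat.lt_or_ge u v with h | h
  · exact ⟨hne, v - u, by omega, by omega, Or.inl (by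
      rw [Nat.add_sub_cancel' h.le, Nat.mod_eq_of_lt v.2])⟩
  · exact ⟨hne, u - v, by omega, by omega, Or.inr (by
      rw [Nat.add_sub_cancel' h, Nat.mod_eq_of_lt u.2])⟩

/-! ### Wrongly decoded components -/

section Bad

open scoped Classical

variable {V ι : Type*} [Fintype V] {G : SimpleGraph V} (D : Decomposition V ι)

/-- Some optimal labeling of `W⋆` restricts to `W` neither as `Y` nor as `-Y`. -/
def Decomposition.IsBad (G : SimpleGraph V) (Y : V → ℤˣ) (X : G.edgeSet → ℤˣ) (i : ι) : Prop :=
  ∃ y : V → ℤˣ, (∀ y', D.localCost G X i y ≤ D.localCost G X i y') ∧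
    ¬ ∃ t : ℤˣ, ∀ v ∈ D.bag i, y v = t * Y v

/-- The sets of `⌈mincut⋆(W) / 2⌉` edges of `W⋆`. -/
noncomputable def Decomposition.halfCuts (G : SimpleGraph V) (i : ι) :
    Finset (Finset G.edgeSet) :=
  (D.localEdges G i).powersetCard ((D.mincutStar G i + 1) / 2)

theorem Int.units_eq_neg_of_ne {a b : ℤˣ} (h : a ≠ b) : a = -b := by
  rcases Int.units_eq_one_or a with rfl | rfl <;> rcases Int.units_eq_one_or b with rfl | rfl <;>
    simp_all

/-- If `W` is decoded wrongly, then half of a cut is flipped. -/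
theorem Decomposition.IsBad.exists_halfCut {Y : V → ℤˣ} {X : G.edgeSet → ℤˣ} {i : ι}
    (hsub : D.bag i ⊆ D.ext i) (h : D.IsBad G Y X i) :
    ∃ F ∈ D.halfCuts G i, ∀ e : G.edgeSet, e ∈ F → X e ≠ edgeProd Y e := by
  obtain ⟨y, hy, ht⟩ := h
  push Not at ht
  -- The cut to be charged is the one between the vertices where `y` and `Y` disagree and those
  -- where they agree.
  set S : Finset V := (D.ext i).filter fun v => y v ≠ Y v with hS
  set cut : Finset G.edgeSet := (D.localEdges G i).filter fun e : G.edgeSet =>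
    ∃ u ∈ S, ∃ v ∉ S, (e : Sym2 V) = s(u, v) with hcut
  have hmin : D.mincutStar G i ≤ cut.card := by
    refine Nat.sInf_le ⟨S, Finset.filter_subset _ _, ?_, ?_, rfl⟩
    -- That `y` is not `Y` on `W` makes `S` meet `W`; that it is not `-Y` makes `S` miss a vertex of
    -- `W`. So `S` is admissible for `mincutStar`.
    · obtain ⟨v, hv, hne⟩ := ht 1
      rw [one_mul] at hne
      exact ⟨v, hv, Finset.mem_filter.2 ⟨hsub hv, hne⟩⟩
    · obtain ⟨v, hv, hne⟩ := ht (-1)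
      refine ⟨v, hv, fun hvS => hne ?_⟩
      rw [neg_mul, one_mul]
      exact Int.units_eq_neg_of_ne (Finset.mem_filter.1 hvS).2
  have hprod : ∀ e : G.edgeSet, e ∈ D.localEdges G i → edgeProd y e =
      if e ∈ cut then -edgeProd Y e else edgeProd Y e := by
    intro e he
    have hext := (Finset.mem_filter.1 he).2.2
    obtain ⟨e, hG⟩ := e
    induction e using Sym2.ind with
    | h a b =>
      have ha : a ∈ D.ext i := hext a (Sym2.mem_mk_left _ _)
      have hb : b ∈ D.ext i := hext b (Sym2.mem_mk_right _ _)
      have hiff : (⟨s(a, b), hG⟩ : G.edgeSet) ∈ cut ↔ (a ∈ S ∧ b ∉ S ∨ b ∈ S ∧ a ∉ S) := by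
        rw [hcut, Finset.mem_filter, and_iff_right he]
        constructor
        · rintro ⟨u, hu, v, hv, huv⟩
          rcases Sym2.eq_iff.1 huv with ⟨rfl, rfl⟩ | ⟨rfl, rfl⟩
          exacts [Or.inl ⟨hu, hv⟩, Or.inr ⟨hu, hv⟩]
        · rintro (⟨h1, h2⟩ | ⟨h1, h2⟩)
          exacts [⟨a, h1, b, h2, rfl⟩, ⟨b, h1, a, h2, Sym2.eq_swap⟩]
      have hSa : a ∈ S ↔ y a ≠ Y a := by rw [hS, Finset.mem_filter, and_iff_right ha]
      have hSb : b ∈ S ↔ y b ≠ Y b := by rw [hS, Finset.mem_filter, and_iff_right hb]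
      simp only [hiff, hSa, hSb, edgeProd_mk]
      by_cases h1 : y a = Y a <;> by_cases h2 : y b = Y b
      · simp [h1, h2]
      · simp [h1, Int.units_eq_neg_of_ne h2, (Int.units_ne_neg _).symm]
      · simp [h2, Int.units_eq_neg_of_ne h1, (Int.units_ne_neg _).symm]
      · simp [Int.units_eq_neg_of_ne h1, Int.units_eq_neg_of_ne h2, (Int.units_ne_neg _).symm]
  set bad : Finset G.edgeSet := cut.filter fun e : G.edgeSet => X e ≠ edgeProd Y e with hbad
  have hle := hy Y
  have hcl : cut ⊆ D.localEdges G i := Finset.filter_subset _ _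
  have hsplit : ∀ z : V → ℤˣ, D.localCost G X i z =
      (cut.filter fun e : G.edgeSet => edgeProd z e ≠ X e).card +
        ((D.localEdges G i \ cut).filter fun e : G.edgeSet => edgeProd z e ≠ X e).card := by
    intro z
    rw [Decomposition.localCost, ← Finset.card_union_of_disjoint
      (Finset.disjoint_filter_filter Finset.disjoint_sdiff), ← Finset.filter_union,
      Finset.union_sdiff_of_subset hcl]
  have hout : ((D.localEdges G i \ cut).filter fun e : G.edgeSet => edgeProd y e ≠ X e) =
      (D.localEdges G i \ cut).filter fun e : G.edgeSet => edgeProd Y e ≠ X e := by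
    refine Finset.filter_congr fun e he => ?_
    have he' := Finset.mem_sdiff.1 he
    rw [hprod e he'.1, if_neg he'.2]
  have hY : (cut.filter fun e : G.edgeSet => edgeProd Y e ≠ X e) = bad :=
    Finset.filter_congr fun e _ => ne_comm
  -- On the cut `y` and `Y` predict opposite signs, so they contradict complementary sets of
  -- measurements; off the cut they contradict the same ones. Hence `y` beats `Y` only if `Y` is
  -- contradicted on at least half of the cut.
  have hy' : (cut.filter fun e : G.edgeSet => edgeProd y e ≠ X e) =
      cut.filter fun e : G.edgeSet => ¬ X e ≠ edgeProd Y e := by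
    refine Finset.filter_congr fun e he => ?_
    rw [hprod e (hcl he), if_pos he, not_ne_iff]
    constructor
    · intro hne
      rw [Int.units_eq_neg_of_ne hne.symm, neg_neg]
    · intro heq
      rw [heq]
      exact (Int.units_ne_neg _).symm
  have hcard : bad.card + (cut.filter fun e : G.edgeSet => ¬ X e ≠ edgeProd Y e).card =
      cut.card := by
    rw [hbad, ← Finset.card_filter_add_card_filter_not (s := cut)
      fun e : G.edgeSet => X e ≠ edgeProd Y e]
  rw [hsplit y, hsplit Y, hout, hY, hy'] at hle
  obtain ⟨F, hF, hFc⟩ := Finset.exists_subset_card_eq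
    (show (D.mincutStar G i + 1) / 2 ≤ bad.card by omega)
  refine ⟨F, Finset.mem_powersetCard.2 ⟨hF.trans ((Finset.filter_subset _ _).trans hcl), hFc⟩,
    fun e he => (Finset.mem_filter.1 (hF he)).2⟩

/-- The indicator that all measurements in `F` are flipped. -/
noncomputable def flipIndicator (Y : V → ℤˣ) (F : Finset G.edgeSet) (X : G.edgeSet → ℤˣ) : ℝ :=
  ∏ e : G.edgeSet, if e ∈ F ∧ X e = edgeProd Y e then 0 else 1

theorem flipIndicator_nonneg (Y : V → ℤˣ) (F : Finset G.edgeSet) (X : G.edgeSet → ℤˣ) :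
    0 ≤ flipIndicator Y F X :=
  Finset.prod_nonneg fun e _ => by split_ifs <;> norm_num

theorem flipIndicator_eq_one {Y : V → ℤˣ} {F : Finset G.edgeSet} {X : G.edgeSet → ℤˣ}
    (h : ∀ e : G.edgeSet, e ∈ F → X e ≠ edgeProd Y e) : flipIndicator Y F X = 1 :=
  Finset.prod_eq_one fun e _ => if_neg fun h' => h e h'.1 h'.2

theorem flipIndicator_union (Y : V → ℤˣ) (F F' : Finset G.edgeSet) (X : G.edgeSet → ℤˣ) :
    flipIndicator Y (F ∪ F') X = flipIndicator Y F X * flipIndicator Y F' X := by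
  rw [flipIndicator, flipIndicator, flipIndicator, ← Finset.prod_mul_distrib]
  refine Finset.prod_congr rfl fun e _ => ?_
  by_cases h1 : e ∈ F <;> by_cases h2 : e ∈ F' <;> simp [h1, h2]

theorem sum_flipWeight_mul_flipIndicator (p : ℝ) (Y : V → ℤˣ) (F : Finset G.edgeSet) :
    ∑ X, flipWeight p (fun e : G.edgeSet => edgeProd Y e) X * flipIndicator Y F X =
      p ^ F.card := by
  rw [show (∑ X, flipWeight p (fun e : G.edgeSet => edgeProd Y e) X * flipIndicator Y F X) = _ from
    sum_flipWeight_mul_prod p (fun e : G.edgeSet => edgeProd Y e)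
      fun e x => if e ∈ F ∧ x = edgeProd Y e then 0 else 1]
  rw [← Finset.prod_const, ← Finset.prod_subset (Finset.subset_univ F)]
  · refine Finset.prod_congr rfl fun e he => ?_
    simp [he, (Int.units_ne_neg _).symm]
  · intro e _ he
    simp [he]

/-- Union bound over the possible half cuts, kept pointwise so that it can be multiplied over
several components before taking expectations. -/
theorem Decomposition.indicator_isBad_le (hsub : ∀ i, D.bag i ⊆ D.ext i) (Y : V → ℤˣ)
    (X : G.edgeSet → ℤˣ) (i : ι) :
    (if D.IsBad G Y X i then 1 else 0 : ℝ) ≤ ∑ F ∈ D.halfCuts G i, flipIndicator Y F X := by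
  split_ifs with h
  · obtain ⟨F, hF, hflip⟩ := h.exists_halfCut D (hsub i)
    rw [← flipIndicator_eq_one hflip]
    exact Finset.single_le_sum (f := fun F => flipIndicator Y F X)
      (fun F _ => flipIndicator_nonneg Y F X) hF
  · exact Finset.sum_nonneg fun F _ => flipIndicator_nonneg Y F X

/-- A bound on the probability that `W` is decoded wrongly. -/
noncomputable def Decomposition.badBound (G : SimpleGraph V) (p : ℝ) (i : ι) : ℝ :=
  ∑ F ∈ D.halfCuts G i, p ^ F.card

theorem Decomposition.badBound_nonneg {p : ℝ} (hp : 0 ≤ p) (i : ι) : 0 ≤ D.badBound G p i :=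
  Finset.sum_nonneg fun _ _ => pow_nonneg hp _

/-- All half cuts have the same size, and their number is a binomial coefficient, at most `2` to the
number of local edges. -/
theorem Decomposition.badBound_le {p : ℝ} (hp : 0 ≤ p) (i : ι) :
    D.badBound G p i ≤ 2 ^ (D.localEdges G i).card * p ^ ((D.mincutStar G i + 1) / 2) := by
  rw [badBound, Finset.sum_congr rfl fun F hF => by
    rw [(Finset.mem_powersetCard.1 hF).2], Finset.sum_const, nsmul_eq_mul]
  refine mul_le_mul_of_nonneg_right ?_ (pow_nonneg hp _)
  rw [halfCuts, Finset.card_powersetCard]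
  exact_mod_cast Nat.choose_le_two_pow _ _

/-- The number of components that are decoded wrongly. -/
noncomputable def Decomposition.badCount [Fintype ι] (G : SimpleGraph V) (Y : V → ℤˣ)
    (X : G.edgeSet → ℤˣ) : ℕ :=
  (Finset.univ.filter fun i => D.IsBad G Y X i).card

theorem Decomposition.sum_flipWeight_mul_badCount_le [Fintype ι] (hsub : ∀ i, D.bag i ⊆ D.ext i)
    {p : ℝ} (hp0 : 0 ≤ p) (hp1 : p ≤ 1) (Y : V → ℤˣ) :
    ∑ X, flipWeight p (fun e : G.edgeSet => edgeProd Y e) X * (D.badCount G Y X : ℝ) ≤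
      ∑ i, D.badBound G p i := by
  have h : ∀ X, (D.badCount G Y X : ℝ) ≤ ∑ i, ∑ F ∈ D.halfCuts G i, flipIndicator Y F X := by
    intro X
    rw [badCount, Finset.card_filter, Nat.cast_sum]
    refine Finset.sum_le_sum fun i _ => ?_
    have := D.indicator_isBad_le (G := G) hsub Y X i
    push_cast
    exact this
  refine (Finset.sum_le_sum fun X _ => mul_le_mul_of_nonneg_left (h X)
    (flipWeight_nonneg hp0 hp1 _ _)).trans (le_of_eq ?_)
  simp only [Finset.mul_sum]
  rw [Finset.sum_comm]
  refine Finset.sum_congr rfl fun i _ => ?_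
  rw [Finset.sum_comm, badBound]
  exact Finset.sum_congr rfl fun F _ => sum_flipWeight_mul_flipIndicator p Y F

/-- For components with disjoint sets of edges, the events of being decoded wrongly are dominated
by independent ones. -/
theorem Decomposition.sum_flipWeight_mul_prod_eq {p : ℝ} (Y : V → ℤˣ) (R : Finset ι)
    (hR : ∀ i ∈ R, ∀ j ∈ R, i ≠ j → Disjoint (D.localEdges G i) (D.localEdges G j)) :
    ∀ H : Finset G.edgeSet, (∀ i ∈ R, Disjoint H (D.localEdges G i)) →
    ∑ X, flipWeight p (fun e : G.edgeSet => edgeProd Y e) X * (flipIndicator Y H X *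
      ∏ i ∈ R, (1 + ∑ F ∈ D.halfCuts G i, flipIndicator Y F X)) =
      p ^ H.card * ∏ i ∈ R, (1 + D.badBound G p i) := by
  -- The statement is made for every `H` disjoint from the remaining components because expanding
  -- the factor of one component adds its half cut `F` to the edges already required to be flipped.
  induction R using Finset.induction_on with
  | empty =>
    intro H _
    simpa using sum_flipWeight_mul_flipIndicator p Y H
  | insert j R hj ih =>
    intro H hH
    have ih' := ih fun i hi i' hi' => hR i (Finset.mem_insert_of_mem hi) i'
      (Finset.mem_insert_of_mem hi')
    have h1 := ih' H fun i hi => hH i (Finset.mem_insert_of_mem hi)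
    have h2 : ∀ F ∈ D.halfCuts G j,
        ∑ X, flipWeight p (fun e : G.edgeSet => edgeProd Y e) X * (flipIndicator Y (H ∪ F) X *
          ∏ i ∈ R, (1 + ∑ F ∈ D.halfCuts G i, flipIndicator Y F X)) =
        p ^ H.card * p ^ F.card * ∏ i ∈ R, (1 + D.badBound G p i) := by
      intro F hF
      have hFj := (Finset.mem_powersetCard.1 hF).1
      rw [ih' (H ∪ F) fun i hi => Finset.disjoint_union_left.2
        ⟨hH i (Finset.mem_insert_of_mem hi), (hR j (Finset.mem_insert_self _ _) i
          (Finset.mem_insert_of_mem hi) (by rintro rfl; exact hj hi)).mono_left hFj⟩,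
        Finset.card_union_of_disjoint ((hH j (Finset.mem_insert_self _ _)).mono_right hFj),
        pow_add]
    calc _ = ∑ X, flipWeight p (fun e : G.edgeSet => edgeProd Y e) X * (flipIndicator Y H X *
          ∏ i ∈ R, (1 + ∑ F ∈ D.halfCuts G i, flipIndicator Y F X)) +
          ∑ F ∈ D.halfCuts G j,
          ∑ X, flipWeight p (fun e : G.edgeSet => edgeProd Y e) X * (flipIndicator Y (H ∪ F) X *
          ∏ i ∈ R, (1 + ∑ F ∈ D.halfCuts G i, flipIndicator Y F X)) := by
          rw [Finset.sum_comm, ← Finset.sum_add_distrib]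
          refine Finset.sum_congr rfl fun X _ => ?_
          rw [Finset.prod_insert hj]
          simp only [flipIndicator_union, ← Finset.mul_sum, ← Finset.sum_mul]
          ring
      _ = _ := by
          rw [h1, Finset.sum_congr rfl h2, Finset.prod_insert hj, badBound, ← Finset.sum_mul,
            ← Finset.mul_sum]
          ring

/-- Each bad component contributes `2 ≤ 1 + ∑ F, flipIndicator Y F X`. The expectation of the
product of the right sides factors because the edge sets are disjoint, and `1 + x ≤ exp x` finishes.
-/
theorem Decomposition.sum_flipWeight_mul_two_pow_le (hsub : ∀ i, D.bag i ⊆ D.ext i)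
    {p : ℝ} (hp0 : 0 ≤ p) (hp1 : p ≤ 1) (Y : V → ℤˣ) (R : Finset ι)
    (hR : ∀ i ∈ R, ∀ j ∈ R, i ≠ j → Disjoint (D.localEdges G i) (D.localEdges G j)) :
    ∑ X, flipWeight p (fun e : G.edgeSet => edgeProd Y e) X *
      (2 : ℝ) ^ (R.filter fun i => D.IsBad G Y X i).card ≤
      Real.exp (∑ i ∈ R, D.badBound G p i) := by
  have h := D.sum_flipWeight_mul_prod_eq (G := G) (p := p) Y R hR ∅ fun i _ => Finset.disjoint_empty_left _
  have h0 : ∀ X : G.edgeSet → ℤˣ, flipIndicator Y ∅ X = 1 := fun X =>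
    flipIndicator_eq_one (by simp)
  simp only [h0, one_mul, Finset.card_empty, pow_zero] at h
  calc _ ≤ ∑ X, flipWeight p (fun e : G.edgeSet => edgeProd Y e) X *
        ∏ i ∈ R, (1 + ∑ F ∈ D.halfCuts G i, flipIndicator Y F X) := by
        refine Finset.sum_le_sum fun X _ => mul_le_mul_of_nonneg_left ?_
          (flipWeight_nonneg hp0 hp1 _ _)
        rw [← Finset.prod_const, Finset.prod_filter]
        refine Finset.prod_le_prod (fun i _ => by split_ifs <;> norm_num) fun i _ => ?_
        have := D.indicator_isBad_le (G := G) hsub Y X i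
        split_ifs at this ⊢ <;> linarith
    _ = ∏ i ∈ R, (1 + D.badBound G p i) := h
    _ ≤ ∏ i ∈ R, Real.exp (D.badBound G p i) :=
        Finset.prod_le_prod (fun i _ => by linarith [D.badBound_nonneg (G := G) hp0 i])
          fun i _ => by linarith [Real.add_one_le_exp (D.badBound G p i)]
    _ = _ := (Real.exp_sum _ _).symm

end Bad

/-! ### Sets of components with few boundaries -/

/-- The positions `i` on the path such that exactly one of `i`, `i + 1` belongs to `A`. -/
def pathBoundary {m : ℕ} (A : Finset (Fin m)) : Finset (Fin m) :=
  Finset.univ.filter fun i => ∃ j : Fin m, (j : ℕ) = i + 1 ∧ ¬ (i ∈ A ↔ j ∈ A)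

theorem mem_pathBoundary {m : ℕ} {A : Finset (Fin m)} {i j : Fin m} (hij : (j : ℕ) = i + 1) :
    i ∈ pathBoundary A ↔ ¬ (i ∈ A ↔ j ∈ A) := by
  simp only [pathBoundary, Finset.mem_filter, Finset.mem_univ, true_and]
  constructor
  · rintro ⟨j', hj', h⟩
    rwa [Fin.ext (hij.trans hj'.symm)]
  · exact fun h => ⟨j, hij, h⟩

/-- Membership propagates from position `0` along the path, switching exactly at the boundaries. -/
theorem eq_of_pathBoundary_eq {m : ℕ} {A B : Finset (Fin m)}
    (h0 : ∀ i : Fin m, (i : ℕ) = 0 → (i ∈ A ↔ i ∈ B)) (h : pathBoundary A = pathBoundary B) :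
    A = B := by
  have key : ∀ (a : ℕ) (i : Fin m), (i : ℕ) = a → (i ∈ A ↔ i ∈ B) := by
    intro a
    induction a with
    | zero => exact h0
    | succ a ih =>
      intro i hi
      have h1 := ih ⟨a, by omega⟩ rfl
      have h2 := mem_pathBoundary (A := A) (i := ⟨a, by omega⟩) hi
      have h3 := mem_pathBoundary (A := B) (i := ⟨a, by omega⟩) hi
      rw [h] at h2
      tauto
  exact Finset.ext fun i => key _ i rfl

/-- A set is encoded injectively by its boundaries and one bit for position `0`; the sum over all
boundary sets is then a binomial expansion. -/
theorem sum_pow_card_pathBoundary_le (m : ℕ) {z : ℝ} (hz : 0 ≤ z) :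
    ∑ A : Finset (Fin m), z ^ (pathBoundary A).card ≤ 2 * (1 + z) ^ m := by
  classical
  let φ : Finset (Fin m) → Bool × Finset (Fin m) := fun A =>
    (decide (∃ i ∈ A, (i : ℕ) = 0), pathBoundary A)
  have hφ : Function.Injective φ := by
    intro A B h
    obtain ⟨h1, h2⟩ := Prod.ext_iff.1 h
    refine eq_of_pathBoundary_eq (fun i hi => ?_) h2
    have h3 : (∃ i ∈ A, (i : ℕ) = 0) ↔ ∃ i ∈ B, (i : ℕ) = 0 := decide_eq_decide.1 h1
    have h4 : ∀ C : Finset (Fin m), i ∈ C ↔ ∃ j ∈ C, (j : ℕ) = 0 := fun C =>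
      ⟨fun hC => ⟨i, hC, hi⟩, fun ⟨j, hj, hj0⟩ => by rwa [Fin.ext (hi.trans hj0.symm)]⟩
    rw [h4 A, h4 B, h3]
  calc ∑ A : Finset (Fin m), z ^ (pathBoundary A).card
      = ∑ x ∈ Finset.univ.image φ, z ^ x.2.card :=
        (Finset.sum_image (f := fun x : Bool × Finset (Fin m) => z ^ x.2.card) hφ.injOn).symm
    _ ≤ ∑ x : Bool × Finset (Fin m), z ^ x.2.card :=
        Finset.sum_le_sum_of_subset_of_nonneg (Finset.subset_univ _)
          fun _ _ _ => pow_nonneg hz _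
    _ = 2 * ∑ C : Finset (Fin m), z ^ C.card := by
        rw [Fintype.sum_prod_type]
        simp
    _ = 2 * (1 + z) ^ m := by
        have h := Fintype.sum_pow_mul_eq_add_pow (Fin m) z 1
        simp only [one_pow, mul_one, Fintype.card_fin] at h
        rw [h, add_comm]

/-- With weight `1 / n` per boundary the binomial sum is at most `2 * e`. This makes a union bound
over all sets possible at the price of `log n` per boundary. -/
theorem sum_inv_pow_card_pathBoundary_le {m n : ℕ} (hn : 0 < n) (hm : m ≤ n) :
    ∑ A : Finset (Fin m), ((n : ℝ)⁻¹) ^ (pathBoundary A).card ≤ 6 := by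
  have hn' : (0 : ℝ) < n := Nat.cast_pos.2 hn
  have h1 : (1 + (n : ℝ)⁻¹) ^ m ≤ Real.exp 1 := by
    calc (1 + (n : ℝ)⁻¹) ^ m ≤ (1 + (n : ℝ)⁻¹) ^ n :=
          pow_le_pow_right₀ (by linarith [inv_pos.2 hn']) hm
      _ ≤ Real.exp (n : ℝ)⁻¹ ^ n :=
          pow_le_pow_left₀ (by positivity) (by linarith [Real.add_one_le_exp (n : ℝ)⁻¹]) _
      _ = Real.exp 1 := by
          rw [← Real.exp_nat_mul, mul_inv_cancel₀ hn'.ne']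
  have h2 := sum_pow_card_pathBoundary_le m (inv_nonneg.2 hn'.le)
  linarith [Real.exp_one_lt_d9]

/-! ### Exponential moments of the vertex measurements. -/

theorem two_point_mgf_le {q x : ℝ} (hq0 : 0 ≤ q) (hq1 : q ≤ 1 / 2) (hx0 : 0 ≤ x) (hx1 : x ≤ 1) :
    (1 - q) * Real.exp (-x) + q * Real.exp x ≤ Real.exp (x ^ 2 - (1 - 2 * q) * x) := by
  -- Both exponentials are bounded by `1 + y + y ^ 2` for `|y| ≤ 1`; averaging gives `1 - (1 - 2 *
  -- q) * x + x ^ 2`.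
  have h1 := (abs_le.1 (Real.abs_exp_sub_one_sub_id_le (x := x) (abs_le.2 ⟨by linarith, hx1⟩))).2
  have h2 := (abs_le.1 (Real.abs_exp_sub_one_sub_id_le (x := -x)
    (abs_le.2 ⟨by linarith, by linarith⟩))).2
  have h3 := Real.add_one_le_exp (x ^ 2 - (1 - 2 * q) * x)
  nlinarith [mul_le_mul_of_nonneg_left h1 hq0,
    mul_le_mul_of_nonneg_left h2 (by linarith : 0 ≤ 1 - q)]

section Agreement

variable {V : Type*} {m : ℕ}

/-- The number of vertex measurements that agree with `Y` minus the number of those that do not,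
summed over the components in `A`. -/
def agreement (bag : Fin m → Finset V) (Y Z : V → ℤˣ) (A : Finset (Fin m)) : ℤ :=
  ∑ i ∈ A, ∑ v ∈ bag i, ((Z v * Y v : ℤˣ) : ℤ)

/-- Components overlap, so a vertex is counted with a multiplicity. Summing over vertices instead of
components exposes independent terms. -/
theorem agreement_eq [Fintype V] [DecidableEq V] (bag : Fin m → Finset V) (Y Z : V → ℤˣ)
    (A : Finset (Fin m)) : agreement bag Y Z A =
      ∑ v, ((A.filter fun i => v ∈ bag i).card : ℤ) * ((Z v * Y v : ℤˣ) : ℤ) := by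
  have h : ∀ i, ∑ v ∈ bag i, ((Z v * Y v : ℤˣ) : ℤ) =
      ∑ v, if v ∈ bag i then ((Z v * Y v : ℤˣ) : ℤ) else 0 := fun i => by
    rw [← Finset.sum_filter]
    congr 1
    ext v
    simp
  rw [agreement, Finset.sum_congr rfl fun i _ => h i, Finset.sum_comm]
  refine Finset.sum_congr rfl fun v _ => ?_
  rw [← Finset.sum_filter, Finset.sum_const, nsmul_eq_mul]

/-- An exponential penalty for the sets of components, weighted by their boundaries, on which the
vertex measurements do not clearly favour the ground truth. -/
noncomputable def agreementPenalty (bag : Fin m → Finset V) (n : ℕ) (θ c : ℝ) (Y Z : V → ℤˣ) : ℝ :=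
  ∑ A : Finset (Fin m), ((n : ℝ)⁻¹) ^ (pathBoundary A).card *
    Real.exp (-θ * (agreement bag Y Z A - c * A.card))

theorem agreementPenalty_nonneg (bag : Fin m → Finset V) (n : ℕ) (θ c : ℝ) (Y Z : V → ℤˣ) :
    0 ≤ agreementPenalty bag n θ c Y Z :=
  Finset.sum_nonneg fun _ _ => mul_nonneg (by positivity) (Real.exp_pos _).le

/-- A single term of the penalty is at most the whole sum; taking logarithms turns the weight `n⁻¹`
of a boundary into `log n`. The bound holds for all `A` simultaneously, which matters because the
decoder's `A` depends on the data. -/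
theorem card_le_of_agreementPenalty {bag : Fin m → Finset V} {n : ℕ} {θ c : ℝ} (hn : 0 < n)
    (hθ : 0 < θ) (Y Z : V → ℤˣ) (A : Finset (Fin m)) {t : ℝ}
    (ht : agreementPenalty bag n θ c Y Z ≤ Real.exp t) :
    c * A.card ≤ agreement bag Y Z A + (t + (pathBoundary A).card * Real.log n) / θ := by
  have hn' : (0 : ℝ) < n := Nat.cast_pos.2 hn
  have h1 : ((n : ℝ)⁻¹) ^ (pathBoundary A).card *
      Real.exp (-θ * (agreement bag Y Z A - c * A.card)) ≤ Real.exp t :=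
    (Finset.single_le_sum (f := fun A : Finset (Fin m) => ((n : ℝ)⁻¹) ^ (pathBoundary A).card *
      Real.exp (-θ * (agreement bag Y Z A - c * A.card)))
      (fun _ _ => mul_nonneg (by positivity) (Real.exp_pos _).le) (Finset.mem_univ A)).trans ht
  have h2 : ((n : ℝ)⁻¹) ^ (pathBoundary A).card =
      Real.exp (-((pathBoundary A).card * Real.log n)) := by
    rw [Real.exp_neg, Real.exp_nat_mul, Real.exp_log hn', inv_pow]
  rw [h2, ← Real.exp_add, Real.exp_le_exp] at h1
  rw [← sub_le_iff_le_add', le_div_iff₀ hθ]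
  linarith

/-- The exponent `(1 - 2 * q) / (2 * a)` is chosen so that, even for a vertex of multiplicity `a`,
the quadratic term of the moment is at most half of the linear drift. The remaining half of the
drift pays for the subtracted multiple of `A.card`, since the multiplicities add up to at least
`A.card`. -/
theorem sum_flipWeight_mul_exp_agreement_le [Fintype V] [DecidableEq V] {bag : Fin m → Finset V}
    {a : ℕ} (ha0 : 0 < a) (ha : ∀ v, (Finset.univ.filter fun i => v ∈ bag i).card ≤ a)
    (hbag : ∀ i, (bag i).Nonempty) {q : ℝ} (hq0 : 0 ≤ q) (hq1 : q ≤ 1 / 2) (Y : V → ℤˣ)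
    (A : Finset (Fin m)) :
    ∑ Z, flipWeight q Y Z * Real.exp (-((1 - 2 * q) / (2 * a)) *
      (agreement bag Y Z A - (1 - 2 * q) / 2 * A.card)) ≤ 1 := by
  set θ : ℝ := (1 - 2 * q) / (2 * a) with hθ
  have ha0' : (0 : ℝ) < a := Nat.cast_pos.2 ha0
  have hθ0 : 0 ≤ θ := div_nonneg (by linarith) (by positivity)
  have hθa : θ * a = (1 - 2 * q) / 2 := by
    rw [hθ]
    field_simp
  set N : V → ℕ := fun v => (A.filter fun i => v ∈ bag i).card with hN
  have hNa : ∀ v, (N v : ℝ) ≤ a := fun v => by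
    exact_mod_cast (Finset.card_le_card (Finset.filter_subset_filter _
      (Finset.subset_univ A))).trans (ha v)
  have hsum : (A.card : ℝ) ≤ ∑ v, (N v : ℝ) := by
    have h1 : ∑ v, N v = ∑ i ∈ A, (bag i).card := by
      simp only [hN, Finset.card_filter]
      rw [Finset.sum_comm]
      exact Finset.sum_congr rfl fun i _ => by simp
    have h2 : A.card ≤ ∑ v, N v := by
      rw [h1, Finset.card_eq_sum_ones]
      exact Finset.sum_le_sum fun i _ => (hbag i).card_pos
    exact_mod_cast h2
  have h1 : ∀ Z, Real.exp (-θ * (agreement bag Y Z A - (1 - 2 * q) / 2 * A.card)) =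
      Real.exp (θ * ((1 - 2 * q) / 2) * A.card) *
        ∏ v, Real.exp (-(θ * N v) * ((Z v * Y v : ℤˣ) : ℤ)) := fun Z => by
    rw [← Real.exp_sum, ← Real.exp_add, agreement_eq]
    congr 1
    push_cast
    rw [mul_sub, Finset.mul_sum, sub_eq_add_neg, add_comm]
    congr 1
    · ring
    · exact Finset.sum_congr rfl fun v _ => by ring
  simp_rw [h1, mul_left_comm (flipWeight q Y _)]
  rw [← Finset.mul_sum]
  have h2 := sum_flipWeight_mul_prod q Y
    fun v z => Real.exp (-(θ * N v) * ((z * Y v : ℤˣ) : ℤ))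
  rw [h2]
  have h3 : ∀ v, (1 - q) * Real.exp (-(θ * N v) * ((Y v * Y v : ℤˣ) : ℤ)) +
      q * Real.exp (-(θ * N v) * ((-Y v * Y v : ℤˣ) : ℤ)) ≤
      Real.exp (-(θ * ((1 - 2 * q) / 2)) * N v) := fun v => by
    -- For `x = θ * N v` this yields `x ^ 2 ≤ (1 - 2 * q) / 2 * x`.
    have hx1 : θ * N v ≤ (1 - 2 * q) / 2 := hθa ▸ mul_le_mul_of_nonneg_left (hNa v) hθ0
    have hx0 : 0 ≤ θ * N v := mul_nonneg hθ0 (Nat.cast_nonneg _)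
    have h4 := two_point_mgf_le hq0 hq1 hx0 (by linarith)
    have h5 : (Y v * Y v : ℤˣ) = 1 := Int.units_mul_self _
    rw [neg_mul (Y v), h5]
    simp only [Units.val_one, Int.cast_one, mul_one, Units.val_neg, Int.cast_neg, mul_neg, neg_neg]
    refine h4.trans (Real.exp_le_exp.2 ?_)
    nlinarith
  calc _ ≤ Real.exp (θ * ((1 - 2 * q) / 2) * A.card) *
        ∏ v, Real.exp (-(θ * ((1 - 2 * q) / 2)) * N v) :=
        mul_le_mul_of_nonneg_left (Finset.prod_le_prod (fun v _ => add_nonneg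
          (mul_nonneg (by linarith) (Real.exp_pos _).le) (mul_nonneg hq0 (Real.exp_pos _).le))
          fun v _ => h3 v) (Real.exp_pos _).le
    _ ≤ 1 := by
        rw [← Real.exp_sum, ← Real.exp_add, ← Finset.mul_sum, Real.exp_le_one_iff]
        have : 0 ≤ θ * ((1 - 2 * q) / 2) := mul_nonneg hθ0 (by linarith)
        nlinarith

theorem sum_flipWeight_mul_agreementPenalty_le [Fintype V] [DecidableEq V]
    {bag : Fin m → Finset V} {a : ℕ} (ha0 : 0 < a)
    (ha : ∀ v, (Finset.univ.filter fun i => v ∈ bag i).card ≤ a)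
    (hbag : ∀ i, (bag i).Nonempty) {n : ℕ} (hn : 0 < n) (hm : m ≤ n) {q : ℝ} (hq0 : 0 ≤ q)
    (hq1 : q ≤ 1 / 2) (Y : V → ℤˣ) :
    ∑ Z, flipWeight q Y Z *
      agreementPenalty bag n ((1 - 2 * q) / (2 * a)) ((1 - 2 * q) / 2) Y Z ≤ 6 := by
  simp only [agreementPenalty, Finset.mul_sum]
  rw [Finset.sum_comm]
  refine le_trans (Finset.sum_le_sum fun A _ => ?_) (sum_inv_pow_card_pathBoundary_le hn hm)
  have h := sum_flipWeight_mul_exp_agreement_le ha0 ha hbag hq0 hq1 Y A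
  calc _ = ((n : ℝ)⁻¹) ^ (pathBoundary A).card *
        ∑ Z, flipWeight q Y Z * Real.exp (-((1 - 2 * q) / (2 * a)) *
          (agreement bag Y Z A - (1 - 2 * q) / 2 * A.card)) := by
        rw [Finset.mul_sum]
        exact Finset.sum_congr rfl fun Z _ => by ring
    _ ≤ ((n : ℝ)⁻¹) ^ (pathBoundary A).card * 1 :=
        mul_le_mul_of_nonneg_left h (by positivity)
    _ = _ := mul_one _

end Agreement

/-! ### Comparison of the decoded signs with the correct ones -/

section Compare

open scoped Classical

variable {V : Type*} {m : ℕ} {G : SimpleGraph V} (D : Decomposition V (Fin m))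

theorem Decomposition.card_incident_le (Bd : Finset (Fin m)) :
    (Finset.univ.filter fun e : D.tree.edgeSet => ∃ i ∈ Bd, i ∈ (e : Sym2 (Fin m))).card ≤
      D.treeDegree * Bd.card := by
  have h1 : ∀ i, (Finset.univ.filter fun e : D.tree.edgeSet => i ∈ (e : Sym2 (Fin m))).card ≤
      D.treeDegree := by
    intro i
    refine le_trans ?_ (Finset.le_sup (f := fun i => (D.tree.neighborSet i).ncard)
      (Finset.mem_univ i))
    rw [Set.ncard_eq_toFinset_card']
    refine Finset.card_le_card_of_forall_subsingleton
      (fun (e : D.tree.edgeSet) j => (e : Sym2 (Fin m)) = s(i, j)) ?_ ?_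
    · intro e he
      obtain ⟨j, hj⟩ := (Finset.mem_filter.1 he).2
      refine ⟨j, Set.mem_toFinset.2 ?_, hj⟩
      have h := e.2
      rw [hj] at h
      exact h
    · intro j _ e he e' he'
      exact Subtype.ext (he.2.trans he'.2.symm)
  calc _ ≤ (Bd.biUnion fun i =>
        Finset.univ.filter fun e : D.tree.edgeSet => i ∈ (e : Sym2 (Fin m))).card := by
        refine Finset.card_le_card fun e he => ?_
        obtain ⟨i, hi, hie⟩ := (Finset.mem_filter.1 he).2
        exact Finset.mem_biUnion.2 ⟨i, hi, Finset.mem_filter.2 ⟨Finset.mem_univ _, hie⟩⟩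
    _ ≤ Bd.card * D.treeDegree := Finset.card_biUnion_le_card_mul _ _ _ fun i _ => h1 i
    _ = _ := mul_comm _ _

/-- With the wrong sign a good component predicts `-Y`, so every vertex measurement that agrees with
`Y` adds one to the cost and every other one saves one. -/
theorem Decomposition.vertexCost_neg (Z Y : V → ℤˣ) (est : Fin m → V → ℤˣ) (i : Fin m) {s t : ℤˣ}
    (hst : s ≠ t) (ht : ∀ v ∈ D.bag i, est i v = t * Y v) :
    (D.vertexCost Z est i s : ℤ) = D.vertexCost Z est i t +
      ∑ v ∈ D.bag i, ((Z v * Y v : ℤˣ) : ℤ) := by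
  rw [vertexCost, vertexCost, Finset.card_filter, Finset.card_filter]
  push_cast
  rw [← Finset.sum_add_distrib]
  refine Finset.sum_congr rfl fun v hv => ?_
  rw [ht v hv, Int.units_eq_neg_of_ne hst]
  rcases Int.units_eq_one_or t with rfl | rfl <;> rcases Int.units_eq_one_or (Y v) with h | h <;>
    rcases Int.units_eq_one_or (Z v) with h' | h' <;> rw [h, h'] <;> decide

/-- The signs `s` found by a decoder are compared with the correct signs: `A` is the set of
components that are decoded correctly but get the wrong sign. -/
theorem Decomposition.exists_wrong_components [Fintype V] (hT : D.tree = SimpleGraph.pathGraph m) {b : ℕ}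
    (hb : ∀ i, (D.bag i).card ≤ b) (Y Z : V → ℤˣ) (X : G.edgeSet → ℤˣ) {est : Fin m → V → ℤˣ}
    {pivot : Sym2 (Fin m) → V} {home : V → Fin m} {Yhat : V → ℤˣ} (s : Fin m → ℤˣ)
    (hest : ∀ i y, D.localCost G X i (est i) ≤ D.localCost G X i y)
    (hpivot : ∀ i j, D.tree.Adj i j → pivot s(i, j) ∈ D.bag i ∧ pivot s(i, j) ∈ D.bag j)
    (hhome : ∀ v, v ∈ D.bag (home v)) (hY : ∀ v, Yhat v = s (home v) * est (home v) v) :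
    ∃ (A : Finset (Fin m)) (s' : Fin m → ℤˣ),
      ((∑ i, D.vertexCost Z est i (s i) : ℕ) : ℤ) =
        (∑ i, D.vertexCost Z est i (s' i) : ℕ) + agreement D.bag Y Z A ∧
      D.violations est pivot s' ≤ D.treeDegree * D.badCount G Y X ∧
      (pathBoundary A).card ≤ D.violations est pivot s + D.treeDegree * D.badCount G Y X ∧
      hammingDist Yhat Y ≤ b * (D.badCount G Y X + A.card) := by
  have hgood : ∀ i, ∃ t : ℤˣ, ¬ D.IsBad G Y X i → ∀ v ∈ D.bag i, est i v = t * Y v := by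
    intro i
    by_cases h : D.IsBad G Y X i
    · exact ⟨1, fun h' => absurd h h'⟩
    · by_contra hne
      push Not at hne
      refine h ⟨est i, hest i, ?_⟩
      rintro ⟨t, ht⟩
      obtain ⟨-, v, hv, hvt⟩ := hne t
      exact hvt (ht v hv)
  choose t ht using hgood
  set Bd : Finset (Fin m) := Finset.univ.filter fun i => D.IsBad G Y X i with hBd
  set A : Finset (Fin m) := Finset.univ.filter fun i => ¬ D.IsBad G Y X i ∧ s i ≠ t i with hA
  set inc := Finset.univ.filter fun e : D.tree.edgeSet => ∃ i ∈ Bd, i ∈ (e : Sym2 (Fin m))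
    with hinc
  have hinc_le : inc.card ≤ D.treeDegree * D.badCount G Y X := D.card_incident_le Bd
  have hlink : ∀ i j, D.tree.Adj i j → ¬ D.IsBad G Y X i → ¬ D.IsBad G Y X j →
      edgeProd (fun l => est l (pivot s(i, j))) s(i, j) = t i * t j := by
    intro i j hij hi hj
    obtain ⟨h1, h2⟩ := hpivot i j hij
    rw [edgeProd_mk, ht i hi _ h1, ht j hj _ h2, mul_mul_mul_comm, Int.units_mul_self, mul_one]
  -- The competitor `s'` has the correct signs on good components and copies `s` on bad ones, so its
  -- cost differs from that of `s` only on `A`.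
  refine ⟨A, fun i => if D.IsBad G Y X i then s i else t i, ?_, ?_, ?_, ?_⟩
  · rw [agreement, hA, Finset.sum_filter]
    push_cast
    rw [← Finset.sum_add_distrib]
    refine Finset.sum_congr rfl fun i _ => ?_
    by_cases hi : D.IsBad G Y X i
    · simp [hi]
    · by_cases hs : s i = t i
      · simp [hi, hs]
      · rw [if_neg hi, if_pos ⟨hi, hs⟩]
        exact D.vertexCost_neg Z Y est i hs (ht i hi)
  · refine le_trans (Finset.card_le_card fun e he => ?_) hinc_le
    have hne := (Finset.mem_filter.1 he).2
    by_contra hni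
    have hgood : ∀ i ∈ (e : Sym2 (Fin m)), ¬ D.IsBad G Y X i := fun i hi hbad =>
      hni (Finset.mem_filter.2 ⟨Finset.mem_univ _, i,
        Finset.mem_filter.2 ⟨Finset.mem_univ _, hbad⟩, hi⟩)
    obtain ⟨e, hT⟩ := e
    induction e using Sym2.ind with
    | h i j =>
      have hi := hgood i (Sym2.mem_mk_left _ _)
      have hj := hgood j (Sym2.mem_mk_right _ _)
      refine hne ?_
      rw [hlink i j hT hi hj, edgeProd_mk, if_neg hi, if_neg hj]
  -- Between two good components `S` is the product of the correct signs. If `s` satisfies such an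
  -- edge, it is right at both ends or wrong at both, so the edge is no boundary of `A`.
  · refine le_trans ?_ ((Finset.card_union_le (Finset.univ.filter fun e : D.tree.edgeSet =>
      edgeProd s e ≠ edgeProd (fun i => est i (pivot e)) e) inc).trans
      (Nat.add_le_add_left hinc_le _))
    refine Finset.card_le_card_of_forall_subsingleton (fun (i : Fin m) (e : D.tree.edgeSet) =>
      ∃ j : Fin m, (j : ℕ) = i + 1 ∧ (e : Sym2 (Fin m)) = s(i, j)) ?_ ?_
    · intro i hi
      obtain ⟨j, hij, hne⟩ := (Finset.mem_filter.1 hi).2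
      have hadj : D.tree.Adj i j := by
        rw [hT, SimpleGraph.pathGraph_adj]
        exact Or.inl hij.symm
      refine ⟨⟨s(i, j), hadj⟩, ?_, j, hij, rfl⟩
      rw [Finset.mem_union, Finset.mem_filter, Finset.mem_filter]
      by_cases hbi : D.IsBad G Y X i
      · exact Or.inr ⟨Finset.mem_univ _, i, Finset.mem_filter.2 ⟨Finset.mem_univ _, hbi⟩,
          Sym2.mem_mk_left _ _⟩
      by_cases hbj : D.IsBad G Y X j
      · exact Or.inr ⟨Finset.mem_univ _, j, Finset.mem_filter.2 ⟨Finset.mem_univ _, hbj⟩,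
          Sym2.mem_mk_right _ _⟩
      refine Or.inl ⟨Finset.mem_univ _, ?_⟩
      rw [hlink i j hadj hbi hbj, edgeProd_mk]
      simp only [hA, Finset.mem_filter, Finset.mem_univ, true_and, hbi, hbj, not_false_iff] at hne
      intro heq
      apply hne
      rcases Int.units_eq_one_or (s i) with h1 | h1 <;>
        rcases Int.units_eq_one_or (s j) with h2 | h2 <;>
        rcases Int.units_eq_one_or (t i) with h3 | h3 <;>
        rcases Int.units_eq_one_or (t j) with h4 | h4 <;>
        simp_all
    · rintro e - i ⟨-, j, hj, hej⟩ i' ⟨-, j', hj', hej'⟩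
      rcases Sym2.eq_iff.1 (hej.symm.trans hej') with ⟨h1, -⟩ | ⟨h1, h2⟩
      · exact h1
      · have h1' := congrArg Fin.val h1
        have h2' := congrArg Fin.val h2
        omega
  · have hsub : (Finset.univ.filter fun v => Yhat v ≠ Y v) ⊆ (Bd ∪ A).biUnion D.bag := by
      intro v hv
      have hv' := (Finset.mem_filter.1 hv).2
      refine Finset.mem_biUnion.2 ⟨home v, ?_, hhome v⟩
      rw [Finset.mem_union, hBd, hA, Finset.mem_filter, Finset.mem_filter]
      by_cases hbad : D.IsBad G Y X (home v)
      · exact Or.inl ⟨Finset.mem_univ _, hbad⟩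
      · refine Or.inr ⟨Finset.mem_univ _, hbad, fun hs => hv' ?_⟩
        rw [hY, hs, ht _ hbad v (hhome v), ← mul_assoc, Int.units_mul_self, one_mul]
    calc hammingDist Yhat Y ≤ ((Bd ∪ A).biUnion D.bag).card := by
          rw [hammingDist]
          convert Finset.card_le_card hsub
      _ ≤ (Bd ∪ A).card * b := Finset.card_biUnion_le_card_mul _ _ _ fun i _ => hb i
      _ ≤ (Bd.card + A.card) * b := Nat.mul_le_mul_right _ (Finset.card_union_le _ _)
      _ = _ := by rw [mul_comm]; rfl

end Compare

/-! ### Decompositions of the ring lattice into neighborhoods -/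

/-- The path of the closed neighborhoods, in `H`, of equally spaced vertices. -/
noncomputable def latticeDecomposition (n k : ℕ) (H : SimpleGraph (Fin n)) :
    Decomposition (Fin n) (Fin (ringComponents n k)) where
  probed := H
  tree := SimpleGraph.pathGraph (ringComponents n k)
  bag i := closedNeighborhood H {ringCenter n k i}
  ext i := closedNeighborhood H (closedNeighborhood H {ringCenter n k i})

theorem ringDecomposition_eq (n k : ℕ) :
    ringDecomposition n k = latticeDecomposition n k (ringProbed n k) := rfl

section Lattice

open scoped Classical

variable {n k : ℕ} {H : SimpleGraph (Fin n)}

theorem ringComponents_le (hn : 2 * k + 1 ≤ n) : ringComponents n k ≤ n := by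
  rw [ringComponents]
  refine Nat.div_le_of_le_mul ?_
  nlinarith

theorem two_le_ringComponents (hk : 1 ≤ k) (hn : 2 * k + 1 ≤ n) : 2 ≤ ringComponents n k := by
  rw [ringComponents, Nat.le_div_iff_mul_le (Nat.succ_pos k)]
  omega

theorem ringCenter_val (i : Fin (ringComponents n k)) : (ringCenter n k i : ℕ) = i * (k + 1) := rfl

theorem ringCenter_injective : Function.Injective (ringCenter n k) := fun i j h => by
  have h1 : (i : ℕ) * (k + 1) = j * (k + 1) := congrArg Fin.val h
  exact Fin.ext (Nat.eq_of_mul_eq_mul_right (Nat.succ_pos k) h1)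

theorem latticeDecomposition_bag_subset_ext (i : Fin (ringComponents n k)) :
    (latticeDecomposition n k H).bag i ⊆ (latticeDecomposition n k H).ext i :=
  subset_closedNeighborhood _ _

theorem latticeDecomposition_bag_nonempty (i : Fin (ringComponents n k)) :
    ((latticeDecomposition n k H).bag i).Nonempty :=
  ⟨_, subset_closedNeighborhood _ _ (Finset.mem_singleton_self _)⟩

theorem card_latticeDecomposition_bag_le (hn : 2 * k + 1 ≤ n) (hH : H ≤ ringLattice n k)
    (i : Fin (ringComponents n k)) : ((latticeDecomposition n k H).bag i).card ≤ 2 * k + 1 := by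
  exact (card_closedNeighborhood_le hn hH {ringCenter n k i}).trans (by simp)

theorem card_latticeDecomposition_ext_le (hn : 2 * k + 1 ≤ n) (hH : H ≤ ringLattice n k)
    (i : Fin (ringComponents n k)) :
    ((latticeDecomposition n k H).ext i).card ≤ (2 * k + 1) ^ 2 := by
  rw [pow_two]
  exact (card_closedNeighborhood_le hn hH _).trans
    (Nat.mul_le_mul_right _ (card_latticeDecomposition_bag_le hn hH i))

theorem card_filter_mem_bag_le (hn : 2 * k + 1 ≤ n) (hH : H ≤ ringLattice n k) (v : Fin n) :
    (Finset.univ.filter fun i => v ∈ (latticeDecomposition n k H).bag i).card ≤ 2 * k + 1 := by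
  refine le_trans ?_ (card_closedNeighborhood_le hn hH {v} |>.trans (by simp))
  refine Finset.card_le_card_of_injOn (ringCenter n k) (fun i hi => ?_)
    ringCenter_injective.injOn
  exact mem_closedNeighborhood_singleton_comm.1 (Finset.mem_filter.1 hi).2

theorem card_filter_mem_ext_le (hn : 2 * k + 1 ≤ n) (hH : H ≤ ringLattice n k) (v : Fin n) :
    (Finset.univ.filter fun i => v ∈ (latticeDecomposition n k H).ext i).card ≤
      (2 * k + 1) ^ 2 := by
  have h1 := card_closedNeighborhood_le hn hH {v}
  have h2 := card_closedNeighborhood_le hn hH (closedNeighborhood H {v})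
  rw [Finset.card_singleton, one_mul] at h1
  refine le_trans ?_ (h2.trans ((Nat.mul_le_mul_right _ h1).trans (pow_two _).ge))
  refine Finset.card_le_card_of_injOn (ringCenter n k) (fun i hi => ?_)
    ringCenter_injective.injOn
  exact mem_closedNeighborhood_twice_comm.1 (Finset.mem_filter.1 hi).2

theorem Decomposition.mem_localEdges {V ι : Type*} [Fintype V] {G : SimpleGraph V}
    {D : Decomposition V ι} {i : ι} {e : G.edgeSet} : e ∈ D.localEdges G i ↔
      (e : Sym2 V) ∈ D.probed.edgeSet ∧ ∀ v ∈ (e : Sym2 V), v ∈ D.ext i := by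
  simp [localEdges]

theorem Decomposition.card_localEdges_le {V ι : Type*} [Fintype V] (G : SimpleGraph V)
    (D : Decomposition V ι) (i : ι) : (D.localEdges G i).card ≤ (D.ext i).card ^ 2 := by
  rw [pow_two, ← Finset.card_product]
  refine Finset.card_le_card_of_forall_subsingleton
    (fun (e : G.edgeSet) (x : V × V) => (e : Sym2 V) = s(x.1, x.2)) ?_ ?_
  · rintro ⟨e, hG⟩ he
    induction e using Sym2.ind with
    | h a b =>
      have h := (mem_localEdges.1 he).2
      exact ⟨(a, b), Finset.mem_product.2
        ⟨h a (Sym2.mem_mk_left _ _), h b (Sym2.mem_mk_right _ _)⟩, rfl⟩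
  · intro x _ e he e' he'
    exact Subtype.ext (he.2.trans he'.2.symm)

theorem card_latticeDecomposition_localEdges_le (hn : 2 * k + 1 ≤ n) (hH : H ≤ ringLattice n k)
    (G : SimpleGraph (Fin n)) (i : Fin (ringComponents n k)) :
    ((latticeDecomposition n k H).localEdges G i).card ≤ (2 * k + 1) ^ 4 := by
  refine ((latticeDecomposition n k H).card_localEdges_le G i).trans ?_
  calc _ ≤ ((2 * k + 1) ^ 2) ^ 2 :=
        Nat.pow_le_pow_left (card_latticeDecomposition_ext_le hn hH i) 2
    _ = _ := by ring

theorem latticeDecomposition_treeDegree_le : (latticeDecomposition n k H).treeDegree ≤ 2 := by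
  refine Finset.sup_le fun i _ => ?_
  rw [Set.ncard_eq_toFinset_card']
  have h : (((latticeDecomposition n k H).tree.neighborSet i).toFinset.image Fin.val) ⊆
      {(i : ℕ) + 1, (i : ℕ) - 1} := by
    intro a ha
    obtain ⟨j, hj, rfl⟩ := Finset.mem_image.1 ha
    have hj' : (SimpleGraph.pathGraph (ringComponents n k)).Adj i j := by
      rw [Set.mem_toFinset] at hj
      exact hj
    rw [SimpleGraph.pathGraph_adj] at hj'
    rw [Finset.mem_insert, Finset.mem_singleton]
    omega
  rw [← Finset.card_image_of_injective _ Fin.val_injective]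
  exact (Finset.card_le_card h).trans Finset.card_le_two

theorem mem_bag_of_near (hH : ringProbed n k ≤ H) {v : Fin n} {i : Fin (ringComponents n k)}
    (h1 : (v : ℕ) ≤ i * (k + 1) + k) (h2 : (i : ℕ) * (k + 1) ≤ v + k) :
    v ∈ (latticeDecomposition n k H).bag i := by
  refine mem_closedNeighborhood_singleton.2 ?_
  by_cases h : v = ringCenter n k i
  · exact Or.inl h
  · exact Or.inr (hH ⟨Ne.symm h, h2, h1⟩)

/-- Division by `k + 1`: the intervals of length `k + 1` that start at the centers cover all
vertices. -/
theorem exists_ringComponents_near (v : Fin n) : ∃ i : Fin (ringComponents n k),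
    (i : ℕ) * (k + 1) ≤ v ∧ (v : ℕ) ≤ i * (k + 1) + k := by
  have hv := v.2
  have h1 := Nat.div_add_mod v (k + 1)
  have h2 : (v : ℕ) % (k + 1) < k + 1 := Nat.mod_lt v (Nat.succ_pos k)
  rw [mul_comm] at h1
  have hi : (v : ℕ) / (k + 1) < ringComponents n k := by
    rw [ringComponents, Nat.lt_iff_add_one_le, Nat.le_div_iff_mul_le (Nat.succ_pos k)]
    have h3 := Nat.succ_mul ((v : ℕ) / (k + 1)) (k + 1)
    simp only [Nat.succ_eq_add_one] at h3 ⊢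
    omega
  exact ⟨⟨(v : ℕ) / (k + 1), hi⟩, by simp only; omega, by simp only; omega⟩

theorem exists_mem_bag (hH : ringProbed n k ≤ H) (v : Fin n) :
    ∃ i, v ∈ (latticeDecomposition n k H).bag i := by
  obtain ⟨i, h1, h2⟩ := exists_ringComponents_near (k := k) v
  exact ⟨i, mem_bag_of_near hH h2 (by omega)⟩

/-- The vertex after the first center is at distance `1` from it and `k` from the next one; this
needs `1 ≤ k`. -/
theorem exists_mem_bag_inter (hk : 1 ≤ k) (hH : ringProbed n k ≤ H)
    (i j : Fin (ringComponents n k)) (hij : (j : ℕ) = i + 1) :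
    ∃ v, v ∈ (latticeDecomposition n k H).bag i ∧ v ∈ (latticeDecomposition n k H).bag j := by
  have hj := (ringCenter n k j).2
  have h : (j : ℕ) * (k + 1) = i * (k + 1) + (k + 1) := by rw [hij, Nat.succ_mul]
  rw [ringCenter_val] at hj
  refine ⟨⟨i * (k + 1) + 1, by omega⟩, mem_bag_of_near hH ?_ ?_, mem_bag_of_near hH ?_ ?_⟩ <;>
    simp only <;> omega

theorem near_of_mem_bag {v : Fin n} {i : Fin (ringComponents n k)}
    (h : v ∈ (latticeDecomposition n k (ringProbed n k)).bag i) :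
    (v : ℕ) ≤ i * (k + 1) + k ∧ (i : ℕ) * (k + 1) ≤ v + k := by
  rcases mem_closedNeighborhood_singleton.1 h with rfl | ⟨-, h1, h2⟩
  · rw [ringCenter_val]
    omega
  · exact ⟨h2, h1⟩

theorem near_of_mem_ext {v : Fin n} {i : Fin (ringComponents n k)}
    (h : v ∈ (latticeDecomposition n k (ringProbed n k)).ext i) :
    (v : ℕ) ≤ i * (k + 1) + 2 * k ∧ (i : ℕ) * (k + 1) ≤ v + 2 * k := by
  rcases mem_closedNeighborhood.1 h with h | ⟨w, hw, -, h1, h2⟩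
  · have := near_of_mem_bag h
    omega
  · have := near_of_mem_bag hw
    omega

/-- An extended component reaches at most `2k` to either side of its center, and centers in the same
class mod 4 are at least `4 * (k + 1)` apart, so they have no common vertex. Here it matters that
the probed graph does not close up at the seam. -/
theorem disjoint_localEdges_ringProbed (G : SimpleGraph (Fin n))
    {i j : Fin (ringComponents n k)} (hij : i ≠ j) (hmod : (i : ℕ) % 4 = j % 4) :
    Disjoint ((latticeDecomposition n k (ringProbed n k)).localEdges G i)
      ((latticeDecomposition n k (ringProbed n k)).localEdges G j) := by
  rw [Finset.disjoint_left]
  intro e hi hj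
  have hi' := (Decomposition.mem_localEdges.1 hi).2
  have hj' := (Decomposition.mem_localEdges.1 hj).2
  obtain ⟨e, he⟩ := e
  induction e using Sym2.ind with
  | h a b =>
    have h1 := near_of_mem_ext (hi' a (Sym2.mem_mk_left _ _))
    have h2 := near_of_mem_ext (hj' a (Sym2.mem_mk_left _ _))
    have hne : (i : ℕ) ≠ j := fun h => hij (Fin.ext h)
    rcases Nat.lt_or_ge i j with h | h
    · have h3 : (i : ℕ) + 4 ≤ j := by omega
      have h4 := Nat.mul_le_mul_right (k + 1) h3
      rw [add_mul] at h4
      omega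
    · have h3 : (j : ℕ) + 4 ≤ i := by omega
      have h4 := Nat.mul_le_mul_right (k + 1) h3
      rw [add_mul] at h4
      omega

/-! ### The cuts of a component -/

/-- If `W⋆` contains a full window `f 0, …, f (4k)` of the ring around `W`, then every cut that
separates `W` has at least `2k - 1` edges. -/
theorem le_mincutStar {V ι : Type*} [Fintype V] {G : SimpleGraph V} {D : Decomposition V ι}
    {i : ι} {k : ℕ} (hk : 1 ≤ k) (hG : D.probed ≤ G) (f : ℕ → V)
    (hinj : ∀ a b, a ≤ 4 * k → b ≤ 4 * k → f a = f b → a = b)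
    (hbag : ∀ v, v ∈ D.bag i ↔ ∃ a, k ≤ a ∧ a ≤ 3 * k ∧ v = f a)
    (hext : ∀ a, a ≤ 4 * k → f a ∈ D.ext i)
    (hadj : ∀ a b, a < b → b ≤ a + k → b ≤ 4 * k → D.probed.Adj (f a) (f b)) :
    2 * k - 1 ≤ D.mincutStar G i := by
  have hadj' : ∀ a b, a ≠ b → b ≤ a + k → a ≤ b + k → a ≤ 4 * k → b ≤ 4 * k →
      D.probed.Adj (f a) (f b) := by
    intro a b hne h1 h2 h3 h4
    rcases Nat.lt_or_ge a b with h | h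
    · exact hadj a b h h1 h4
    · exact (hadj b a (by omega) h2 h3).symm
  have hkb : f k ∈ D.bag i := (hbag _).2 ⟨k, le_rfl, by omega, rfl⟩
  -- The infimum of an empty set of naturals is `0`, so an admissible cut must be exhibited: a
  -- single vertex of `W` will do.
  refine le_csInf ?_ ?_
  · refine ⟨_, {f k}, Finset.singleton_subset_iff.2 (hext k (by omega)),
      ⟨f k, hkb, Finset.mem_singleton_self _⟩,
      ⟨f (k + 1), (hbag _).2 ⟨k + 1, by omega, by omega, rfl⟩, fun h => ?_⟩, rfl⟩
    have := hinj _ _ (by omega) (by omega) (Finset.mem_singleton.1 h)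
    omega
  · rintro c ⟨S, -, ⟨v, hv, hvS⟩, ⟨w, hw, hwS⟩, rfl⟩
    obtain ⟨a, ha1, ha2, rfl⟩ := (hbag _).1 hv
    obtain ⟨b, hb1, hb2, rfl⟩ := (hbag _).1 hw
    -- `S` separates two vertices of `W`, so somewhere along the window two consecutive vertices of
    -- `W` are separated.
    obtain ⟨j, hj1, hj2, hj⟩ : ∃ j, k ≤ j ∧ j + 1 ≤ 3 * k ∧ ¬ (f j ∈ S ↔ f (j + 1) ∈ S) := by
      by_contra hne
      push Not at hne
      have key : ∀ d, k + d ≤ 3 * k → (f (k + d) ∈ S ↔ f k ∈ S) := by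
        intro d
        induction d with
        | zero => exact fun _ => Iff.rfl
        | succ d ih =>
          intro h
          exact (hne (k + d) (by omega) (by omega)).symm.trans (ih (by omega))
      have h1 := key (a - k) (by omega)
      have h2 := key (b - k) (by omega)
      rw [Nat.add_sub_cancel' ha1] at h1
      rw [Nat.add_sub_cancel' hb1] at h2
      exact hwS (h2.2 (h1.1 hvS))
    -- Every `l` from `j + 1 - k` to `j + k` is within `k` of both `j` and `j + 1`. As these two lie
    -- on different sides, `l` has a cut edge to one of them. Index `j` is left out so that the edge
    -- joining `j` and `j + 1` is counted once.
    have hcard : ((Finset.Ico (j + 1 - k) (j + 1 + k)).erase j).card = 2 * k - 1 := by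
      rw [Finset.card_erase_of_mem (Finset.mem_Ico.2 ⟨by omega, by omega⟩), Nat.card_Ico]
      omega
    rw [← hcard]
    refine Finset.card_le_card_of_forall_subsingleton (fun (l : ℕ) (e : G.edgeSet) =>
      ∃ x, (x = j ∨ x = j + 1) ∧ (e : Sym2 V) = s(f x, f l)) ?_ ?_
    · intro l hl
      have hlj := Finset.ne_of_mem_erase hl
      have hl' := Finset.mem_Ico.1 (Finset.mem_of_mem_erase hl)
      obtain ⟨x, hx, hne, hcut⟩ : ∃ x, (x = j ∨ x = j + 1) ∧ x ≠ l ∧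
          ¬ (f x ∈ S ↔ f l ∈ S) := by
        by_cases h : f j ∈ S ↔ f l ∈ S
        · refine ⟨j + 1, Or.inr rfl, ?_, fun h' => hj (h.trans h'.symm)⟩
          rintro rfl
          exact hj h
        · exact ⟨j, Or.inl rfl, Ne.symm hlj, h⟩
      have had : D.probed.Adj (f x) (f l) :=
        hadj' x l hne (by omega) (by omega) (by omega) (by omega)
      refine ⟨⟨s(f x, f l), hG had⟩, Finset.mem_filter.2
        ⟨Decomposition.mem_localEdges.2 ⟨had, ?_⟩, ?_⟩, x, hx, rfl⟩
      · intro u hu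
        rcases Sym2.mem_iff.1 hu with rfl | rfl
        · exact hext _ (by omega)
        · exact hext _ (by omega)
      · by_cases h : f x ∈ S
        · exact ⟨f x, h, f l, fun h' => hcut (iff_of_true h h'), rfl⟩
        · refine ⟨f l, ?_, f x, h, Sym2.eq_swap⟩
          by_contra h'
          exact hcut (iff_of_false h h')
    · rintro e - l ⟨hl, x, hx, hex⟩ l' ⟨hl', x', hx', hex'⟩
      have hlj := Finset.ne_of_mem_erase hl
      have hl1 := Finset.mem_Ico.1 (Finset.mem_of_mem_erase hl)
      have hlj' := Finset.ne_of_mem_erase hl'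
      have hl1' := Finset.mem_Ico.1 (Finset.mem_of_mem_erase hl')
      -- If the two representations are swapped, then `l` and `l'` both belong to `{j, j + 1}`, and
      -- since neither is `j` they coincide.
      rcases Sym2.eq_iff.1 (hex.symm.trans hex') with ⟨-, h⟩ | ⟨h1, h2⟩
      · exact hinj _ _ (by omega) (by omega) h
      · have h3 := hinj _ _ (by omega) (by omega) h1
        have h4 := hinj _ _ (by omega) (by omega) h2
        omega

theorem ringShift_ringShift (v : Fin n) (a b : ℕ) :
    ringShift (ringShift v a) b = ringShift v (a + b) :=
  Fin.ext (by
    change ((v + a) % n + b) % n = (v + (a + b)) % n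
    rw [Nat.mod_add_mod, Nat.add_assoc])

theorem ringShift_add_self (v : Fin n) (d : ℕ) : ringShift v (n + d) = ringShift v d :=
  Fin.ext (by
    change (v + (n + d)) % n = (v + d) % n
    rw [← Nat.add_assoc, Nat.add_right_comm, Nat.add_mod_right])

/-- The window starts `2k` before the center, written as a forward shift by `n - 2k`. It has `4k +
1` positions, which are distinct because `4 * k + 1 ≤ n`. -/
theorem le_mincutStar_latticeDecomposition (hk : 1 ≤ k) (hn : 4 * k + 1 ≤ n)
    (hH : H ≤ ringLattice n k) (i : Fin (ringComponents n k))
    (hadj : ∀ a b, a < b → b ≤ a + k → b ≤ 4 * k →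
      H.Adj (ringShift (ringCenter n k i) (n - 2 * k + a))
        (ringShift (ringCenter n k i) (n - 2 * k + b))) :
    2 * k - 1 ≤ (latticeDecomposition n k H).mincutStar (ringLattice n k) i := by
  set c := ringCenter n k i with hc
  set f : ℕ → Fin n := fun a => ringShift c (n - 2 * k + a) with hf
  have hfc : f (2 * k) = c := by
    have := ringShift_add_self c 0
    rw [ringShift_zero] at this
    rw [hf]
    simp only
    rwa [Nat.sub_add_cancel (by omega)]
  have hnear : ∀ a b, a ≤ b + k → b ≤ a + k → a ≤ 4 * k → b ≤ 4 * k →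
      f b = f a ∨ H.Adj (f a) (f b) := by
    intro a b h1 h2 h3 h4
    rcases Nat.lt_trichotomy a b with h | rfl | h
    · exact Or.inr (hadj a b h h2 h4)
    · exact Or.inl rfl
    · exact Or.inr (hadj b a h h1 h3).symm
  have hbag : ∀ a, k ≤ a → a ≤ 3 * k → f a ∈ closedNeighborhood H {c} := by
    intro a h1 h2
    refine mem_closedNeighborhood_singleton.2 ?_
    rw [← hfc]
    exact hnear (2 * k) a (by omega) (by omega) (by omega) (by omega)
  refine le_mincutStar hk hH f ?_ ?_ ?_ hadj
  · intro a b ha hb hab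
    refine ringShift_inj (v := ringShift c (n - 2 * k)) (by omega) (by omega) ?_
    rw [ringShift_ringShift, ringShift_ringShift]
    exact hab
  · intro v
    constructor
    · intro hv
      rcases mem_closedNeighborhood_singleton.1 hv with rfl | hv
      · exact ⟨2 * k, by omega, by omega, hfc.symm⟩
      · obtain ⟨d, hd | hd, rfl⟩ := (ringLattice_adj_iff (by omega) _ _).1 (hH hv)
        · refine ⟨2 * k + d, by omega, by omega, ?_⟩
          rw [hf, ← ringShift_add_self]
          simp only
          rw [← Nat.add_assoc, Nat.sub_add_cancel (by omega)]
        · refine ⟨2 * k + d - n, by omega, by omega, ?_⟩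
          rw [hf]
          simp only
          congr 1
          omega
    · rintro ⟨a, h1, h2, rfl⟩
      exact hbag a h1 h2
  · intro a ha
    refine mem_closedNeighborhood_iff.2 ?_
    rcases Nat.lt_or_ge a (2 * k) with h | h
    · refine ⟨f (a + k), hbag _ (by omega) (by omega), mem_closedNeighborhood_singleton.2 ?_⟩
      exact hnear _ _ (by omega) (by omega) (by omega) (by omega)
    · refine ⟨f (a - k), hbag _ (by omega) (by omega), mem_closedNeighborhood_singleton.2 ?_⟩
      exact hnear _ _ (by omega) (by omega) (by omega) (by omega)

theorem le_mincutStar_ringLattice (hk : 1 ≤ k) (hn : 4 * k + 1 ≤ n)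
    (i : Fin (ringComponents n k)) :
    2 * k - 1 ≤
      (latticeDecomposition n k (ringLattice n k)).mincutStar (ringLattice n k) i := by
  refine le_mincutStar_latticeDecomposition hk hn le_rfl i fun a b h1 h2 h3 => ?_
  refine (ringLattice_adj_iff (by omega) _ _).2 ⟨b - a, Or.inl ⟨by omega, by omega⟩, ?_⟩
  rw [ringShift_ringShift]
  congr 1
  omega

/-- The hypotheses say that the window around the center does not reach the seam; there all edges of
the ring are probed. They also imply `4 * k + 1 ≤ n`. -/
theorem le_mincutStar_ringProbed (hk : 1 ≤ k) (i : Fin (ringComponents n k))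
    (h1 : 2 * k ≤ (i : ℕ) * (k + 1)) (h2 : (i : ℕ) * (k + 1) + 2 * k < n) :
    2 * k - 1 ≤
      (latticeDecomposition n k (ringProbed n k)).mincutStar (ringLattice n k) i := by
  have hval : ∀ a, a ≤ 4 * k → (ringShift (ringCenter n k i) (n - 2 * k + a) : ℕ) =
      i * (k + 1) + a - 2 * k := by
    intro a ha
    change (i * (k + 1) + (n - 2 * k + a)) % n = _
    rw [show (i : ℕ) * (k + 1) + (n - 2 * k + a) = i * (k + 1) + a - 2 * k + n by omega,
      Nat.add_mod_right, Nat.mod_eq_of_lt (by omega)]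
  refine le_mincutStar_latticeDecomposition hk (by omega) ringProbed_le i fun a b h3 h4 h5 => ?_
  have ha := hval a (by omega)
  have hb := hval b h5
  refine ⟨fun h => ?_, ?_, ?_⟩
  · rw [h] at ha
    omega
  · omega
  · omega

end Lattice

/-! ### Admissibility of the decomposition of the ring lattice -/

section EdgeDegree

open scoped Classical

variable {V ι : Type*} [Fintype V] [Fintype ι] {G : SimpleGraph V} {D : Decomposition V ι}

theorem Decomposition.edgeDegreeStar_le_of_ext {b : ℕ} (S : V → Finset ι)
    (hS : ∀ v i, v ∈ D.ext i → i ∈ S v) (hb : ∀ v, (S v).card ≤ b) : D.edgeDegreeStar G ≤ b := by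
  refine Finset.sup_le ?_
  rintro ⟨e, he⟩ -
  induction e using Sym2.ind with
  | h u v =>
    refine le_trans (Finset.card_le_card fun i hi => ?_) (hb u)
    exact hS u i ((mem_localEdges.1 (Finset.mem_filter.1 hi).2).2 u (Sym2.mem_mk_left _ _))

theorem Decomposition.edgeDegreeStar_pos {i : ι} {e : G.edgeSet} (he : e ∈ D.localEdges G i) :
    0 < D.edgeDegreeStar G :=
  lt_of_lt_of_le (Finset.card_pos.2 ⟨i, Finset.mem_filter.2 ⟨Finset.mem_univ _, he⟩⟩)
    (Finset.le_sup (f := fun e : G.edgeSet =>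
      (Finset.univ.filter fun i => e ∈ D.localEdges G i).card) (Finset.mem_univ e))

theorem Decomposition.maxLocalEdges_pos {i : ι} {e : G.edgeSet} (he : e ∈ D.localEdges G i) :
    0 < D.maxLocalEdges G :=
  lt_of_lt_of_le (Finset.card_pos.2 ⟨e, he⟩)
    (Finset.le_sup (f := fun i => (D.localEdges G i).card) (Finset.mem_univ i))

theorem Decomposition.widthStar_pos {V ι : Type*} [Fintype ι] {D : Decomposition V ι} {i : ι} (h : 2 ≤ (D.ext i).card) : 0 < D.widthStar := by
  have h1 : (D.ext i).card ≤ Finset.univ.sup fun i => (D.ext i).card :=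
    Finset.le_sup (f := fun i => (D.ext i).card) (Finset.mem_univ i)
  rw [widthStar]
  omega

end EdgeDegree

/-- The edges of the path, in their order. -/
def pathEdge {m : ℕ} (i : Fin m) : (SimpleGraph.pathGraph (m + 1)).edgeSet :=
  ⟨s(i.castSucc, i.succ), SimpleGraph.pathGraph_adj.2 (Or.inl (by simp))⟩

theorem pathEdge_bijective {m : ℕ} :
    Function.Bijective (pathEdge : Fin m → (SimpleGraph.pathGraph (m + 1)).edgeSet) := by
  constructor
  · intro i j hij
    rcases Sym2.eq_iff.1 (congrArg Subtype.val hij) with ⟨h, -⟩ | ⟨h1, h2⟩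
    · exact Fin.castSucc_injective _ h
    · have h1' := congrArg Fin.val h1
      have h2' := congrArg Fin.val h2
      simp only [Fin.val_castSucc, Fin.val_succ] at h1' h2'
      omega
  · rintro ⟨e, he⟩
    induction e using Sym2.ind with
    | h a b =>
      rcases (SimpleGraph.pathGraph_adj (u := a) (v := b)).1 he with h | h
      · refine ⟨⟨a, by omega⟩, Subtype.ext (Sym2.eq_iff.2 (Or.inl ⟨Fin.ext rfl, Fin.ext h⟩))⟩
      · refine ⟨⟨b, by omega⟩, Subtype.ext (Sym2.eq_iff.2 (Or.inr ⟨Fin.ext rfl, Fin.ext h⟩))⟩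

/-- A connected graph is a tree if it has one edge fewer than vertices; `pathEdge` counts the edges.
-/
theorem pathGraph_isTree {m : ℕ} (hm : 0 < m) : (SimpleGraph.pathGraph m).IsTree := by
  obtain ⟨m, rfl⟩ : ∃ l, m = l + 1 := ⟨m - 1, by omega⟩
  refine SimpleGraph.isTree_iff_connected_and_card.2 ⟨SimpleGraph.pathGraph_connected m, ?_⟩
  rw [← Nat.card_eq_of_bijective _ pathEdge_bijective, Nat.card_fin, Nat.card_fin]

section Admissible

open scoped Classical

variable {n k : ℕ}

theorem ringDecomposition_isTreeDecomposition (hk : 1 ≤ k) (hn : 2 * k + 1 ≤ n) :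
    (ringDecomposition n k).IsTreeDecomposition := by
  have hm := two_le_ringComponents hk hn
  have htree : (SimpleGraph.pathGraph (ringComponents n k)).IsTree := pathGraph_isTree (by omega)
  constructor
  · exact htree
  · exact exists_mem_bag le_rfl
  -- For `u < v`, the component whose interval contains `u` serves if it reaches `v`; otherwise the
  -- one whose interval contains `v` has its center between `u` and `v` and reaches back to `u`.
  · have key : ∀ u v : Fin n, (u : ℕ) < v → (v : ℕ) ≤ u + k →
        ∃ i, u ∈ (ringDecomposition n k).bag i ∧ v ∈ (ringDecomposition n k).bag i := by
      intro u v huv hvk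
      obtain ⟨i, h1, h2⟩ := exists_ringComponents_near (k := k) u
      rcases Nat.lt_or_ge ((i : ℕ) * (k + 1) + k) v with h | h
      · obtain ⟨j, h3, h4⟩ := exists_ringComponents_near (k := k) v
        have hij : (i : ℕ) < j := by
          by_contra hji
          have := Nat.mul_le_mul_right (k + 1) (not_lt.1 hji)
          omega
        have h5 := Nat.mul_le_mul_right (k + 1) (Nat.succ_le_of_lt hij)
        rw [Nat.succ_mul] at h5
        exact ⟨j, mem_bag_of_near le_rfl (by omega) (by omega),
          mem_bag_of_near le_rfl (by omega) (by omega)⟩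
      · exact ⟨i, mem_bag_of_near le_rfl (by omega) (by omega),
          mem_bag_of_near le_rfl (by omega) (by omega)⟩
    rintro u v ⟨hne, h1, h2⟩
    rcases Nat.lt_or_ge u v with h | h
    · exact key u v h h2
    · have hne' : (u : ℕ) ≠ v := fun h' => hne (Fin.ext h')
      obtain ⟨i, hi⟩ := key v u (by omega) h1
      exact ⟨i, hi.2, hi.1⟩
  · intro i j w hw l hl v hvi hvj
    have h1 := near_of_mem_bag hvi
    have h2 := near_of_mem_bag hvj
    -- Centers of intersecting components are at most `2k < 2 * (k + 1)` apart, so the indices are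
    -- equal or adjacent. Since paths in a tree are unique, the given one is trivial or a single
    -- edge.
    have hclose : ∀ a b : ℕ, a * (k + 1) ≤ b * (k + 1) + 2 * k → a ≤ b + 1 := by
      intro a b hab
      by_contra hlt
      have h3 := Nat.mul_le_mul_right (k + 1) (show b + 2 ≤ a by omega)
      rw [add_mul] at h3
      omega
    have h3 := hclose i j (by omega)
    have h4 := hclose j i (by omega)
    by_cases hij : i = j
    · subst hij
      have h5 : w = SimpleGraph.Walk.nil := congrArg Subtype.val
        ((htree.isAcyclic.subsingleton_path i i).elim ⟨w, hw⟩ SimpleGraph.Path.nil)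
      rw [h5, SimpleGraph.Walk.support_nil, List.mem_singleton] at hl
      rwa [hl]
    · have hij' : (i : ℕ) ≠ j := fun h => hij (Fin.ext h)
      have hadj : (SimpleGraph.pathGraph (ringComponents n k)).Adj i j :=
        SimpleGraph.pathGraph_adj.2 (by omega)
      have h5 : w = (SimpleGraph.Path.singleton hadj : (SimpleGraph.pathGraph _).Walk i j) :=
        congrArg Subtype.val ((htree.isAcyclic.subsingleton_path i j).elim ⟨w, hw⟩
          (SimpleGraph.Path.singleton hadj))
      rw [h5] at hl
      have hl' : l ∈ (SimpleGraph.Walk.cons hadj SimpleGraph.Walk.nil :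
        (SimpleGraph.pathGraph (ringComponents n k)).Walk i j).support := hl
      simp only [SimpleGraph.Walk.support_cons, SimpleGraph.Walk.support_nil, List.mem_cons,
        List.not_mem_nil, or_false] at hl'
      rcases hl' with rfl | rfl
      exacts [hvi, hvj]
  · intro i j hij hsub
    -- The center of `j` lies `k + 1` away from that of `i`, just out of reach.
    have h1 := near_of_mem_bag (hsub (mem_bag_of_near (v := ringCenter n k j) le_rfl
      (by rw [ringCenter_val]; omega) (by rw [ringCenter_val]; omega)))
    rw [ringCenter_val] at h1
    rcases SimpleGraph.pathGraph_adj.1 hij with h | h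
    · have h2 : (j : ℕ) * (k + 1) = i * (k + 1) + (k + 1) := by rw [← h, Nat.succ_mul]
      omega
    · have h2 : (i : ℕ) * (k + 1) = j * (k + 1) + (k + 1) := by rw [← h, Nat.succ_mul]
      omega

theorem latticeDecomposition_ext_connected {H : SimpleGraph (Fin n)}
    (i : Fin (ringComponents n k)) :
    (H.induce ((latticeDecomposition n k H).ext i : Set (Fin n))).Connected := by
  have hc : ringCenter n k i ∈ (latticeDecomposition n k H).bag i :=
    subset_closedNeighborhood _ _ (Finset.mem_singleton_self _)
  have hsub := latticeDecomposition_bag_subset_ext (H := H) i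
  have hbag : ∀ (v : Fin n) (hv : v ∈ (latticeDecomposition n k H).bag i),
      (H.induce ((latticeDecomposition n k H).ext i : Set (Fin n))).Reachable
        ⟨v, hsub hv⟩ ⟨ringCenter n k i, hsub hc⟩ := by
    intro v hv
    rcases mem_closedNeighborhood_singleton.1 hv with rfl | h
    · exact SimpleGraph.Reachable.refl _
    · exact SimpleGraph.Adj.reachable (SimpleGraph.Adj.symm h)
  refine (SimpleGraph.connected_iff_exists_forall_reachable _).2
    ⟨⟨ringCenter n k i, hsub hc⟩, ?_⟩
  rintro ⟨v, hv⟩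
  obtain ⟨u, hu, huv⟩ := mem_closedNeighborhood_iff.1 (Finset.mem_coe.1 hv)
  rcases mem_closedNeighborhood_singleton.1 huv with rfl | h
  · exact (hbag v hu).symm
  · have h1 : (H.induce ((latticeDecomposition n k H).ext i : Set (Fin n))).Adj
      ⟨u, hsub hu⟩ ⟨v, hv⟩ := h
    exact (hbag u hu).symm.trans h1.reachable

theorem ringDecomposition_maxLocalEdges_le (hn : 2 * k + 1 ≤ n) :
    (ringDecomposition n k).maxLocalEdges (ringLattice n k) ≤ (2 * k + 1) ^ 4 :=
  Finset.sup_le fun i _ => card_latticeDecomposition_localEdges_le hn ringProbed_le _ i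

theorem ringDecomposition_edgeDegreeStar_le (hn : 2 * k + 1 ≤ n) :
    (ringDecomposition n k).edgeDegreeStar (ringLattice n k) ≤ (2 * k + 1) ^ 2 :=
  Decomposition.edgeDegreeStar_le_of_ext
    (fun v => Finset.univ.filter fun i => v ∈ (ringDecomposition n k).ext i)
    (fun _ _ h => Finset.mem_filter.2 ⟨Finset.mem_univ _, h⟩)
    fun v => card_filter_mem_ext_le hn ringProbed_le v

theorem ringDecomposition_widthStar_le (hn : 2 * k + 1 ≤ n) :
    (ringDecomposition n k).widthStar ≤ (2 * k + 1) ^ 2 :=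
  (Nat.sub_le _ _).trans
    (Finset.sup_le fun i _ => card_latticeDecomposition_ext_le hn ringProbed_le i)

theorem ringDecomposition_isAdmissible (hk : 1 ≤ k) (hn : 2 * k + 1 ≤ n) :
    (ringDecomposition n k).IsAdmissible (ringLattice n k) ((2 * k + 1) ^ 4) := by
  have h24 : (2 * k + 1) ^ 2 ≤ (2 * k + 1) ^ 4 := Nat.pow_le_pow_right (by omega) (by omega)
  exact
  { probed_le := ringProbed_le
    isTreeDecomposition := ringDecomposition_isTreeDecomposition hk hn
    bag_subset_ext := latticeDecomposition_bag_subset_ext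
    treeDegree_le := latticeDecomposition_treeDegree_le.trans (by nlinarith)
    edgeDegreeStar_le := (ringDecomposition_edgeDegreeStar_le hn).trans h24
    maxLocalEdges_le := ringDecomposition_maxLocalEdges_le hn
    widthStar_le := (ringDecomposition_widthStar_le hn).trans h24
    ext_connected := latticeDecomposition_ext_connected }

/-! ### The budget of the decoder on the ring lattice -/

theorem exists_localEdge (hk : 1 ≤ k) (hn : 2 * k + 1 ≤ n) :
    ∃ (i : Fin (ringComponents n k)) (e : (ringLattice n k).edgeSet),
      e ∈ (ringDecomposition n k).localEdges (ringLattice n k) i ∧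
      2 ≤ ((ringDecomposition n k).ext i).card := by
  have hm := two_le_ringComponents hk hn
  set i : Fin (ringComponents n k) := ⟨0, by omega⟩ with hi
  set u : Fin n := ⟨0, by omega⟩ with hu
  set v : Fin n := ⟨1, by omega⟩ with hv
  have hne : u ≠ v := fun h => by simpa [hu, hv] using congrArg Fin.val h
  have hadj : (ringProbed n k).Adj u v := ⟨hne, by simp [hu, hv], by simp [hu, hv]; omega⟩
  have hue : u ∈ (ringDecomposition n k).ext i := latticeDecomposition_bag_subset_ext i
    (mem_bag_of_near le_rfl (by simp [hu, hi]) (by simp [hi]))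
  have hve : v ∈ (ringDecomposition n k).ext i := latticeDecomposition_bag_subset_ext i
    (mem_bag_of_near le_rfl (by simp [hv, hi]; omega) (by simp [hi]))
  refine ⟨i, ⟨s(u, v), ringProbed_le hadj⟩, Decomposition.mem_localEdges.2 ⟨hadj, ?_⟩, ?_⟩
  · intro w hw
    rcases Sym2.mem_iff.1 hw with rfl | rfl
    exacts [hue, hve]
  · rw [← Finset.card_pair hne]
    exact Finset.card_le_card (Finset.insert_subset hue (Finset.singleton_subset_iff.2 hve))

/-- This product multiplies the logarithm in the budget. Were it zero, the budget would leave no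
room for the failure probability. -/
theorem one_le_edgeDegreeStar_mul (hk : 1 ≤ k) (hn : 2 * k + 1 ≤ n) :
    1 ≤ (ringDecomposition n k).edgeDegreeStar (ringLattice n k) *
      (ringDecomposition n k).maxLocalEdges (ringLattice n k) := by
  obtain ⟨i, e, he, -⟩ := exists_localEdge hk hn
  exact Nat.mul_pos (Decomposition.edgeDegreeStar_pos he) (Decomposition.maxLocalEdges_pos he)

theorem one_le_widthStar (hk : 1 ≤ k) (hn : 2 * k + 1 ≤ n) :
    1 ≤ (ringDecomposition n k).widthStar := by
  obtain ⟨i, -, -, h⟩ := exists_localEdge hk hn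
  exact Decomposition.widthStar_pos h

/-- Away from the seam the exponent is at least `k`, because half of `2 * k - 1` rounds up to `k`.
At most `2k` centers are too close to either end, and their terms are bounded by `1`. -/
theorem sum_pow_mincutStar_le (hk : 1 ≤ k) (hn : 2 * k + 1 ≤ n) {p : ℝ} (hp0 : 0 ≤ p)
    (hp1 : p ≤ 1) :
    ∑ i, p ^ (((ringDecomposition n k).mincutStar (ringLattice n k) i + 1) / 2) ≤
      p ^ k * n + 4 * k := by
  set Ex : Finset (Fin (ringComponents n k)) := Finset.univ.filter fun i =>
    ¬ (2 * k ≤ (i : ℕ) * (k + 1) ∧ (i : ℕ) * (k + 1) + 2 * k < n) with hEx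
  have hcard : Ex.card ≤ 4 * k := by
    have h1 : Ex.card ≤ (Finset.range (2 * k) ∪ Finset.Ico (n - 2 * k) n).card := by
      refine Finset.card_le_card_of_injOn (fun i => (ringCenter n k i : ℕ)) (fun i hi => ?_)
        (Fin.val_injective.comp ringCenter_injective).injOn
      have h2 := (Finset.mem_filter.1 hi).2
      have h3 := (ringCenter n k i).2
      rw [ringCenter_val] at h3
      rw [Finset.mem_coe, Finset.mem_union, Finset.mem_range, Finset.mem_Ico]
      simp only [ringCenter_val]
      omega
    refine h1.trans ((Finset.card_union_le _ _).trans ?_)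
    rw [Finset.card_range, Nat.card_Ico]
    omega
  have hterm : ∀ i, p ^ (((ringDecomposition n k).mincutStar (ringLattice n k) i + 1) / 2) ≤
      p ^ k + if i ∈ Ex then 1 else 0 := by
    intro i
    by_cases hi : i ∈ Ex
    · rw [if_pos hi]
      linarith [pow_le_one₀ hp0 hp1
        (n := ((ringDecomposition n k).mincutStar (ringLattice n k) i + 1) / 2),
        pow_nonneg hp0 k]
    · rw [if_neg hi, add_zero]
      rw [hEx, Finset.mem_filter, and_iff_right (Finset.mem_univ _), not_not] at hi
      have h2 := le_mincutStar_ringProbed hk i hi.1 hi.2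
      rw [← ringDecomposition_eq] at h2
      exact pow_le_pow_of_le_one hp0 hp1 (by omega)
  refine (Finset.sum_le_sum fun i _ => hterm i).trans ?_
  rw [Finset.sum_add_distrib, Finset.sum_const, Finset.card_univ, Fintype.card_fin, nsmul_eq_mul,
    mul_comm]
  refine add_le_add (mul_le_mul_of_nonneg_left ?_ (pow_nonneg hp0 k)) ?_
  · exact_mod_cast ringComponents_le hn
  · rw [← Finset.sum_filter, Finset.filter_univ_mem, Finset.sum_const, nsmul_eq_mul, mul_one]
    exact_mod_cast hcard

end Admissible

/-! ### The number of wrongly decoded components is concentrated -/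

theorem expect_const {V : Type*} [Fintype V] {G : SimpleGraph V} {p q : ℝ} {Y : V → ℤˣ} (c : ℝ) :
    expect G p q Y (fun _ => c) = c := by
  classical
  rw [expect_fst (fun _ => c), ← Finset.sum_mul, sum_flipWeight, one_mul]

theorem Decomposition.expect_badCount_le {V ι : Type*} [Fintype V] [Fintype ι] {G : SimpleGraph V}
    (D : Decomposition V ι) (hsub : ∀ i, D.bag i ⊆ D.ext i) {p q : ℝ} (hp0 : 0 ≤ p) (hp1 : p ≤ 1)
    (Y : V → ℤˣ) :
    expect G p q Y (fun o => D.badCount G Y o.1) ≤ ∑ i, D.badBound G p i := by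
  rw [expect_fst (fun X => (D.badCount G Y X : ℝ))]
  exact D.sum_flipWeight_mul_badCount_le hsub hp0 hp1 Y

open scoped Classical in
theorem expect_agreementPenalty_le {V : Type*} [Fintype V] {G : SimpleGraph V} {m : ℕ}
    {bag : Fin m → Finset V} {a : ℕ} (ha0 : 0 < a)
    (ha : ∀ v, (Finset.univ.filter fun i => v ∈ bag i).card ≤ a)
    (hbag : ∀ i, (bag i).Nonempty) {n : ℕ} (hn : 0 < n) (hm : m ≤ n) {p q : ℝ} (hq0 : 0 ≤ q)
    (hq1 : q ≤ 1 / 2) (Y : V → ℤˣ) :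
    expect G p q Y (fun o =>
      agreementPenalty bag n ((1 - 2 * q) / (2 * a)) ((1 - 2 * q) / 2) Y o.2) ≤ 6 := by
  rw [expect_snd]
  exact sum_flipWeight_mul_agreementPenalty_le ha0 ha hbag hn hm hq0 hq1 Y

section Concentration

open scoped Classical

variable {V : Type*} [Fintype V] {G : SimpleGraph V} {m : ℕ} (D : Decomposition V (Fin m))

/-- Jensen's inequality over the four residue classes mod 4. The factor `1 / 4` in the exponent lets
each class be treated separately, without independence between classes. -/
theorem Decomposition.exp_badCount_le (Y : V → ℤˣ) (X : G.edgeSet → ℤˣ) :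
    Real.exp (Real.log 2 / 4 * D.badCount G Y X) ≤ ∑ r ∈ Finset.range 4, (1 / 4 : ℝ) *
      2 ^ ((Finset.univ.filter fun i : Fin m => (i : ℕ) % 4 = r).filter
        fun i => D.IsBad G Y X i).card := by
  set c : ℕ → ℕ := fun r => ((Finset.univ.filter fun i : Fin m => (i : ℕ) % 4 = r).filter
        fun i => D.IsBad G Y X i).card with hc
  have hsum : D.badCount G Y X = ∑ r ∈ Finset.range 4, c r := by
    rw [badCount, Finset.card_eq_sum_card_fiberwise (f := fun i : Fin m => (i : ℕ) % 4)
      (t := Finset.range 4) (fun i _ => Finset.mem_coe.2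
        (Finset.mem_range.2 (Nat.mod_lt _ (by norm_num))))]
    refine Finset.sum_congr rfl fun r _ => ?_
    rw [hc]
    simp only [Finset.filter_filter]
    congr 1
    ext i
    simp [and_comm]
  have h := convexOn_exp.map_sum_le (t := Finset.range 4) (w := fun _ => (1 / 4 : ℝ))
    (p := fun r => Real.log 2 * c r) (fun _ _ => by norm_num) (by norm_num)
    (fun _ _ => Set.mem_univ _)
  have h2 : ∀ r, Real.exp (Real.log 2 * c r) = 2 ^ c r := fun r => by
    rw [mul_comm, Real.exp_nat_mul, Real.exp_log (by norm_num)]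
  simp only [smul_eq_mul, h2] at h
  refine le_trans (le_of_eq ?_) h
  rw [hsum, Nat.cast_sum, Finset.mul_sum]
  exact congrArg Real.exp (Finset.sum_congr rfl fun r _ => by ring)

/-- Within a residue class the edge sets are disjoint, so `sum_flipWeight_mul_two_pow_le` applies;
the average over the four classes keeps the bound. -/
theorem Decomposition.sum_flipWeight_mul_exp_badCount_le (hsub : ∀ i, D.bag i ⊆ D.ext i)
    (hdisj : ∀ i j : Fin m, i ≠ j → (i : ℕ) % 4 = j % 4 →
      Disjoint (D.localEdges G i) (D.localEdges G j))
    {p : ℝ} (hp0 : 0 ≤ p) (hp1 : p ≤ 1) (Y : V → ℤˣ) :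
    ∑ X, flipWeight p (fun e : G.edgeSet => edgeProd Y e) X *
      Real.exp (Real.log 2 / 4 * D.badCount G Y X) ≤ Real.exp (∑ i, D.badBound G p i) := by
  have h1 : ∀ r ∈ Finset.range 4, (1 / 4 : ℝ) *
      ∑ X, flipWeight p (fun e : G.edgeSet => edgeProd Y e) X *
        2 ^ ((Finset.univ.filter fun i : Fin m => (i : ℕ) % 4 = r).filter
          fun i => D.IsBad G Y X i).card ≤ 1 / 4 * Real.exp (∑ i, D.badBound G p i) := by
    intro r _
    refine mul_le_mul_of_nonneg_left ((D.sum_flipWeight_mul_two_pow_le hsub hp0 hp1 Y _ ?_).trans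
      (Real.exp_le_exp.2 (Finset.sum_le_sum_of_subset_of_nonneg (Finset.subset_univ _)
        fun i _ _ => D.badBound_nonneg hp0 i))) (by norm_num)
    intro i hi j hj hij
    exact hdisj i j hij ((Finset.mem_filter.1 hi).2.trans (Finset.mem_filter.1 hj).2.symm)
  calc _ ≤ ∑ X, flipWeight p (fun e : G.edgeSet => edgeProd Y e) X *
        ∑ r ∈ Finset.range 4, (1 / 4 : ℝ) *
          2 ^ ((Finset.univ.filter fun i : Fin m => (i : ℕ) % 4 = r).filter
            fun i => D.IsBad G Y X i).card :=
        Finset.sum_le_sum fun X _ => mul_le_mul_of_nonneg_left (D.exp_badCount_le Y X)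
          (flipWeight_nonneg hp0 hp1 _ _)
    _ = ∑ r ∈ Finset.range 4, (1 / 4 : ℝ) *
        ∑ X, flipWeight p (fun e : G.edgeSet => edgeProd Y e) X *
          2 ^ ((Finset.univ.filter fun i : Fin m => (i : ℕ) % 4 = r).filter
            fun i => D.IsBad G Y X i).card := by
        simp only [Finset.mul_sum]
        rw [Finset.sum_comm]
        exact Finset.sum_congr rfl fun r _ => Finset.sum_congr rfl fun X _ => by ring
    _ ≤ ∑ r ∈ Finset.range 4, 1 / 4 * Real.exp (∑ i, D.badBound G p i) := Finset.sum_le_sum h1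
    _ = _ := by
        rw [Finset.sum_const, Finset.card_range, nsmul_eq_mul]
        push_cast
        ring

theorem Decomposition.sum_badBound_le {p : ℝ} (hp0 : 0 ≤ p) :
    ∑ i, D.badBound G p i ≤
      2 ^ D.maxLocalEdges G * ∑ i, p ^ ((D.mincutStar G i + 1) / 2) := by
  rw [Finset.mul_sum]
  refine Finset.sum_le_sum fun i _ => (D.badBound_le hp0 i).trans
    (mul_le_mul_of_nonneg_right ?_ (pow_nonneg hp0 _))
  exact pow_le_pow_right₀ (by norm_num)
    (Finset.le_sup (f := fun i => (D.localEdges G i).card) (Finset.mem_univ i))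

/-- The first bound lets constants be absorbed into `log (2 / δ)`. The second handles the threshold
`12 / δ` for the agreement penalty: its expectation 6 leaves failure probability `δ / 2`. -/
theorem log_two_bounds {δ : ℝ} (hδ0 : 0 < δ) (hδ1 : δ ≤ 1) :
    1 / 2 ≤ Real.log (2 / δ) ∧ Real.log (12 / δ) ≤ 4 * Real.log (2 / δ) := by
  have h1 : Real.log 2 ≤ Real.log (2 / δ) :=
    Real.log_le_log (by norm_num) (by rw [le_div_iff₀ hδ0]; linarith)
  have h2 := Real.log_two_gt_d9
  refine ⟨by linarith, ?_⟩
  have h3 : Real.log (12 / δ) = Real.log 6 + Real.log (2 / δ) := by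
    rw [← Real.log_mul (by norm_num) (by positivity)]
    congr 1
    ring
  have h4 : Real.log 6 ≤ 3 * Real.log 2 := by
    rw [show (3 : ℝ) * Real.log 2 = Real.log (2 ^ 3) by rw [Real.log_pow]; norm_num]
    exact Real.log_le_log (by norm_num) (by norm_num)
  linarith

theorem Decomposition.componentBudget_nonneg {p δ : ℝ} (hp0 : 0 ≤ p) (hδ0 : 0 < δ) (hδ1 : δ ≤ 1) :
    0 ≤ D.componentBudget G p δ := by
  have h := (log_two_bounds hδ0 hδ1).1
  have h2 : 0 ≤ ∑ i, p ^ ((D.mincutStar G i + 1) / 2) :=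
    Finset.sum_nonneg fun i _ => pow_nonneg hp0 _
  rw [componentBudget]
  have : 0 ≤ Real.log (2 / δ) := by linarith
  positivity

/-- With high probability the number of components decoded wrongly is within the budget. -/
theorem Decomposition.expect_exp_badCount_sub_le (hsub : ∀ i, D.bag i ⊆ D.ext i)
    (hdisj : ∀ i j : Fin m, i ≠ j → (i : ℕ) % 4 = j % 4 →
      Disjoint (D.localEdges G i) (D.localEdges G j))
    (hw : 1 ≤ D.widthStar) (hd : 1 ≤ D.edgeDegreeStar G * D.maxLocalEdges G)
    {p q δ : ℝ} (hp0 : 0 ≤ p) (hp1 : p ≤ 1) (hδ0 : 0 < δ) (hδ1 : δ ≤ 1) (Y : V → ℤˣ) :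
    expect G p q Y (fun o =>
      Real.exp (Real.log 2 / 4 * (D.badCount G Y o.1 - D.componentBudget G p δ))) ≤ δ / 2 := by
  rw [expect_fst (fun X =>
    Real.exp (Real.log 2 / 4 * (D.badCount G Y X - D.componentBudget G p δ)))]
  set K := D.componentBudget G p δ with hK
  set μ := ∑ i, D.badBound G p i with hμ
  have hμ0 : 0 ≤ μ := Finset.sum_nonneg fun i _ => D.badBound_nonneg hp0 i
  have hl := (log_two_bounds hδ0 hδ1).1
  have hsum0 : 0 ≤ 2 ^ D.maxLocalEdges G * ∑ i, p ^ ((D.mincutStar G i + 1) / 2) :=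
    hμ0.trans (D.sum_badBound_le hp0)
  -- The coefficients suffice because `8 * (log 2 / 4) ≥ 1` cancels the exponential moment and `6 *
  -- (log 2 / 4) ≥ 1` leaves `exp (-log (2 / δ)) = δ / 2`. The 8 comes from the factor `2 ^ (w + 2)`
  -- with `w ≥ 1`.
  have hKμ : 8 * μ + 6 * Real.log (2 / δ) ≤ K := by
    have h1 : (8 : ℝ) ≤ 2 ^ (D.widthStar + 2) := by
      calc (8 : ℝ) = 2 ^ 3 := by norm_num
        _ ≤ _ := pow_le_pow_right₀ (by norm_num) (by omega)
    have h2 : (1 : ℝ) ≤ D.edgeDegreeStar G * D.maxLocalEdges G := by exact_mod_cast hd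
    rw [hK, componentBudget, pow_add, mul_assoc]
    have h3 := D.sum_badBound_le (G := G) hp0
    have h4 := mul_le_mul_of_nonneg_right h1 hsum0
    have h5 := mul_le_mul_of_nonneg_right h2 (by linarith : 0 ≤ Real.log (2 / δ))
    linarith
  have h1 : ∀ X : G.edgeSet → ℤˣ, Real.exp (Real.log 2 / 4 * (D.badCount G Y X - K)) =
      Real.exp (Real.log 2 / 4 * D.badCount G Y X) * Real.exp (-(Real.log 2 / 4 * K)) :=
    fun X => by rw [← Real.exp_add]; congr 1; ring
  simp only [h1, ← mul_assoc]
  rw [← Finset.sum_mul]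
  refine (mul_le_mul_of_nonneg_right (D.sum_flipWeight_mul_exp_badCount_le hsub hdisj hp0 hp1 Y)
    (Real.exp_pos _).le).trans ?_
  have h2 : δ / 2 = Real.exp (-Real.log (2 / δ)) := by
    rw [Real.exp_neg, Real.exp_log (by positivity), inv_div]
  rw [h2, ← Real.exp_add, Real.exp_le_exp]
  have h3 := Real.log_two_gt_d9
  have h4 := mul_le_mul_of_nonneg_left hKμ (by linarith : 0 ≤ Real.log 2 / 4)
  nlinarith

end Concentration

/-! ### The error of the decoder -/

section RingError

variable {n k : ℕ}

/-- The constant in the bound on the number of components that are decoded wrongly. -/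
noncomputable def budgetConst (k : ℕ) : ℝ :=
  8 * k * 2 ^ ((2 * k + 1) ^ 2 + 2 + (2 * k + 1) ^ 4) + 6 * (2 * k + 1) ^ 2 * (2 * k + 1) ^ 4

theorem budgetConst_pos (hk : 1 ≤ k) : 0 < budgetConst k := by
  have : (0 : ℝ) < k := by exact_mod_cast hk
  rw [budgetConst]
  positivity

theorem componentBudget_le (hk : 1 ≤ k) (hn : 2 * k + 1 ≤ n) {p δ : ℝ} (hp0 : 0 ≤ p) (hp1 : p ≤ 1)
    (hδ0 : 0 < δ) (hδ1 : δ ≤ 1) :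
    (ringDecomposition n k).componentBudget (ringLattice n k) p δ ≤
      budgetConst k * (p ^ k * n + Real.log (2 / δ)) := by
  have hl := (log_two_bounds hδ0 hδ1).1
  have hk' : (1 : ℝ) ≤ k := by exact_mod_cast hk
  have hpn : 0 ≤ p ^ k * n := by positivity
  set T : ℝ := 2 ^ ((2 * k + 1) ^ 2 + 2 + (2 * k + 1) ^ 4) with hT
  have h1 : (2 : ℝ) ^ ((ringDecomposition n k).widthStar + 2 +
      (ringDecomposition n k).maxLocalEdges (ringLattice n k)) ≤ T := by
    refine pow_le_pow_right₀ (by norm_num) ?_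
    have := ringDecomposition_widthStar_le hn
    have := ringDecomposition_maxLocalEdges_le hn
    omega
  have hT0 : 0 < T := by positivity
  have h2 := sum_pow_mincutStar_le hk hn hp0 hp1
  have h3 : ((ringDecomposition n k).edgeDegreeStar (ringLattice n k) : ℝ) ≤ (2 * k + 1) ^ 2 := by
    exact_mod_cast ringDecomposition_edgeDegreeStar_le hn
  have h4 : ((ringDecomposition n k).maxLocalEdges (ringLattice n k) : ℝ) ≤ (2 * k + 1) ^ 4 := by
    exact_mod_cast ringDecomposition_maxLocalEdges_le hn
  have h5 : (2 : ℝ) ^ ((ringDecomposition n k).widthStar + 2 +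
      (ringDecomposition n k).maxLocalEdges (ringLattice n k)) *
      ∑ i, p ^ (((ringDecomposition n k).mincutStar (ringLattice n k) i + 1) / 2) ≤
      T * (p ^ k * n + 4 * k) :=
    mul_le_mul h1 h2 (Finset.sum_nonneg fun i _ => pow_nonneg hp0 _) hT0.le
  have h6 : 6 * ((ringDecomposition n k).edgeDegreeStar (ringLattice n k) : ℝ) *
      (ringDecomposition n k).maxLocalEdges (ringLattice n k) * Real.log (2 / δ) ≤
      6 * (2 * k + 1) ^ 2 * (2 * k + 1) ^ 4 * Real.log (2 / δ) := by
    refine mul_le_mul_of_nonneg_right ?_ (by linarith)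
    refine mul_le_mul ?_ h4 (Nat.cast_nonneg _) (by positivity)
    linarith
  rw [Decomposition.componentBudget, budgetConst, ← hT]
  refine (add_le_add h5 h6).trans ?_
  set U : ℝ := 6 * (2 * k + 1) ^ 2 * (2 * k + 1) ^ 4 with hU
  have hU0 : 0 ≤ U := by positivity
  have h7 : T * (p ^ k * n) ≤ 8 * k * T * (p ^ k * n) := by
    nlinarith [mul_nonneg hT0.le hpn]
  -- The constant contribution of the seam is absorbed using `1 / 2 ≤ log (2 / δ)`.
  have h8 : T * (4 * k) ≤ 8 * k * T * Real.log (2 / δ) := by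
    nlinarith [mul_pos hT0 (by linarith : (0 : ℝ) < k)]
  nlinarith [mul_nonneg hU0 hpn]

/-- The constant in the bound on the Hamming error. -/
noncomputable def errorConst (k : ℕ) : ℝ :=
  (2 * k + 1) * (budgetConst k + (2 * k + 1) * (4 + 4 * budgetConst k))

theorem one_le_log_natCast {n : ℕ} (hn : 3 ≤ n) : 1 ≤ Real.log n := by
  rw [Real.le_log_iff_exp_le (by positivity)]
  have h : (3 : ℝ) ≤ n := by exact_mod_cast hn
  linarith [Real.exp_one_lt_d9]

/-- The deterministic half of the analysis: the two hypotheses `hJ` and `hQ` hold off an event of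
small probability, and given them every admissible output has small error. -/
theorem hammingDist_le_of_isDecoderOutput (hk : 1 ≤ k) (hn : 2 * k + 1 ≤ n) {p q δ : ℝ}
    (hp0 : 0 ≤ p) (hp1 : p ≤ 1) (hq1 : q < 1 / 2) (hq0 : 0 ≤ q) (hδ0 : 0 < δ) (hδ1 : δ ≤ 1)
    (Y : Fin n → ℤˣ) (X : (ringLattice n k).edgeSet → ℤˣ) (Z Yhat : Fin n → ℤˣ)
    (hout : (ringDecomposition n k).IsDecoderOutput (ringLattice n k)
      ((ringDecomposition n k).treeBudget (ringLattice n k) p δ) X Z Yhat)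
    (hJ : ((ringDecomposition n k).badCount (ringLattice n k) Y X : ℝ) ≤
      (ringDecomposition n k).componentBudget (ringLattice n k) p δ)
    (hQ : agreementPenalty (ringDecomposition n k).bag n ((1 - 2 * q) / (2 * (2 * k + 1 : ℕ)))
      ((1 - 2 * q) / 2) Y Z ≤ 12 / δ) :
    (hammingDist Yhat Y : ℝ) ≤
      errorConst k / (1 / 2 - q) ^ 2 * (p ^ k * n + Real.log (2 / δ)) * Real.log n := by
  set D := ringDecomposition n k with hD
  set K := D.componentBudget (ringLattice n k) p δ with hK
  set J := D.badCount (ringLattice n k) Y X with hJdef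
  obtain ⟨est, pivot, s, home, hest, hpivot, hviol, hopt, hhome, hYhat⟩ := hout
  obtain ⟨A, s', hcost, hviol', hbd, herr⟩ := D.exists_wrong_components rfl
    (card_latticeDecomposition_bag_le hn ringProbed_le) Y Z X s hest hpivot hhome hYhat
  have hK0 : 0 ≤ K := D.componentBudget_nonneg hp0 hδ0 hδ1
  have hdeg : (D.treeDegree : ℝ) ≤ 2 := by
    exact_mod_cast (latticeDecomposition_treeDegree_le : D.treeDegree ≤ 2)
  have hdegJ : (D.treeDegree : ℝ) * J ≤ D.treeDegree * K :=
    mul_le_mul_of_nonneg_left hJ (Nat.cast_nonneg _)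
  have hdegK : (D.treeDegree : ℝ) * K ≤ 2 * K := mul_le_mul_of_nonneg_right hdeg hK0
  have hL : ((D.treeBudget (ringLattice n k) p δ : ℕ) : ℝ) ≤ D.treeDegree * K :=
    Nat.floor_le (by positivity)
  -- The corrected signs `s'` violate at most `deg T * J` edges, an integer below `deg T * K`, so
  -- they fit into the rounded budget and compete with `s`. Optimality of `s` then makes the
  -- agreement on `A` nonpositive.
  have hs' := hopt s' (hviol'.trans (Nat.le_floor (by exact_mod_cast hdegJ)))
  have hagr : (agreement D.bag Y Z A : ℝ) ≤ 0 := by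
    have : agreement D.bag Y Z A ≤ 0 := by
      have h1 : ((∑ i, D.vertexCost Z est i (s i) : ℕ) : ℤ) ≤
        (∑ i, D.vertexCost Z est i (s' i) : ℕ) := by exact_mod_cast hs'
      linarith
    exact_mod_cast this
  -- `2 K` for the violations of `s` and `2 K` for the edges at bad components, the degree of the
  -- path being at most 2.
  have hbd' : ((pathBoundary A).card : ℝ) ≤ 4 * K := by
    have h1 : ((pathBoundary A).card : ℝ) ≤
        (D.treeBudget (ringLattice n k) p δ : ℕ) + D.treeDegree * J := by
      exact_mod_cast hbd.trans (Nat.add_le_add_right hviol _)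
    linarith
  have hlog := one_le_log_natCast (show 3 ≤ n by omega)
  have hθ0 : 0 < (1 - 2 * q) / (2 * (2 * k + 1 : ℕ)) := by
    have : 0 < 1 - 2 * q := by linarith
    positivity
  have hA := card_le_of_agreementPenalty (by omega : 0 < n) hθ0 Y Z A
    (t := Real.log (12 / δ)) (by rwa [Real.exp_log (by positivity)])
  obtain ⟨hl, hl'⟩ := log_two_bounds hδ0 hδ1
  set ℓ := Real.log (2 / δ) with hℓ
  set P := p ^ k * n + ℓ with hP
  have hpn : 0 ≤ p ^ k * n := by positivity
  have hKP : K ≤ budgetConst k * P := componentBudget_le hk hn hp0 hp1 hδ0 hδ1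
  have hC := budgetConst_pos hk
  set C1 := budgetConst k with hC1
  set lg := Real.log n with hlg
  set g := (1 / 2 - q) ^ 2 with hg
  have hg0 : 0 < g := pow_pos (by linarith) 2
  have hg1 : g ≤ 1 := by
    rw [hg]
    nlinarith
  have hA1 : g * A.card ≤ (2 * k + 1) * ((4 + 4 * C1) * (P * lg)) := by
    have h1 : (1 - 2 * q) / 2 * A.card ≤
        (4 * P + 4 * (C1 * P) * lg) / ((1 - 2 * q) / (2 * (2 * k + 1 : ℕ))) := by
      refine hA.trans ?_
      have : (Real.log (12 / δ) + (pathBoundary A).card * lg) /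
          ((1 - 2 * q) / (2 * (2 * k + 1 : ℕ))) ≤
          (4 * P + 4 * (C1 * P) * lg) / ((1 - 2 * q) / (2 * (2 * k + 1 : ℕ))) := by
        refine div_le_div_of_nonneg_right ?_ hθ0.le
        refine add_le_add (by linarith) (mul_le_mul_of_nonneg_right ?_ (by linarith))
        linarith
      linarith
    rw [le_div_iff₀ hθ0] at h1
    -- The square of `1 / 2 - q` has two sources: the drift of the agreement and the exponent `θ`,
    -- each proportional to it.
    have h2 : (1 - 2 * q) / 2 * A.card * ((1 - 2 * q) / (2 * (2 * k + 1 : ℕ))) =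
        g * A.card / (2 * k + 1) := by
      rw [hg]
      push_cast
      field_simp
    rw [h2, div_le_iff₀ (by positivity)] at h1
    have h3 : P ≤ P * lg := le_mul_of_one_le_right (by linarith) hlog
    have h4 : 4 * P + 4 * (C1 * P) * lg ≤ (4 + 4 * C1) * (P * lg) := by linarith
    have h5 := mul_le_mul_of_nonneg_right h4 (by positivity : (0 : ℝ) ≤ 2 * k + 1)
    linarith
  have hJ1 : g * J ≤ C1 * (P * lg) := by
    have h1 : g * J ≤ J := mul_le_of_le_one_left (Nat.cast_nonneg _) hg1
    have h3 : P ≤ P * lg := le_mul_of_one_le_right (by linarith) hlog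
    have h4 := mul_le_mul_of_nonneg_left h3 hC.le
    linarith
  have herr' : (hammingDist Yhat Y : ℝ) ≤ (2 * k + 1) * (J + A.card) := by
    have : (hammingDist Yhat Y : ℝ) ≤ ((2 * k + 1 : ℕ) : ℝ) * ((J : ℝ) + A.card) := by
      exact_mod_cast herr
    push_cast at this
    exact this
  rw [div_mul_eq_mul_div, div_mul_eq_mul_div, le_div_iff₀ hg0, errorConst, ← hC1]
  have h6 := mul_le_mul_of_nonneg_right herr' hg0.le
  have h7 := mul_le_mul_of_nonneg_left (add_le_add hJ1 hA1)
    (by positivity : (0 : ℝ) ≤ 2 * k + 1)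
  linarith

/-- The error of the decoder on the ring lattice, with high probability. -/
theorem observationLaw_decoder_error_le (hk : 1 ≤ k) (hn : 2 * k + 1 ≤ n) {p q δ C : ℝ}
    (hp0 : 0 < p) (hpq : p < q) (hq1 : q < 1 / 2) (hδ0 : 0 < δ) (hδ1 : δ < 1)
    (hC : errorConst k ≤ C) (Y : Fin n → ℤˣ) :
    observationLaw (ringLattice n k) p q Y
      {o | ∃ Yhat : Fin n → ℤˣ,
        (ringDecomposition n k).IsDecoderOutput (ringLattice n k)
          ((ringDecomposition n k).treeBudget (ringLattice n k) p δ) o.1 o.2 Yhat ∧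
        C / (1 / 2 - q) ^ 2 * (p ^ k * n + Real.log (2 / δ)) * Real.log n <
          (hammingDist Yhat Y : ℝ)} ≤ ENNReal.ofReal δ := by
  classical
  have hp1 : p ≤ 1 := by linarith
  have hq0 : 0 ≤ q := by linarith
  set D := ringDecomposition n k with hD
  set K := D.componentBudget (ringLattice n k) p δ with hK
  set Q : (Fin n → ℤˣ) → ℝ := fun Z => agreementPenalty D.bag n
    ((1 - 2 * q) / (2 * (2 * k + 1 : ℕ))) ((1 - 2 * q) / 2) Y Z with hQ
  have hQ0 : ∀ Z, 0 ≤ Q Z := fun Z => agreementPenalty_nonneg _ _ _ _ _ _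
  -- The failure event is dominated by two penalties, one for too many bad components and one for
  -- atypical vertex measurements. Their expectations are at most `δ / 2` and `δ / 12 * 6`.
  refine (observationLaw_le_expect hp0.le hp1 hq0 (by linarith) (f := fun o =>
    Real.exp (Real.log 2 / 4 * (D.badCount (ringLattice n k) Y o.1 - K)) + δ / 12 * Q o.2)
    (fun o => add_nonneg (Real.exp_pos _).le (mul_nonneg (by positivity) (hQ0 _))) ?_).trans
    (ENNReal.ofReal_le_ofReal ?_)
  · rintro ⟨X, Z⟩ ⟨Yhat, hout, herr⟩
    by_contra hlt
    rw [not_le] at hlt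
    simp only at hlt hout
    have hJ : (D.badCount (ringLattice n k) Y X : ℝ) ≤ K := by
      by_contra h
      rw [not_le] at h
      have h1 : 1 ≤ Real.exp (Real.log 2 / 4 * (D.badCount (ringLattice n k) Y X - K)) :=
        Real.one_le_exp (mul_nonneg (by linarith [Real.log_two_gt_d9]) (by linarith))
      linarith [mul_nonneg (by positivity : 0 ≤ δ / 12) (hQ0 Z)]
    have hQZ : Q Z ≤ 12 / δ := by
      rw [le_div_iff₀ hδ0]
      linarith [Real.exp_pos (Real.log 2 / 4 * (D.badCount (ringLattice n k) Y X - K))]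
    have h := hammingDist_le_of_isDecoderOutput hk hn hp0.le hp1 hq1 hq0 hδ0 hδ1.le Y X Z Yhat
      hout hJ hQZ
    refine absurd (herr.trans_le h) (not_lt.2 ?_)
    have hl := (log_two_bounds hδ0 hδ1.le).1
    have hlog := one_le_log_natCast (show 3 ≤ n by omega)
    refine mul_le_mul_of_nonneg_right (mul_le_mul_of_nonneg_right
      (div_le_div_of_nonneg_right hC (sq_nonneg _)) ?_) (by linarith)
    have : 0 ≤ p ^ k * n := by positivity
    linarith
  · rw [expect_add, expect_const_mul]
    have h1 := D.expect_exp_badCount_sub_le (G := ringLattice n k) (q := q)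
      latticeDecomposition_bag_subset_ext
      (fun i j hij hmod => disjoint_localEdges_ringProbed _ hij hmod)
      (one_le_widthStar hk hn) (one_le_edgeDegreeStar_mul hk hn) hp0.le hp1 hδ0 hδ1.le Y
    have h2 := expect_agreementPenalty_le (G := ringLattice n k) (p := p) (bag := D.bag)
      (a := 2 * k + 1) (by omega) (fun v => by
        convert card_filter_mem_bag_le hn ringProbed_le v
        rfl)
      latticeDecomposition_bag_nonempty (by omega : 0 < n) (ringComponents_le hn) hq0 hq1.le Y
    have h3 := mul_le_mul_of_nonneg_left h2 (by positivity : 0 ≤ δ / 12)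
    exact (add_le_add h1 h3).trans (by linarith)

end RingError

/-! ### The upper bound on the minimax error -/

section Upper

variable {n k : ℕ}

/-- Lagrangian form of the decoder: each violated edge costs `lam`. Without a hard budget the
corrected signs are always admissible, so the error can be compared with the actual number of bad
components and averaged. -/
theorem exists_penalized_minimizer {m : ℕ} {V : Type*} [Fintype V] (G : SimpleGraph V)
    (D : Decomposition V (Fin m)) (lam : ℝ) (pivot : Sym2 (Fin m) → V)
    (o : Observation G) : ∃ (est : Fin m → V → ℤˣ) (s : Fin m → ℤˣ),
      (∀ i y, D.localCost G o.1 i (est i) ≤ D.localCost G o.1 i y) ∧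
      ∀ s', ((∑ i, D.vertexCost o.2 est i (s i) : ℕ) : ℝ) + lam * D.violations est pivot s ≤
        ((∑ i, D.vertexCost o.2 est i (s' i) : ℕ) : ℝ) + lam * D.violations est pivot s' := by
  classical
  have h : ∀ i, ∃ y : V → ℤˣ, ∀ y', D.localCost G o.1 i y ≤ D.localCost G o.1 i y' := fun i =>
    Finite.exists_min (D.localCost G o.1 i)
  choose est hest using h
  obtain ⟨s, hs⟩ := Finite.exists_min fun s : Fin m → ℤˣ =>
    ((∑ i, D.vertexCost o.2 est i (s i) : ℕ) : ℝ) + lam * D.violations est pivot s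
  exact ⟨est, s, hest, hs⟩

theorem exists_pivot (hk : 1 ≤ k) {H : SimpleGraph (Fin n)} (hH : ringProbed n k ≤ H)
    (hn : 0 < n) : ∃ pivot : Sym2 (Fin (ringComponents n k)) → Fin n,
      ∀ i j, (latticeDecomposition n k H).tree.Adj i j →
        pivot s(i, j) ∈ (latticeDecomposition n k H).bag i ∧
        pivot s(i, j) ∈ (latticeDecomposition n k H).bag j := by
  have h : ∀ e : Sym2 (Fin (ringComponents n k)), ∃ v : Fin n,
      e ∈ (latticeDecomposition n k H).tree.edgeSet →
        ∀ i ∈ e, v ∈ (latticeDecomposition n k H).bag i := by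
    intro e
    by_cases he : e ∈ (latticeDecomposition n k H).tree.edgeSet
    · induction e using Sym2.ind with
      | h i j =>
        have hij : (SimpleGraph.pathGraph (ringComponents n k)).Adj i j := he
        rcases SimpleGraph.pathGraph_adj.1 hij with h | h
        · obtain ⟨v, hv⟩ := exists_mem_bag_inter hk hH i j h.symm
          refine ⟨v, fun _ l hl => ?_⟩
          rcases Sym2.mem_iff.1 hl with rfl | rfl
          exacts [hv.1, hv.2]
        · obtain ⟨v, hv⟩ := exists_mem_bag_inter hk hH j i h.symm
          refine ⟨v, fun _ l hl => ?_⟩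
          rcases Sym2.mem_iff.1 hl with rfl | rfl
          exacts [hv.2, hv.1]
    · exact ⟨⟨0, hn⟩, fun h => absurd h he⟩
  choose pivot hpivot using h
  exact ⟨pivot, fun i j hij =>
    ⟨hpivot _ hij i (Sym2.mem_mk_left _ _), hpivot _ hij j (Sym2.mem_mk_right _ _)⟩⟩

/-- Without boundaries there is no penalty per edge; the case of the full set is a global sign error
and needs separate care. -/
theorem pathBoundary_eq_empty {m : ℕ} {A : Finset (Fin m)} (h : pathBoundary A = ∅) :
    A = ∅ ∨ A = Finset.univ := by
  classical
  by_cases h0 : ∃ i ∈ A, (i : ℕ) = 0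
  · refine Or.inr (eq_of_pathBoundary_eq (fun i hi => ?_) (h.trans ?_))
    · obtain ⟨j, hj, hj0⟩ := h0
      rw [Fin.ext (hi.trans hj0.symm)]
      exact iff_of_true hj (Finset.mem_univ _)
    · simp [pathBoundary]
  · refine Or.inl (eq_of_pathBoundary_eq (fun i hi => ?_) (h.trans ?_))
    · exact iff_of_false (fun hA => h0 ⟨i, hA, hi⟩) (Finset.notMem_empty _)
    · simp [pathBoundary]

/-- The error of the penalized decoder on the whole ring. -/
theorem hammingDist_penalized_le (hk : 1 ≤ k) (hn : 2 * k + 1 ≤ n) {θ c lam : ℝ} (hθ : 0 < θ)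
    (hc : 0 < c) (hlam : lam = (k + 2) * Real.log n / θ)
    (hlarge : (k + 1) * Real.log n / θ < c * ringComponents n k)
    (Y : Fin n → ℤˣ) (o : Observation (ringLattice n k))
    {est : Fin (ringComponents n k) → Fin n → ℤˣ} {s : Fin (ringComponents n k) → ℤˣ}
    {pivot : Sym2 (Fin (ringComponents n k)) → Fin n} {home : Fin n → Fin (ringComponents n k)}
    (hest : ∀ i y, (latticeDecomposition n k (ringLattice n k)).localCost (ringLattice n k) o.1 i
      (est i) ≤ (latticeDecomposition n k (ringLattice n k)).localCost (ringLattice n k) o.1 i y)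
    (hs : ∀ s', ((∑ i, (latticeDecomposition n k (ringLattice n k)).vertexCost o.2 est i (s i) :
        ℕ) : ℝ) + lam * (latticeDecomposition n k (ringLattice n k)).violations est pivot s ≤
        ((∑ i, (latticeDecomposition n k (ringLattice n k)).vertexCost o.2 est i (s' i) : ℕ) : ℝ) +
        lam * (latticeDecomposition n k (ringLattice n k)).violations est pivot s')
    (hpivot : ∀ i j, (latticeDecomposition n k (ringLattice n k)).tree.Adj i j →
        pivot s(i, j) ∈ (latticeDecomposition n k (ringLattice n k)).bag i ∧
        pivot s(i, j) ∈ (latticeDecomposition n k (ringLattice n k)).bag j)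
    (hhome : ∀ v, v ∈ (latticeDecomposition n k (ringLattice n k)).bag (home v)) :
    (hammingDist (fun v => s (home v) * est (home v) v) Y : ℝ) ≤
      (2 * k + 1) * (1 + 4 * lam / c) *
        (latticeDecomposition n k (ringLattice n k)).badCount (ringLattice n k) Y o.1 +
      (n : ℝ)⁻¹ ^ k *
        agreementPenalty (latticeDecomposition n k (ringLattice n k)).bag n θ c Y o.2 := by
  set D := latticeDecomposition n k (ringLattice n k) with hD
  set J := D.badCount (ringLattice n k) Y o.1 with hJ
  set Q := agreementPenalty D.bag n θ c Y o.2 with hQ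
  have hn0 : (0 : ℝ) < n := by exact_mod_cast (by omega : 0 < n)
  have hlog := one_le_log_natCast (show 3 ≤ n by omega)
  have hQ0 : 0 ≤ Q := agreementPenalty_nonneg _ _ _ _ _ _
  have hlam0 : 0 ≤ lam := by
    rw [hlam]
    positivity
  have hJ0 : (0 : ℝ) ≤ J := Nat.cast_nonneg _
  -- The threshold is `n ^ (k + 1)`: beyond it the trivial error `n` is at most `n⁻¹ ^ k * Q`.
  rcases le_or_gt Q (Real.exp ((k + 1) * Real.log n)) with hQt | hQt
  · obtain ⟨A, s', hcost, hviol', hbd, herr⟩ := D.exists_wrong_components rfl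
      (card_latticeDecomposition_bag_le hn le_rfl) Y o.2 o.1 s hest hpivot hhome (fun _ => rfl)
    have hdeg : D.treeDegree ≤ 2 := latticeDecomposition_treeDegree_le
    have hdegJ : D.treeDegree * J ≤ 2 * J := Nat.mul_le_mul_right _ hdeg
    have hv' : (D.violations est pivot s' : ℝ) ≤ 2 * J := by exact_mod_cast hviol'.trans hdegJ
    have hch : ((pathBoundary A).card : ℝ) ≤ D.violations est pivot s + 2 * J := by
      exact_mod_cast hbd.trans (Nat.add_le_add_left hdegJ _)
    have hcost' : ((∑ i, D.vertexCost o.2 est i (s i) : ℕ) : ℝ) =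
        (∑ i, D.vertexCost o.2 est i (s' i) : ℕ) + (agreement D.bag Y o.2 A : ℝ) := by
      exact_mod_cast hcost
    have hagr : (agreement D.bag Y o.2 A : ℝ) + lam * D.violations est pivot s ≤
        lam * (2 * J) := by
      have h1 := hs s'
      have h2 := mul_le_mul_of_nonneg_left hv' hlam0
      linarith
    have hA := card_le_of_agreementPenalty (by omega : 0 < n) hθ Y o.2 A hQt
    have hk1 : (k + 1) * Real.log n / θ ≤ lam := by
      rw [hlam]
      refine div_le_div_of_nonneg_right ?_ hθ.le
      linarith
    have hkey : c * A.card ≤ 4 * lam * J := by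
      rcases Nat.eq_zero_or_pos (pathBoundary A).card with h0 | h0
      · rw [h0, Nat.cast_zero, zero_mul, add_zero] at hA
        have hv0 : 0 ≤ lam * D.violations est pivot s := by positivity
        rcases pathBoundary_eq_empty (Finset.card_eq_zero.1 h0) with h | h
        · rw [h]
          simp only [Finset.card_empty, Nat.cast_zero, mul_zero]
          positivity
        · rcases Nat.eq_zero_or_pos J with hJz | hJp
          -- With no bad component a global sign error is impossible: it would make `c *
          -- ringComponents n k` at most `(k + 1) * log n / θ`, against `hlarge`.
          · rw [hJz, Nat.cast_zero] at hagr
            rw [h, Finset.card_univ, Fintype.card_fin, ← h] at hA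
            linarith
          · have hJ1 : (1 : ℝ) ≤ J := by exact_mod_cast hJp
            have := mul_le_mul_of_nonneg_left hJ1 hlam0
            linarith [mul_nonneg hlam0 hJ0]
      -- As there is at least one boundary, the allowance `(k + 1) * log n` can be charged to the
      -- boundaries; hence `k + 2` in `lam`. Half of the resulting `4 * lam * J` comes from
      -- boundaries at bad components, half from the comparison with `s'`.
      · have h1 : (1 : ℝ) ≤ (pathBoundary A).card := by exact_mod_cast h0
        have h2 : ((k + 1) * Real.log n + (pathBoundary A).card * Real.log n) / θ ≤
            lam * (pathBoundary A).card := by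
          rw [hlam, div_mul_eq_mul_div]
          refine div_le_div_of_nonneg_right ?_ hθ.le
          have h3 := mul_le_mul_of_nonneg_left h1
            (by positivity : 0 ≤ (k + 1 : ℝ) * Real.log n)
          linarith
        have h3 := mul_le_mul_of_nonneg_left hch hlam0
        linarith
    have hA' : (A.card : ℝ) ≤ 4 * lam / c * J := by
      rw [div_mul_eq_mul_div, le_div_iff₀ hc]
      linarith
    have herr' : (hammingDist (fun v => s (home v) * est (home v) v) Y : ℝ) ≤
        (2 * k + 1) * (J + A.card) := by
      have : (hammingDist (fun v => s (home v) * est (home v) v) Y : ℝ) ≤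
          ((2 * k + 1 : ℕ) : ℝ) * ((J : ℝ) + A.card) := by
        exact_mod_cast herr
      push_cast at this
      exact this
    have h5 := mul_le_mul_of_nonneg_left (add_le_add_right hA' (J : ℝ))
      (by positivity : (0 : ℝ) ≤ 2 * k + 1)
    have h6 : 0 ≤ (n : ℝ)⁻¹ ^ k * Q := by positivity
    linarith
  · have h1 : (hammingDist (fun v => s (home v) * est (home v) v) Y : ℝ) ≤ n := by
      have := hammingDist_le_card_fintype (x := fun v => s (home v) * est (home v) v) (y := Y)
      rw [Fintype.card_fin] at this
      exact_mod_cast this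
    have h2 : Real.exp ((k + 1) * Real.log n) = (n : ℝ) ^ (k + 1) := by
      rw [← Nat.cast_succ, Real.exp_nat_mul, Real.exp_log hn0]
    rw [h2] at hQt
    have h3 : (n : ℝ) ≤ (n : ℝ)⁻¹ ^ k * Q := by
      have h4 := mul_le_mul_of_nonneg_left hQt.le (by positivity : 0 ≤ (n : ℝ)⁻¹ ^ k)
      rwa [pow_succ, ← mul_assoc, ← mul_pow, inv_mul_cancel₀ hn0.ne', one_pow, one_mul] at h4
    have h5 : 0 ≤ (2 * k + 1) * (1 + 4 * lam / c) * (J : ℝ) := by positivity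
    linarith

/-- Components use all ring edges here, also across the seam, while `T` stays a path. For `4 * k + 1
≤ n` every separating cut then has at least `2k - 1` edges, and no additive constant remains, as is
necessary when `p ^ k * n` is small. -/
theorem minimaxHammingError_ringLattice_le_of_large (hk : 1 ≤ k) (hn : 4 * k + 1 ≤ n) {p q : ℝ}
    (hp : 1 / (n : ℝ) ≤ p) (hpq : p < q) (hq : q < 1 / 2)
    (hlarge : (k + 1) * Real.log n / ((1 - 2 * q) / (2 * (2 * k + 1 : ℕ))) <
      (1 - 2 * q) / 2 * ringComponents n k) :
    minimaxHammingError (ringLattice n k) p q ≤ ENNReal.ofReal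
      (((2 * k + 1) * (1 + 4 * (k + 2) / ((1 - 2 * q) / (2 * (2 * k + 1 : ℕ))) /
        ((1 - 2 * q) / 2)) * 2 ^ (2 * k + 1) ^ 4 + 6) * Real.log n * (p ^ k * n)) := by
  classical
  have hn0 : (0 : ℝ) < n := by exact_mod_cast (by omega : 0 < n)
  have hp0 : 0 < p := lt_of_lt_of_le (by positivity) hp
  have hp1 : p ≤ 1 := by linarith
  have hq0 : 0 ≤ q := by linarith
  have hlog := one_le_log_natCast (show 3 ≤ n by omega)
  have hq2 : 0 < 1 - 2 * q := by linarith
  set θ := (1 - 2 * q) / (2 * (2 * k + 1 : ℕ)) with hθ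
  set c := (1 - 2 * q) / 2 with hc
  have hθ0 : 0 < θ := by positivity
  have hc0 : 0 < c := by positivity
  set D := latticeDecomposition n k (ringLattice n k) with hD
  obtain ⟨pivot, hpivot⟩ := exists_pivot hk (ringProbed_le (n := n) (k := k)) (by omega)
  choose home hhome using exists_mem_bag (ringProbed_le (n := n) (k := k))
  set lam := (k + 2) * Real.log n / θ with hlam
  have hlam0 : 0 ≤ lam := by positivity
  choose est s hest hs using fun o => exists_penalized_minimizer (ringLattice n k) D lam pivot o
  refine minimaxHammingError_le hp0.le hp1 hq0 (by linarith)
    (fun o v => s o (home v) * est o (home v) v) fun Y => ?_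
  refine (expect_mono hp0.le hp1 hq0 (by linarith) fun o =>
    hammingDist_penalized_le hk (by omega) hθ0 hc0 hlam hlarge Y o (hest o) (hs o) hpivot
      hhome).trans ?_
  rw [expect_add, expect_const_mul, expect_const_mul]
  have h1 : expect (ringLattice n k) p q Y (fun o => D.badCount (ringLattice n k) Y o.1) ≤
      2 ^ (2 * k + 1) ^ 4 * (p ^ k * n) := by
    refine (D.expect_badCount_le latticeDecomposition_bag_subset_ext hp0.le hp1 Y).trans ?_
    have h2 : ∀ i, D.badBound (ringLattice n k) p i ≤ 2 ^ (2 * k + 1) ^ 4 * p ^ k := fun i =>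
      (D.badBound_le hp0.le i).trans (mul_le_mul (pow_le_pow_right₀ (by norm_num)
        (card_latticeDecomposition_localEdges_le (by omega) le_rfl _ i))
        (pow_le_pow_of_le_one hp0.le hp1 (by
          have := le_mincutStar_ringLattice hk hn i
          rw [← hD] at this
          omega)) (pow_nonneg hp0.le _) (by positivity))
    refine (Finset.sum_le_sum fun i _ => h2 i).trans ?_
    rw [Finset.sum_const, Finset.card_univ, Fintype.card_fin, nsmul_eq_mul, mul_comm, mul_assoc]
    have h3 : (ringComponents n k : ℝ) ≤ n := by
      exact_mod_cast ringComponents_le (by omega : 2 * k + 1 ≤ n)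
    gcongr
  have h2 := expect_agreementPenalty_le (G := ringLattice n k) (p := p) (bag := D.bag)
    (a := 2 * k + 1) (by omega) (fun v => by
      convert card_filter_mem_bag_le (by omega : 2 * k + 1 ≤ n) le_rfl v)
    latticeDecomposition_bag_nonempty (by omega : 0 < n) (ringComponents_le (by omega)) hq0
    hq.le Y
  -- The only use of `1 / n ≤ p`: the remainder from atypical vertex measurements is of order `n⁻¹ ^
  -- k ≤ p ^ k`.
  have h3 : (n : ℝ)⁻¹ ^ k ≤ Real.log n * (p ^ k * n) := by
    have h4 : (n : ℝ)⁻¹ ^ k ≤ p ^ k := pow_le_pow_left₀ (by positivity) (by rwa [← one_div]) k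
    have h5 : (1 : ℝ) ≤ n := by exact_mod_cast (by omega : 1 ≤ n)
    have h6 : p ^ k ≤ p ^ k * n := le_mul_of_one_le_right (by positivity) h5
    have h7 : p ^ k * n ≤ Real.log n * (p ^ k * n) :=
      le_mul_of_one_le_left (by positivity) hlog
    linarith
  have h4 : 1 + 4 * lam / c ≤ (1 + 4 * (k + 2) / θ / c) * Real.log n := by
    have h5 : 4 * lam / c = 4 * (k + 2) / θ / c * Real.log n := by
      rw [hlam]
      ring
    rw [h5]
    linarith
  have hpn : 0 ≤ p ^ k * n := by positivity
  calc _ ≤ (2 * k + 1) * ((1 + 4 * (k + 2) / θ / c) * Real.log n) *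
        (2 ^ (2 * k + 1) ^ 4 * (p ^ k * n)) + Real.log n * (p ^ k * n) * 6 := by
        refine add_le_add (mul_le_mul (mul_le_mul_of_nonneg_left h4 (by positivity)) h1 ?_
          (by positivity)) (mul_le_mul h3 h2 ?_ (by positivity))
        · rw [← expect_const (G := ringLattice n k) (p := p) (q := q) (Y := Y) 0]
          exact expect_mono hp0.le hp1 hq0 (by linarith) fun o => Nat.cast_nonneg _
        · rw [← expect_const (G := ringLattice n k) (p := p) (q := q) (Y := Y) 0]
          exact expect_mono hp0.le hp1 hq0 (by linarith)
            fun o => agreementPenalty_nonneg _ _ _ _ _ _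
    _ = _ := by ring

/-- The upper bound on the minimax error of the ring lattice. -/
theorem minimaxHammingError_ringLattice_le (hk : 1 ≤ k) {q : ℝ} (hq : q < 1 / 2) :
    ∃ C' : ℝ, 0 < C' ∧ ∀ (n : ℕ) (p : ℝ), 2 * k + 1 ≤ n → 1 / (n : ℝ) ≤ p → p < q →
      minimaxHammingError (ringLattice n k) p q ≤
        ENNReal.ofReal (C' * Real.log n * (p ^ k * n)) := by
  have hq2 : 0 < 1 - 2 * q := by linarith
  set θ := (1 - 2 * q) / (2 * (2 * k + 1 : ℕ)) with hθ
  set c := (1 - 2 * q) / 2 with hc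
  have hθ0 : 0 < θ := by positivity
  have hc0 : 0 < c := by positivity
  -- One factor `k + 1` stands before `log n` in the condition of the large case, the other comes
  -- from `n ≤ (k + 1) * ringComponents n k`; the 2 makes the inequality strict.
  set ε := c * θ / (2 * (k + 1) ^ 2) with hε
  have hε0 : 0 < ε := by positivity
  obtain ⟨N, hN⟩ : ∃ N : ℕ, ∀ n : ℕ, N ≤ n → Real.log n ≤ ε * n := by
    have h := (Real.isLittleO_log_id_atTop.bound hε0)
    have h2 := tendsto_natCast_atTop_atTop (R := ℝ) |>.eventually h
    obtain ⟨N, hN⟩ := Filter.eventually_atTop.1 h2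
    refine ⟨N, fun n hn => ?_⟩
    have h3 := hN n hn
    simp only [id, Real.norm_eq_abs, Nat.abs_cast] at h3
    exact (le_abs_self _).trans h3
  set C1 := (2 * k + 1) * (1 + 4 * (k + 2) / θ / c) * 2 ^ (2 * k + 1) ^ 4 + 6 with hC1
  have hC1p : 0 < C1 := by positivity
  set N' := max N (4 * k + 1) with hN'
  refine ⟨max C1 ((N' : ℝ) ^ k), lt_max_of_lt_left hC1p, fun n p hn hp hpq => ?_⟩
  have hn0 : (0 : ℝ) < n := by exact_mod_cast (by omega : 0 < n)
  have hp0 : 0 < p := lt_of_lt_of_le (by positivity) hp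
  have hlog := one_le_log_natCast (show 3 ≤ n by omega)
  have hpn : 0 ≤ p ^ k * n := by positivity
  rcases le_or_gt N' n with hnN | hnN
  · refine (minimaxHammingError_ringLattice_le_of_large hk ((le_max_right _ _).trans hnN) hp hpq
      hq ?_).trans (ENNReal.ofReal_le_ofReal ?_)
    · rw [← hθ, ← hc, div_lt_iff₀ hθ0]
      have h1 := hN n ((le_max_left _ _).trans hnN)
      have h2 : (n : ℝ) ≤ (k + 1) * ringComponents n k := by
        have h3 := Nat.div_add_mod (n + k) (k + 1)
        have h4 : (n + k) % (k + 1) < k + 1 := Nat.mod_lt _ (Nat.succ_pos k)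
        have h5 : n ≤ (k + 1) * ringComponents n k := by
          rw [ringComponents]
          omega
        exact_mod_cast h5
      have hm : (0 : ℝ) < ringComponents n k := by
        exact_mod_cast (by have := two_le_ringComponents hk hn; omega : 0 < ringComponents n k)
      calc (k + 1) * Real.log n ≤ (k + 1) * (ε * ((k + 1) * ringComponents n k)) := by
            refine mul_le_mul_of_nonneg_left (h1.trans ?_) (by positivity)
            exact mul_le_mul_of_nonneg_left h2 hε0.le
        _ = c * ringComponents n k * θ / 2 := by
            rw [hε]
            field_simp
        _ < c * ringComponents n k * θ := by
            have : 0 < c * ringComponents n k * θ := by positivity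
            linarith
    · refine mul_le_mul_of_nonneg_right (mul_le_mul_of_nonneg_right ?_ (by linarith)) hpn
      exact le_max_left _ _
  -- For the finitely many small `n` a constant estimator suffices: `1 / n ≤ p` gives `1 ≤ N' * p`,
  -- so even the error `n` is at most `N' ^ k * p ^ k * n`.
  · refine minimaxHammingError_le hp0.le (by linarith) (by linarith) (by linarith)
      (fun _ _ => 1) fun Y => ?_
    rw [expect_const]
    have h1 : (hammingDist (fun _ => 1) Y : ℝ) ≤ n := by
      have := hammingDist_le_card_fintype (x := fun _ => 1) (y := Y)
      rw [Fintype.card_fin] at this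
      exact_mod_cast this
    have h2 : (1 : ℝ) ≤ (N' : ℝ) ^ k * p ^ k := by
      rw [← mul_pow]
      refine one_le_pow₀ ?_
      have h3 : (n : ℝ) ≤ N' := by exact_mod_cast hnN.le
      rw [div_le_iff₀ hn0] at hp
      nlinarith
    have h4 : (N' : ℝ) ^ k * p ^ k * n ≤ max C1 ((N' : ℝ) ^ k) * Real.log n * (p ^ k * n) := by
      have h5 : (N' : ℝ) ^ k ≤ max C1 ((N' : ℝ) ^ k) * Real.log n :=
        (le_max_right _ _).trans (le_mul_of_one_le_right (hC1p.le.trans (le_max_left _ _)) hlog)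
      have := mul_le_mul_of_nonneg_right h5 hpn
      linarith
    have h6 := mul_le_mul_of_nonneg_right h2 hn0.le
    linarith

end Upper

/-! ### Correctness of the timed programs -/

section TimedLemmas

variable {α β : Type}

@[simp] theorem Timed.val_pure (a : α) : (pure a : Timed α).val = a := rfl

@[simp] theorem Timed.time_pure (a : α) : (pure a : Timed α).time = 0 := rfl

@[simp] theorem Timed.val_bind (x : Timed α) (f : α → Timed β) :
    (x >>= f).val = (f x.val).val := rfl

@[simp] theorem Timed.time_bind (x : Timed α) (f : α → Timed β) :
    (x >>= f).time = x.time + (f x.val).time := rfl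

@[simp] theorem tick_time : tick.time = 1 := rfl

@[simp] theorem Timed.val_ite (c : Prop) [Decidable c] (x y : Timed α) :
    (if c then x else y).val = if c then x.val else y.val := apply_ite _ _ _ _

@[simp] theorem Timed.time_ite (c : Prop) [Decidable c] (x y : Timed α) :
    (if c then x else y).time = if c then x.time else y.time := apply_ite _ _ _ _

end TimedLemmas

theorem lengthT_val {V : Type} (vs : List V) : (lengthT vs).val = vs.length := by
  induction vs with
  | nil => rfl
  | cons v vs ih => simp [lengthT, ih]

section Correctness

variable {V : Type} [DecidableEq V]

/-- The labeling given by lists of vertices and labels. -/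
def labelOf (vs : List V) (ys : List ℤˣ) (v : V) : ℤˣ := (lookupT vs ys v).val

theorem labelOf_map {vs : List V} {v : V} (hv : v ∈ vs) (y : V → ℤˣ) :
    labelOf vs (vs.map y) v = y v := by
  induction vs with
  | nil => simp at hv
  | cons a vs ih =>
    simp only [labelOf, List.map_cons, lookupT, Timed.val_bind, Timed.val_ite, Timed.val_pure]
    by_cases h : a = v
    · simp [h]
    · rw [if_neg h]
      exact ih ((List.mem_cons.1 hv).resolve_left (Ne.symm h))

theorem edgeMismatchT_val (x : V → V → ℤˣ) (vs : List V) (ys : List ℤˣ) (es : List (V × V)) :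
    (edgeMismatchT x vs ys es).val =
      es.countP fun e => labelOf vs ys e.1 * labelOf vs ys e.2 ≠ x e.1 e.2 := by
  induction es with
  | nil => rfl
  | cons e es ih =>
    simp only [edgeMismatchT, Timed.val_bind, Timed.val_pure, ih, List.countP_cons, labelOf]
    split_ifs <;> simp_all

/-- The two recursive calls fix the next sign, and the cheaper one is kept. Signs are added in
front, so the sign chosen first is the last entry of `zs`. -/
theorem bestLabelsT_spec (cost : List ℤˣ → Timed ℕ) (m : ℕ) (ys : List ℤˣ) :
    (bestLabelsT cost m ys).val.1 = (cost (bestLabelsT cost m ys).val.2).val ∧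
    ∀ zs : List ℤˣ, zs.length = m →
      (bestLabelsT cost m ys).val.1 ≤ (cost (zs ++ ys)).val := by
  induction m generalizing ys with
  | zero =>
    refine ⟨rfl, fun zs hzs => ?_⟩
    rw [List.length_eq_zero_iff.1 hzs]
    exact le_rfl
  | succ m ih =>
    obtain ⟨h1, h2⟩ := ih (1 :: ys)
    obtain ⟨h3, h4⟩ := ih (-1 :: ys)
    simp only [bestLabelsT, Timed.val_bind, Timed.val_pure]
    refine ⟨by split_ifs <;> assumption, fun zs hzs => ?_⟩
    obtain ⟨zs', z, rfl⟩ : ∃ zs' z, zs = zs' ++ [z] :=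
      ⟨_, _, (List.dropLast_append_getLast (List.ne_nil_of_length_eq_add_one hzs)).symm⟩
    have hlen : zs'.length = m := by simpa using hzs
    rw [List.append_assoc, List.singleton_append]
    rcases Int.units_eq_one_or z with rfl | rfl
    · have := h2 zs' hlen
      split_ifs <;> omega
    · have := h4 zs' hlen
      split_ifs <;> omega

/-- A competitor `y` enters the search as its list of values on `W.ext`. The hypothesis on the edges
ensures that looking up an endpoint returns its value under `y`, not the default `1`. -/
theorem localEstimateT_spec (x : V → V → ℤˣ) (W : ComponentData V)
    (hW : ∀ e ∈ W.edges, e.1 ∈ W.ext ∧ e.2 ∈ W.ext) (y : V → ℤˣ) :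
    (W.edges.countP fun e => labelOf W.ext (localEstimateT x W).val e.1 *
      labelOf W.ext (localEstimateT x W).val e.2 ≠ x e.1 e.2) ≤
      W.edges.countP fun e => y e.1 * y e.2 ≠ x e.1 e.2 := by
  obtain ⟨h1, h2⟩ := bestLabelsT_spec (fun ys => edgeMismatchT x W.ext ys W.edges) W.ext.length []
  have h3 : (localEstimateT x W).val =
      (bestLabelsT (fun ys => edgeMismatchT x W.ext ys W.edges) W.ext.length []).val.2 := by
    simp only [localEstimateT, Timed.val_bind, Timed.val_pure, lengthT_val]
  have h4 := h2 (W.ext.map y) (by simp)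
  rw [h1, ← h3, List.append_nil, edgeMismatchT_val, edgeMismatchT_val] at h4
  refine h4.trans (le_of_eq (List.countP_congr fun e he => ?_))
  rw [labelOf_map (hW e he).1, labelOf_map (hW e he).2]

theorem vertexCostsT_val (Z : V → ℤˣ) (W : ComponentData V) (ys : List ℤˣ) (vs : List V) :
    (vertexCostsT Z W ys vs).val =
      (vs.countP fun v => (1 : ℤˣ) * labelOf W.ext ys v ≠ Z v,
        vs.countP fun v => (-1 : ℤˣ) * labelOf W.ext ys v ≠ Z v) := by
  induction vs with
  | nil => rfl
  | cons v vs ih =>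
    simp only [vertexCostsT, Timed.val_bind, Timed.val_pure, ih, List.countP_cons]
    change (if labelOf W.ext ys v = Z v then _ else _) = _
    by_cases h : labelOf W.ext ys v = Z v
    · simp [h, (Int.units_ne_neg _).symm]
    · simp [Int.units_eq_neg_of_ne h]

theorem memT_val (v : V) (ws : List V) : (memT v ws).val = decide (v ∈ ws) := by
  induction ws with
  | nil => simp [memT]
  | cons w ws ih =>
    simp only [memT, Timed.val_bind, Timed.val_ite, Timed.val_pure, ih]
    by_cases h : v = w <;> simp [h]

theorem linkT_val (W₁ W₂ : ComponentData V) (ys₁ ys₂ : List ℤˣ) (vs : List V)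
    (h : ∃ v ∈ vs, v ∈ W₂.core) : ∃ v ∈ vs, v ∈ W₂.core ∧
      (linkT W₁ W₂ ys₁ ys₂ vs).val = labelOf W₁.ext ys₁ v * labelOf W₂.ext ys₂ v := by
  induction vs with
  | nil => simp at h
  | cons v vs ih =>
    simp only [linkT, Timed.val_bind, Timed.val_ite, Timed.val_pure, memT_val, decide_eq_true_eq]
    by_cases hv : v ∈ W₂.core
    · refine ⟨v, List.mem_cons_self, hv, ?_⟩
      rw [if_pos hv]
      rfl
    · rw [if_neg hv]
      obtain ⟨u, hu, huW⟩ := h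
      rcases List.mem_cons.1 hu with rfl | hu
      · exact absurd huW hv
      · obtain ⟨w, hw, h1, h2⟩ := ih ⟨u, hu, huW⟩
        exact ⟨w, List.mem_cons_of_mem _ hw, h1, h2⟩

/-- The sign on the edge from the preceding component, if there is one. -/
def linkOf (x : V → V → ℤˣ) (W : ComponentData V) : Option (ComponentData V × List ℤˣ) → ℤˣ
  | none => 1
  | some P => (linkT P.1 W P.2 (localEstimateT x W).val P.1.core).val

/-- The data that the decoder computes for a component. -/
def decodedOf (x : V → V → ℤˣ) (Z : V → ℤˣ) (prev : Option (ComponentData V × List ℤˣ))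
    (W : ComponentData V) : DecodedComponent V :=
  ⟨W, (localEstimateT x W).val, (vertexCostsT Z W (localEstimateT x W).val W.core).val,
    linkOf x W prev⟩

theorem decodeComponentsT_val_cons (x : V → V → ℤˣ) (Z : V → ℤˣ)
    (prev : Option (ComponentData V × List ℤˣ)) (W : ComponentData V)
    (Ws : List (ComponentData V)) :
    (decodeComponentsT x Z prev (W :: Ws)).val = decodedOf x Z prev W ::
      (decodeComponentsT x Z (some (W, (localEstimateT x W).val)) Ws).val := by
  cases prev <;> rfl

/-- The preceding component is passed along as an argument, so the entry at `i` depends on the input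
list only at `i` and `i - 1`. -/
theorem decodeComponentsT_getElem? (x : V → V → ℤˣ) (Z : V → ℤˣ)
    (prev : Option (ComponentData V × List ℤˣ)) (Ws : List (ComponentData V)) (i : ℕ) :
    (decodeComponentsT x Z prev Ws).val[i]? = (Ws[i]?).map (decodedOf x Z
      (if i = 0 then prev else (Ws[i - 1]?).map fun W => (W, (localEstimateT x W).val))) := by
  induction Ws generalizing prev i with
  | nil => simp [decodeComponentsT]
  | cons W Ws ih =>
    rw [decodeComponentsT_val_cons]
    cases i with
    | zero => simp
    | succ i =>
      rw [List.getElem?_cons_succ, ih, List.getElem?_cons_succ]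
      cases i with
      | zero => simp
      | succ i => simp

theorem map_comp_decodeComponentsT (x : V → V → ℤˣ) (Z : V → ℤˣ)
    (prev : Option (ComponentData V × List ℤˣ)) (Ws : List (ComponentData V)) :
    (decodeComponentsT x Z prev Ws).val.map DecodedComponent.comp = Ws := by
  induction Ws generalizing prev with
  | nil => rfl
  | cons W Ws ih => rw [decodeComponentsT_val_cons, List.map_cons, ih]; rfl

theorem length_decodeComponentsT (x : V → V → ℤˣ) (Z : V → ℤˣ)
    (prev : Option (ComponentData V × List ℤˣ)) (Ws : List (ComponentData V)) :
    (decodeComponentsT x Z prev Ws).val.length = Ws.length := by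
  conv_rhs => rw [← map_comp_decodeComponentsT x Z prev Ws, List.length_map]

theorem reverseT_val (ss acc : List ℤˣ) : (reverseT ss acc).val = ss.reverse ++ acc := by
  induction ss generalizing acc with
  | nil => rfl
  | cons s ss ih => simp [reverseT, ih]

theorem writeComponentT_val (s : ℤˣ) (W : ComponentData V) (ys : List ℤˣ) (vs : List V)
    (out : V → ℤˣ) (u : V) : (writeComponentT s W ys vs out).val u =
      if u ∈ vs then s * labelOf W.ext ys u else out u := by
  induction vs generalizing out with
  | nil => simp [writeComponentT]
  | cons v vs ih =>
    simp only [writeComponentT, Timed.val_bind, ih]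
    by_cases hu : u ∈ vs
    · simp [hu]
    · by_cases huv : u = v
      · subst huv
        simp [hu, labelOf]
      · simp [hu, huv]

/-- Components overlap and later writes overwrite earlier ones. For the decoder it only matters that
the final value comes from some component containing `u`, which can be taken as its home. -/
theorem writeAllT_val (ss : List ℤˣ) (Ds : List (DecodedComponent V))
    (hlen : ss.length = Ds.length) (out : V → ℤˣ) (u : V) :
    (∃ (i : ℕ) (s : ℤˣ) (W : DecodedComponent V), ss[i]? = some s ∧ Ds[i]? = some W ∧
      u ∈ W.comp.core ∧ (writeAllT ss Ds out).val u = s * labelOf W.comp.ext W.labels u) ∨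
    ((∀ W ∈ Ds, u ∉ W.comp.core) ∧ (writeAllT ss Ds out).val u = out u) := by
  induction ss generalizing Ds out with
  | nil =>
    rw [List.length_nil, eq_comm, List.length_eq_zero_iff] at hlen
    subst hlen
    exact Or.inr ⟨by simp, rfl⟩
  | cons s ss ih =>
    cases Ds with
    | nil => simp at hlen
    | cons W Ds =>
      have hlen' : ss.length = Ds.length := by simpa using hlen
      simp only [writeAllT, Timed.val_bind]
      rcases ih Ds hlen' (writeComponentT s W.comp W.labels W.comp.core out).val with
        ⟨i, s', W', h1, h2, h3, h4⟩ | ⟨h1, h2⟩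
      · exact Or.inl ⟨i + 1, s', W', h1, h2, h3, h4⟩
      · rw [writeComponentT_val] at h2
        by_cases hu : u ∈ W.comp.core
        · rw [if_pos hu] at h2
          exact Or.inl ⟨0, s, W, rfl, rfl, hu, h2⟩
        · rw [if_neg hu] at h2
          refine Or.inr ⟨fun W' hW' => ?_, h2⟩
          rcases List.mem_cons.1 hW' with rfl | hW'
          exacts [hu, h1 W' hW']

end Correctness

/-! ### The dynamic program -/

section DynamicProgram

variable {V : Type}

variable (κ : ℕ → ℤˣ → ℕ) (τ : ℕ → ℤˣ)

/-- The cost of a list of signs, last component first. -/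
def signCost : List ℤˣ → ℕ
  | [] => 0
  | s :: ss => signCost ss + κ ss.length s

/-- The number of violated edges for a list of signs, last component first. -/
def signViolations : List ℤˣ → ℕ
  | s :: s' :: ss => signViolations (s' :: ss) + if s' * s = τ (ss.length + 1) then 0 else 1
  | _ => 0

/-- An entry of the table for `j + 1` components, the sign `s` of the last one, and the
budget `b`. -/
def EntrySpec (j : ℕ) (s : ℤˣ) (b : ℕ) (e : ℕ × List ℤˣ) : Prop :=
  (∃ tl : List ℤˣ, e.2 = s :: tl ∧ tl.length = j) ∧ signCost κ e.2 = e.1 ∧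
    signViolations τ e.2 ≤ b ∧
    ∀ tl : List ℤˣ, tl.length = j → signViolations τ (s :: tl) ≤ b → e.1 ≤ signCost κ (s :: tl)

/-- A row of the table, starting with the budget `b`. -/
def RowSpec (j : ℕ) (s : ℤˣ) : ℕ → List (ℕ × List ℤˣ) → Prop
  | _, [] => True
  | b, e :: row => EntrySpec κ τ j s b e ∧ RowSpec j s (b + 1) row

variable {κ τ}

theorem initialRowT_spec (s : ℤˣ) (L b : ℕ) :
    RowSpec κ τ 0 s b (initialRowT s (κ 0 s) L).val ∧
      (initialRowT s (κ 0 s) L).val.length = L + 1 := by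
  have h : ∀ b, EntrySpec κ τ 0 s b (κ 0 s, [s]) := fun b => by
    refine ⟨⟨[], rfl, rfl⟩, by simp [signCost], by simp [signViolations], fun tl htl _ => ?_⟩
    rw [List.length_eq_zero_iff.1 htl]
    simp [signCost]
  induction L generalizing b with
  | zero => exact ⟨⟨h b, trivial⟩, rfl⟩
  | succ L ih =>
    simp only [initialRowT, Timed.val_bind, Timed.val_pure, List.length_cons, (ih (b + 1)).2]
    exact ⟨⟨h b, (ih (b + 1)).1⟩, trivial⟩

theorem signCost_cons (s : ℤˣ) (ss : List ℤˣ) :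
    signCost κ (s :: ss) = signCost κ ss + κ ss.length s := rfl

theorem signViolations_cons_cons (s s' : ℤˣ) (ss : List ℤˣ) :
    signViolations τ (s :: s' :: ss) =
      signViolations τ (s' :: ss) + if s' * s = τ (ss.length + 1) then 0 else 1 := rfl

/-- The Bellman step. Given `s`, the preceding sign is `s * τ (j + 1)` if the edge is satisfied and
its negative otherwise; in the second case one unit of budget is spent, which is impossible for
budget `0`, where there is no carry. -/
theorem EntrySpec.extend {j b : ℕ} {s : ℤˣ} {a : ℕ × List ℤˣ} {carry : Option (ℕ × List ℤˣ)}
    (ha : EntrySpec κ τ j (s * τ (j + 1)) b a)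
    (hcarry : (carry = none ∧ b = 0) ∨
      ∃ d b', carry = some d ∧ b = b' + 1 ∧ EntrySpec κ τ j (-(s * τ (j + 1))) b' d) :
    EntrySpec κ τ (j + 1) s b
      ((match carry with
        | none => a
        | some d => if a.1 ≤ d.1 then a else d).1 + κ (j + 1) s,
      s :: (match carry with
        | none => a
        | some d => if a.1 ≤ d.1 then a else d).2) := by
  have hsame : ∀ e : ℕ × List ℤˣ, EntrySpec κ τ j (s * τ (j + 1)) b e →
      (∃ tl : List ℤˣ, s :: e.2 = s :: tl ∧ tl.length = j + 1) ∧
      signCost κ (s :: e.2) = e.1 + κ (j + 1) s ∧ signViolations τ (s :: e.2) ≤ b := by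
    rintro ⟨c, ss⟩ ⟨⟨tl, htl, hlen⟩, h1, h2, -⟩
    simp only at htl h1 h2
    subst htl
    refine ⟨⟨_, rfl, by simp [hlen]⟩, ?_, ?_⟩
    · rw [signCost_cons, h1, List.length_cons, hlen]
    · rw [signViolations_cons_cons, hlen, if_pos, add_zero]
      · exact h2
      · rw [mul_right_comm, Int.units_mul_self, one_mul]
  have hdiff : ∀ (e : ℕ × List ℤˣ) (b' : ℕ), EntrySpec κ τ j (-(s * τ (j + 1))) b' e →
      (∃ tl : List ℤˣ, s :: e.2 = s :: tl ∧ tl.length = j + 1) ∧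
      signCost κ (s :: e.2) = e.1 + κ (j + 1) s ∧ signViolations τ (s :: e.2) ≤ b' + 1 := by
    rintro ⟨c, ss⟩ b' ⟨⟨tl, htl, hlen⟩, h1, h2, -⟩
    simp only at htl h1 h2
    subst htl
    refine ⟨⟨_, rfl, by simp [hlen]⟩, ?_, ?_⟩
    · rw [signCost_cons, h1, List.length_cons, hlen]
    · rw [signViolations_cons_cons]
      refine Nat.add_le_add h2 ?_
      split_ifs <;> omega
  -- Every competitor is split by its preceding sign and is bounded below by the table entry for
  -- that sign.
  have hcand : ∀ tl : List ℤˣ, tl.length = j + 1 → signViolations τ (s :: tl) ≤ b →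
      a.1 ≤ signCost κ tl ∨ ∃ d, carry = some d ∧ d.1 ≤ signCost κ tl := by
    intro tl htl hv
    cases tl with
    | nil => simp at htl
    | cons s' tl =>
      have hlen : tl.length = j := by simpa using htl
      rw [signViolations_cons_cons, hlen] at hv
      by_cases hs : s' = s * τ (j + 1)
      · subst hs
        exact Or.inl (ha.2.2.2 tl hlen (by omega))
      · have hs' := Int.units_eq_neg_of_ne hs
        subst hs'
        rw [if_neg] at hv
        · rcases hcarry with ⟨-, rfl⟩ | ⟨d, b', rfl, rfl, hd⟩
          · omega
          · exact Or.inr ⟨d, rfl, hd.2.2.2 tl hlen (by omega)⟩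
        · rw [neg_mul, mul_right_comm, Int.units_mul_self, one_mul]
          exact (Int.units_ne_neg _).symm
  rcases hcarry with ⟨rfl, rfl⟩ | ⟨d, b', rfl, rfl, hd⟩
  · obtain ⟨h1, h2, h3⟩ := hsame a ha
    refine ⟨h1, h2, h3, fun tl htl hv => ?_⟩
    rw [signCost_cons, htl]
    rcases hcand tl htl hv with h | ⟨d, hd, -⟩
    · exact Nat.add_le_add_right h _
    · simp at hd
  · simp only
    split_ifs with had
    · obtain ⟨h1, h2, h3⟩ := hsame a ha
      refine ⟨h1, h2, h3, fun tl htl hv => ?_⟩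
      rw [signCost_cons, htl]
      rcases hcand tl htl hv with h | ⟨d', hd', h⟩
      · exact Nat.add_le_add_right h _
      · rw [← Option.some_inj.1 hd'] at h
        exact Nat.add_le_add_right (had.trans h) _
    · obtain ⟨h1, h2, h3⟩ := hdiff d b' hd
      refine ⟨h1, h2, h3, fun tl htl hv => ?_⟩
      rw [signCost_cons, htl]
      rcases hcand tl htl hv with h | ⟨d', hd', h⟩
      · exact Nat.add_le_add_right ((not_le.1 had).le.trans h) _
      · rw [← Option.some_inj.1 hd'] at h
        exact Nat.add_le_add_right h _

/-- Both rows are traversed in step; `carry` delays the violating row by one position, so that it is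
read at a budget smaller by one. -/
theorem nextRowT_spec {j : ℕ} {s : ℤˣ} (same diff : List (ℕ × List ℤˣ)) (b : ℕ)
    (carry : Option (ℕ × List ℤˣ)) (hlen : same.length = diff.length)
    (hsame : RowSpec κ τ j (s * τ (j + 1)) b same)
    (hdiff : RowSpec κ τ j (-(s * τ (j + 1))) b diff)
    (hcarry : (carry = none ∧ b = 0) ∨
      ∃ d b', carry = some d ∧ b = b' + 1 ∧ EntrySpec κ τ j (-(s * τ (j + 1))) b' d) :
    RowSpec κ τ (j + 1) s b (nextRowT s (κ (j + 1) s) same diff carry).val ∧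
      (nextRowT s (κ (j + 1) s) same diff carry).val.length = same.length := by
  induction same generalizing diff b carry with
  | nil => exact ⟨trivial, rfl⟩
  | cons a same ih =>
    cases diff with
    | nil => simp at hlen
    | cons d diff =>
      have h := ih diff (b + 1) (some d) (by simpa using hlen) hsame.2 hdiff.2
        (Or.inr ⟨d, b, rfl, rfl, hdiff.1⟩)
      simp only [nextRowT, Timed.val_bind, Timed.val_pure, List.length_cons, h.2]
      exact ⟨⟨EntrySpec.extend hsame.1 hcarry, h.1⟩, trivial⟩

theorem lastEntryT_spec {j : ℕ} {s : ℤˣ} (row : List (ℕ × List ℤˣ)) (b L : ℕ)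
    (hrow : RowSpec κ τ j s b row) (hlen : row.length = L + 1) :
    EntrySpec κ τ j s (b + L) (lastEntryT row).val := by
  induction row generalizing b L with
  | nil => simp at hlen
  | cons a row ih =>
    cases row with
    | nil =>
      have hL : L = 0 := by simpa using hlen.symm
      rw [hL]
      exact hrow.1
    | cons a' row =>
      obtain ⟨L, rfl⟩ : ∃ L', L = L' + 1 := ⟨row.length, by simpa using hlen.symm⟩
      have h := ih (b + 1) L hrow.2 (by simpa using hlen)
      rw [show b + (L + 1) = b + 1 + L by omega]
      exact h

/-- Optimality of a list of signs for `j` components within the budget `L`. -/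
def OptimalSigns (κ : ℕ → ℤˣ → ℕ) (τ : ℕ → ℤˣ) (j L : ℕ) (ss : List ℤˣ) : Prop :=
  ss.length = j ∧ signViolations τ ss ≤ L ∧
    ∀ ss' : List ℤˣ, ss'.length = j → signViolations τ ss' ≤ L → signCost κ ss ≤ signCost κ ss'

/-- The list `Ws` of components carries the costs and signs from position `j` on. -/
def Carries (κ : ℕ → ℤˣ → ℕ) (τ : ℕ → ℤˣ) (j : ℕ) (Ws : List (DecodedComponent V)) : Prop :=
  ∀ i W, Ws[i]? = some W → W.costs = (κ (j + i) 1, κ (j + i) (-1)) ∧ W.link = τ (j + i)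

theorem Carries.tail {j : ℕ} {W : DecodedComponent V} {Ws : List (DecodedComponent V)}
    (h : Carries κ τ j (W :: Ws)) : Carries κ τ (j + 1) Ws := fun i W' hW' => by
  have := h (i + 1) W' hW'
  rwa [show j + (i + 1) = j + 1 + i by omega] at this

/-- The invariant is one correct row for each sign of the last treated component. The link decides
which of the two rows plays the satisfied part. -/
theorem pathProgramT_spec (L : ℕ) (Ws : List (DecodedComponent V)) (j : ℕ)
    (rowP rowM : List (ℕ × List ℤˣ)) (hP : RowSpec κ τ j 1 0 rowP) (hM : RowSpec κ τ j (-1) 0 rowM)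
    (hPl : rowP.length = L + 1) (hMl : rowM.length = L + 1) (hW : Carries κ τ (j + 1) Ws) :
    OptimalSigns κ τ (j + 1 + Ws.length) L (pathProgramT rowP rowM Ws).val := by
  induction Ws generalizing j rowP rowM with
  | nil =>
    obtain ⟨⟨tl, h1, h1'⟩, h2, h3, h4⟩ := lastEntryT_spec rowP 0 L hP hPl
    obtain ⟨⟨tl', h5, h5'⟩, h6, h7, h8⟩ := lastEntryT_spec rowM 0 L hM hMl
    rw [Nat.zero_add] at h3 h4 h7 h8
    simp only [pathProgramT, Timed.val_bind, Timed.val_pure, List.length_nil, Nat.add_zero]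
    have hcand : ∀ ss' : List ℤˣ, ss'.length = j + 1 → signViolations τ ss' ≤ L →
        (lastEntryT rowP).val.1 ≤ signCost κ ss' ∨ (lastEntryT rowM).val.1 ≤ signCost κ ss' := by
      intro ss' hlen hv
      cases ss' with
      | nil => simp at hlen
      | cons s tl =>
        have hlen' : tl.length = j := by simpa using hlen
        rcases Int.units_eq_one_or s with rfl | rfl
        exacts [Or.inl (h4 tl hlen' hv), Or.inr (h8 tl hlen' hv)]
    split_ifs with h
    · refine ⟨by rw [h1]; simp [h1'], h3, fun ss' hlen hv => ?_⟩
      rw [h2]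
      rcases hcand ss' hlen hv with h9 | h9 <;> omega
    · refine ⟨by rw [h5]; simp [h5'], h7, fun ss' hlen hv => ?_⟩
      rw [h6]
      rcases hcand ss' hlen hv with h9 | h9 <;> omega
  | cons W Ws ih =>
    obtain ⟨hc, hl⟩ := hW 0 W rfl
    rw [Nat.add_zero] at hc hl
    have hnone : ∀ s : ℤˣ, (none : Option (ℕ × List ℤˣ)) = none ∧ 0 = 0 ∨
        ∃ d b', none = some d ∧ 0 = b' + 1 ∧ EntrySpec κ τ j (-(s * τ (j + 1))) b' d :=
      fun s => Or.inl ⟨rfl, rfl⟩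
    simp only [pathProgramT, Timed.val_bind, Timed.val_ite, hc, hl, List.length_cons]
    rw [show j + 1 + (Ws.length + 1) = j + 1 + 1 + Ws.length by omega]
    rcases Int.units_eq_one_or (τ (j + 1)) with ht | ht
    · rw [if_pos ht, if_pos ht]
      obtain ⟨h1, h2⟩ := nextRowT_spec (κ := κ) (τ := τ) (j := j) (s := 1) rowP rowM 0 none
        (hPl.trans hMl.symm) (by rw [ht]; exact hP) (by rw [ht]; exact hM) (hnone _)
      obtain ⟨h3, h4⟩ := nextRowT_spec (κ := κ) (τ := τ) (j := j) (s := -1) rowM rowP 0 none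
        (hMl.trans hPl.symm) (by rw [ht]; exact hM) (by rw [ht]; exact hP) (hnone _)
      exact ih (j + 1) _ _ h1 h3 (h2.trans hPl) (h4.trans hMl) hW.tail
    · have hne : τ (j + 1) ≠ 1 := by rw [ht]; decide
      rw [if_neg hne, if_neg hne]
      obtain ⟨h1, h2⟩ := nextRowT_spec (κ := κ) (τ := τ) (j := j) (s := 1) rowM rowP 0 none
        (hMl.trans hPl.symm) (by rw [ht]; exact hM) (by rw [ht]; exact hP) (hnone _)
      obtain ⟨h3, h4⟩ := nextRowT_spec (κ := κ) (τ := τ) (j := j) (s := -1) rowP rowM 0 none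
        (hPl.trans hMl.symm) (by rw [ht]; exact hP) (by rw [ht]; exact hM) (hnone _)
      exact ih (j + 1) _ _ h1 h3 (h2.trans hMl) (h4.trans hPl) hW.tail

theorem pathDecoderT_spec (L : ℕ) (Ws : List (DecodedComponent V)) (hW : Carries κ τ 0 Ws) :
    OptimalSigns κ τ Ws.length L (pathDecoderT L Ws).val := by
  cases Ws with
  | nil =>
    refine ⟨rfl, Nat.zero_le _, fun ss' hlen _ => ?_⟩
    exact Nat.zero_le _
  | cons W Ws =>
    obtain ⟨hc, -⟩ := hW 0 W rfl
    simp only [pathDecoderT, Timed.val_bind, hc, Nat.add_zero, List.length_cons]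
    obtain ⟨h1, h2⟩ := initialRowT_spec (κ := κ) (τ := τ) 1 L 0
    obtain ⟨h3, h4⟩ := initialRowT_spec (κ := κ) (τ := τ) (-1) L 0
    have h := pathProgramT_spec L Ws 0 _ _ h1 h3 h2 h4 hW.tail
    rwa [Nat.zero_add, Nat.add_comm 1] at h

theorem signCost_eq (ss : List ℤˣ) : signCost κ ss =
    ∑ i ∈ Finset.range ss.length, κ i (ss.reverse.getD i 1) := by
  induction ss with
  | nil => rfl
  | cons s ss ih =>
    rw [signCost_cons, ih, List.length_cons, Finset.sum_range_succ]
    congr 1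
    · refine Finset.sum_congr rfl fun i hi => ?_
      rw [List.reverse_cons, List.getD_append]
      simpa using hi
    · rw [List.reverse_cons, List.getD_append_right] <;> simp

theorem signViolations_eq (ss : List ℤˣ) : signViolations τ ss =
    ∑ i ∈ Finset.range (ss.length - 1),
      if ss.reverse.getD i 1 * ss.reverse.getD (i + 1) 1 = τ (i + 1) then 0 else 1 := by
  induction ss with
  | nil => rfl
  | cons s ss ih =>
    cases ss with
    | nil => rfl
    | cons s' ss =>
      rw [signViolations_cons_cons, ih]
      simp only [List.length_cons, Nat.add_sub_cancel]
      rw [Finset.sum_range_succ]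
      congr 1
      · refine Finset.sum_congr rfl fun i hi => ?_
        have hi' := Finset.mem_range.1 hi
        rw [List.reverse_cons (a := s), List.getD_append _ _ _ i, List.getD_append]
        · simp
          omega
        · simp
          omega
      · rw [List.reverse_cons (a := s), List.getD_append _ _ _ ss.length,
          List.getD_append_right _ _ _ (ss.length + 1)]
        · rw [List.reverse_cons, List.getD_append_right] <;> simp
        · simp
        · simp

end DynamicProgram

/-! ### The output of the program -/

theorem Finset.card_filter_eq_countP_toList {α : Type*} (s : Finset α) (P : α → Prop)
    [DecidablePred P] : (s.filter P).card = s.toList.countP fun a => P a := by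
  rw [← Multiset.coe_countP, Finset.coe_toList, Multiset.countP_eq_card_filter]
  rfl

theorem edgeProd_out {V : Type*} (y : V → ℤˣ) (e : Sym2 V) :
    edgeProd y e = y (Quot.out e).1 * y (Quot.out e).2 := by
  have h : s((Quot.out e).1, (Quot.out e).2) = e := Quot.out_eq e
  conv_lhs => rw [← h]
  exact edgeProd_mk y _ _

/-- The costs in a list of decoded components. -/
def listCost {V : Type} (Ds : List (DecodedComponent V)) (i : ℕ) (s : ℤˣ) : ℕ :=
  Ds[i]?.elim 0 fun W => if s = 1 then W.costs.1 else W.costs.2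

/-- The signs on the edges of the path, in a list of decoded components. -/
def listLink {V : Type} (Ds : List (DecodedComponent V)) (i : ℕ) : ℤˣ :=
  Ds[i]?.elim 1 fun W => W.link

theorem carries_listCost_listLink {V : Type} (Ds : List (DecodedComponent V)) :
    Carries (listCost Ds) (listLink Ds) 0 Ds := by
  intro i W hW
  simp [listCost, listLink, hW]

section Output

open scoped Classical

variable {V : Type} {m : ℕ} {G : SimpleGraph V}

/-- The edge measurements as an array. -/
noncomputable def edgeArray (X : G.edgeSet → ℤˣ) (u v : V) : ℤˣ :=
  if h : G.Adj u v then X ⟨s(u, v), h⟩ else 1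

theorem edgeArray_out (X : G.edgeSet → ℤˣ) (e : G.edgeSet) :
    edgeArray X (Quot.out (e : Sym2 V)).1 (Quot.out (e : Sym2 V)).2 = X e := by
  have h : s((Quot.out (e : Sym2 V)).1, (Quot.out (e : Sym2 V)).2) = (e : Sym2 V) :=
    Quot.out_eq (e : Sym2 V)
  have hadj : G.Adj (Quot.out (e : Sym2 V)).1 (Quot.out (e : Sym2 V)).2 := by
    rw [← SimpleGraph.mem_edgeSet, h]
    exact e.2
  rw [edgeArray, dif_pos hadj]
  exact congrArg X (Subtype.ext h)

/-- `pathEdge` identifies the edges of the path with the pairs of consecutive positions, over which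
the dynamic program counts. -/
theorem Decomposition.violations_eq_signViolations (D : Decomposition V (Fin (m + 1)))
    (hT : D.tree = SimpleGraph.pathGraph (m + 1)) (est : Fin (m + 1) → V → ℤˣ)
    (pivot : Sym2 (Fin (m + 1)) → V) (τ : ℕ → ℤˣ)
    (hτ : ∀ i : Fin m, τ (i + 1) = est i.castSucc (pivot s(i.castSucc, i.succ)) *
      est i.succ (pivot s(i.castSucc, i.succ))) {ss : List ℤˣ} (hss : ss.length = m + 1) :
    D.violations est pivot (fun i => ss.reverse.getD i 1) = signViolations τ ss := by
  obtain ⟨probed, tree, bag, ext⟩ := D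
  subst hT
  rw [Decomposition.violations, Finset.card_filter, signViolations_eq, hss, Nat.add_sub_cancel,
    Finset.sum_range]
  symm
  refine Fintype.sum_bijective pathEdge pathEdge_bijective _ _ fun i => ?_
  simp only [pathEdge, edgeProd_mk, hτ, Fin.val_castSucc, Fin.val_succ, ne_eq]
  exact (ite_not _ _ _).symm

variable [Fintype V]

/-- A component of a decomposition as linked lists. -/
noncomputable def Decomposition.componentData (G : SimpleGraph V) (D : Decomposition V (Fin m))
    (i : Fin m) : ComponentData V :=
  ⟨(D.bag i).toList, (D.ext i).toList,
    (D.localEdges G i).toList.map fun e => Quot.out (e : Sym2 V)⟩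

theorem Decomposition.componentData_edges (D : Decomposition V (Fin m)) (i : Fin m) :
    (D.componentData G i).edges =
      (D.localEdges G i).toList.map fun e : G.edgeSet => Quot.out (e : Sym2 V) := by
  simp [Decomposition.componentData, List.flatMap_singleton']

theorem Decomposition.localCost_eq_countP (D : Decomposition V (Fin m)) (X : G.edgeSet → ℤˣ)
    (i : Fin m) (y : V → ℤˣ) : D.localCost G X i y =
      (D.componentData G i).edges.countP fun e => y e.1 * y e.2 ≠ edgeArray X e.1 e.2 := by
  rw [Decomposition.localCost, Finset.card_filter_eq_countP_toList, D.componentData_edges,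
    List.countP_map]
  refine List.countP_congr fun e _ => ?_
  simp only [Function.comp_apply, edgeArray_out, ← edgeProd_out]

theorem Decomposition.mem_ext_of_mem_edges (D : Decomposition V (Fin m)) (i : Fin m) :
    ∀ e ∈ (D.componentData G i).edges,
      e.1 ∈ (D.componentData G i).ext ∧ e.2 ∈ (D.componentData G i).ext := by
  intro e he
  rw [D.componentData_edges] at he
  obtain ⟨e', he', rfl⟩ := List.mem_map.1 he
  have h := (Finset.mem_filter.1 (Finset.mem_toList.1 he')).2.2
  exact ⟨Finset.mem_toList.2 (h _ (Sym2.out_fst_mem _)),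
    Finset.mem_toList.2 (h _ (Sym2.out_snd_mem _))⟩

/-- The component estimators that the program computes. -/
noncomputable def Decomposition.programEstimate (D : Decomposition V (Fin m))
    (X : G.edgeSet → ℤˣ) (i : Fin m) : V → ℤˣ :=
  labelOf (D.ext i).toList (localEstimateT (edgeArray X) (D.componentData G i)).val

theorem Decomposition.localCost_programEstimate_le (D : Decomposition V (Fin m))
    (X : G.edgeSet → ℤˣ) (i : Fin m) (y : V → ℤˣ) :
    D.localCost G X i (D.programEstimate X i) ≤ D.localCost G X i y := by
  rw [D.localCost_eq_countP, D.localCost_eq_countP]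
  exact localEstimateT_spec (edgeArray X) (D.componentData G i) (D.mem_ext_of_mem_edges i) y

theorem Decomposition.vertexCostsT_eq (D : Decomposition V (Fin m)) (X : G.edgeSet → ℤˣ)
    (Z : V → ℤˣ) (i : Fin m) :
    (vertexCostsT Z (D.componentData G i)
      (localEstimateT (edgeArray X) (D.componentData G i)).val (D.componentData G i).core).val =
      (D.vertexCost Z (D.programEstimate X) i 1, D.vertexCost Z (D.programEstimate X) i (-1)) := by
  rw [vertexCostsT_val]
  have h : ∀ s : ℤˣ, D.vertexCost Z (D.programEstimate X) i s =
      (D.bag i).toList.countP fun v => s * D.programEstimate X i v ≠ Z v := fun s => by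
    rw [Decomposition.vertexCost, Finset.card_filter_eq_countP_toList]
  rw [h, h]
  congr!

/-- The components that the program has decoded. -/
noncomputable def Decomposition.decoded (D : Decomposition V (Fin m)) (X : G.edgeSet → ℤˣ)
    (Z : V → ℤˣ) : List (DecodedComponent V) :=
  (decodeComponentsT (edgeArray X) Z none (D.componentList G)).val

theorem Decomposition.componentList_getElem? (D : Decomposition V (Fin m)) (i : Fin m) :
    (D.componentList G)[(i : ℕ)]? = some (D.componentData G i) := by
  rw [Decomposition.componentList, List.getElem?_ofFn, dif_pos i.2]
  rfl

theorem Decomposition.decoded_getElem? (D : Decomposition V (Fin m)) (X : G.edgeSet → ℤˣ)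
    (Z : V → ℤˣ) (i : Fin m) : ∃ prev, (D.decoded X Z)[(i : ℕ)]? =
      some (decodedOf (edgeArray X) Z prev (D.componentData G i)) := by
  rw [Decomposition.decoded, decodeComponentsT_getElem?, D.componentList_getElem?]
  exact ⟨_, rfl⟩

theorem Decomposition.decoded_getElem?_succ (D : Decomposition V (Fin (m + 1)))
    (X : G.edgeSet → ℤˣ) (Z : V → ℤˣ) (i : Fin m) : (D.decoded X Z)[(i : ℕ) + 1]? =
      some (decodedOf (edgeArray X) Z (some (D.componentData G i.castSucc,
        (localEstimateT (edgeArray X) (D.componentData G i.castSucc)).val))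
        (D.componentData G i.succ)) := by
  have h1 := D.componentList_getElem? (G := G) i.castSucc
  have h2 := D.componentList_getElem? (G := G) i.succ
  rw [Fin.val_castSucc] at h1
  rw [Fin.val_succ] at h2
  rw [Decomposition.decoded, decodeComponentsT_getElem?, h2, if_neg (Nat.succ_ne_zero _),
    Nat.add_sub_cancel, h1]
  rfl

theorem Decomposition.length_decoded (D : Decomposition V (Fin m)) (X : G.edgeSet → ℤˣ)
    (Z : V → ℤˣ) : (D.decoded X Z).length = m := by
  rw [Decomposition.decoded, length_decodeComponentsT, Decomposition.componentList,
    List.length_ofFn]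

theorem Decomposition.listCost_decoded (D : Decomposition V (Fin m)) (X : G.edgeSet → ℤˣ)
    (Z : V → ℤˣ) (i : Fin m) (s : ℤˣ) :
    listCost (D.decoded X Z) i s = D.vertexCost Z (D.programEstimate X) i s := by
  obtain ⟨prev, h⟩ := D.decoded_getElem? X Z i
  rw [listCost, h, Option.elim_some, decodedOf, D.vertexCostsT_eq X Z i]
  rcases Int.units_eq_one_or s with rfl | rfl
  · rw [if_pos rfl]
  · rw [if_neg (by decide)]

theorem Decomposition.sum_vertexCost_eq (D : Decomposition V (Fin m)) (X : G.edgeSet → ℤˣ)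
    (Z : V → ℤˣ) {ss : List ℤˣ} (hss : ss.length = m) :
    ∑ i : Fin m, D.vertexCost Z (D.programEstimate X) i (ss.reverse.getD i 1) =
      signCost (listCost (D.decoded X Z)) ss := by
  rw [signCost_eq, hss, Finset.sum_range]
  exact Finset.sum_congr rfl fun i _ => (D.listCost_decoded X Z i _).symm

theorem Decomposition.runDecoder_isDecoderOutput [Nonempty V] (D : Decomposition V (Fin m))
    (hm : 0 < m) (hT : D.tree = SimpleGraph.pathGraph m) (hcover : ∀ v, ∃ i, v ∈ D.bag i)
    (hinter : ∀ i j : Fin m, (j : ℕ) = i + 1 → ∃ v, v ∈ D.bag i ∧ v ∈ D.bag j) (L : ℕ)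
    (X : G.edgeSet → ℤˣ) (Z : V → ℤˣ) :
    D.IsDecoderOutput G L X Z (D.runDecoder G L X Z).val := by
  obtain ⟨m, rfl⟩ : ∃ l, m = l + 1 := ⟨m - 1, by omega⟩
  have hlink : ∀ i : Fin m, ∃ v, (v ∈ D.bag i.castSucc ∧ v ∈ D.bag i.succ) ∧
      listLink (D.decoded X Z) (i + 1) =
        D.programEstimate X i.castSucc v * D.programEstimate X i.succ v := by
    intro i
    obtain ⟨u, hu1, hu2⟩ := hinter i.castSucc i.succ (by simp)
    obtain ⟨v, hv1, hv2, h⟩ := linkT_val (D.componentData G i.castSucc) (D.componentData G i.succ)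
      (localEstimateT (edgeArray X) (D.componentData G i.castSucc)).val
      (localEstimateT (edgeArray X) (D.componentData G i.succ)).val
      (D.componentData G i.castSucc).core ⟨u, Finset.mem_toList.2 hu1, Finset.mem_toList.2 hu2⟩
    refine ⟨v, ⟨Finset.mem_toList.1 hv1, Finset.mem_toList.1 hv2⟩, ?_⟩
    rw [listLink, D.decoded_getElem?_succ]
    exact h
  choose piv hpiv hlink using hlink
  -- The pivot on a path edge is the common vertex that the program found first; on other pairs it
  -- is irrelevant.
  let pivot : Sym2 (Fin (m + 1)) → V :=
    Function.extend (fun i : Fin m => (pathEdge i : Sym2 (Fin (m + 1)))) piv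
      fun _ => Classical.arbitrary V
  have hpivot : ∀ i : Fin m, pivot s(i.castSucc, i.succ) = piv i := fun i =>
    Function.Injective.extend_apply
      (Subtype.val_injective.comp pathEdge_bijective.1) piv _ i
  obtain ⟨hlen, hviol, hopt⟩ := pathDecoderT_spec L (D.decoded X Z)
    (carries_listCost_listLink (D.decoded X Z))
  rw [D.length_decoded] at hlen hopt
  set ss := (pathDecoderT L (D.decoded X Z)).val with hss
  have hv : ∀ {ss' : List ℤˣ}, ss'.length = m + 1 →
      D.violations (D.programEstimate X) pivot (fun i => ss'.reverse.getD i 1) =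
        signViolations (listLink (D.decoded X Z)) ss' :=
    D.violations_eq_signViolations hT _ pivot _ fun i => by rw [hpivot, hlink]
  have hrun : (D.runDecoder G L X Z).val =
      (writeAllT ss.reverse (D.decoded X Z) fun _ => 1).val := by
    have h : (D.runDecoder G L X Z).val =
      (writeAllT (reverseT ss []).val (D.decoded X Z) fun _ => 1).val := rfl
    rw [h, reverseT_val, List.append_nil]
  -- The case in which no component writes `v` is excluded by `hcover`.
  have hhome : ∀ v, ∃ i : Fin (m + 1), v ∈ D.bag i ∧
      (D.runDecoder G L X Z).val v = ss.reverse.getD i 1 * D.programEstimate X i v := by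
    intro v
    rw [hrun]
    rcases writeAllT_val ss.reverse (D.decoded X Z)
      (by rw [List.length_reverse, hlen, D.length_decoded]) (fun _ => 1) v with
      ⟨i, s, W, h1, h2, h3, h4⟩ | ⟨h, -⟩
    · have hi : i < m + 1 := by
        rw [← D.length_decoded X Z]
        exact (List.getElem?_eq_some_iff.1 h2).1
      obtain ⟨prev, h5⟩ := D.decoded_getElem? X Z ⟨i, hi⟩
      obtain rfl := Option.some_inj.1 (h2.symm.trans h5)
      refine ⟨⟨i, hi⟩, Finset.mem_toList.1 h3, ?_⟩
      rw [h4, List.getD_eq_getElem?_getD, h1]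
      rfl
    · obtain ⟨i, hi⟩ := hcover v
      obtain ⟨prev, h5⟩ := D.decoded_getElem? X Z i
      exact absurd (Finset.mem_toList.2 hi) (h _ (List.mem_of_getElem? h5))
  choose home hhome1 hhome2 using hhome
  refine ⟨D.programEstimate X, pivot, fun i => ss.reverse.getD i 1, home,
    fun i y => D.localCost_programEstimate_le X i y, ?_, ?_, ?_, hhome1, hhome2⟩
  · intro i j hij
    rw [hT] at hij
    obtain ⟨l, hl⟩ := pathEdge_bijective.2 ⟨s(i, j), hij⟩
    have hl' : s(l.castSucc, l.succ) = s(i, j) := congrArg Subtype.val hl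
    rw [← hl', hpivot]
    rcases Sym2.eq_iff.1 hl' with ⟨rfl, rfl⟩ | ⟨rfl, rfl⟩
    exacts [hpiv l, (hpiv l).symm]
  · rw [hv hlen]
    exact hviol
  -- An arbitrary sign assignment becomes a competitor for the dynamic program when listed with its
  -- last component first.
  · intro s' hs'
    have hlen' : (List.ofFn s').reverse.length = m + 1 := by simp
    have hs : (fun i : Fin (m + 1) => (List.ofFn s').reverse.reverse.getD i 1) = s' := by
      funext i
      rw [List.reverse_reverse, List.getD_eq_getElem?_getD, List.getElem?_ofFn, dif_pos i.2]
      rfl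
    rw [D.sum_vertexCost_eq X Z hlen]
    have h := D.sum_vertexCost_eq X Z hlen'
    have h' := hv hlen'
    rw [hs] at h'
    rw [h'] at hs'
    refine (hopt _ hlen' hs').trans (le_of_eq ?_)
    rw [← h]
    exact Finset.sum_congr rfl fun i _ => congrArg _ (congrFun hs i)

end Output

/-! ### The running time of the program -/

section RunningTime

variable {V : Type}

theorem lengthT_time (vs : List V) : (lengthT vs).time = vs.length + 1 := by
  induction vs with
  | nil => rfl
  | cons v vs ih =>
    simp only [lengthT, Timed.time_bind, Timed.time_pure, tick_time, ih, List.length_cons]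
    omega

/-- The time plus one exactly doubles with each free sign, since a call spends one step besides two
subcalls. -/
theorem bestLabelsT_time_le {cost : List ℤˣ → Timed ℕ} {T : ℕ} (hT : ∀ ys, (cost ys).time ≤ T)
    (m : ℕ) (ys : List ℤˣ) : (bestLabelsT cost m ys).time + 1 ≤ 2 ^ (m + 1) * (T + 1) := by
  induction m generalizing ys with
  | zero =>
    have := hT ys
    simp only [bestLabelsT, Timed.time_bind, Timed.time_pure, tick_time]
    omega
  | succ m ih =>
    have h1 := ih (1 :: ys)
    have h2 := ih (-1 :: ys)
    simp only [bestLabelsT, Timed.time_bind, Timed.time_pure, tick_time]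
    rw [pow_succ 2 (m + 1), mul_assoc, mul_comm 2, ← mul_assoc]
    omega

theorem initialRowT_time (s : ℤˣ) (c L : ℕ) : (initialRowT s c L).time = L + 1 := by
  induction L with
  | zero => rfl
  | succ L ih =>
    simp only [initialRowT, Timed.time_bind, Timed.time_pure, tick_time, ih]
    omega

theorem nextRowT_time_le (s : ℤˣ) (c : ℕ) (same diff : List (ℕ × List ℤˣ))
    (carry : Option (ℕ × List ℤˣ)) : (nextRowT s c same diff carry).time ≤ same.length + 1 := by
  induction same generalizing diff carry with
  | nil => simp [nextRowT]
  | cons a same ih =>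
    cases diff with
    | nil => simp [nextRowT]
    | cons b diff =>
      have := ih diff (some b)
      simp only [nextRowT, Timed.time_bind, Timed.time_pure, tick_time, List.length_cons]
      omega

theorem length_nextRowT_le (s : ℤˣ) (c : ℕ) (same diff : List (ℕ × List ℤˣ))
    (carry : Option (ℕ × List ℤˣ)) : (nextRowT s c same diff carry).val.length ≤ same.length := by
  induction same generalizing diff carry with
  | nil => simp [nextRowT]
  | cons a same ih =>
    cases diff with
    | nil => simp [nextRowT]
    | cons b diff =>
      have := ih diff (some b)
      simp only [nextRowT, Timed.val_bind, Timed.val_pure, List.length_cons]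
      omega

theorem lastEntryT_time_le (row : List (ℕ × List ℤˣ)) :
    (lastEntryT row).time ≤ row.length + 1 := by
  induction row with
  | nil => simp [lastEntryT]
  | cons a row ih =>
    cases row with
    | nil => simp [lastEntryT]
    | cons a' row =>
      simp only [lastEntryT, Timed.time_bind, tick_time, List.length_cons] at ih ⊢
      omega

/-- Each component costs one step and two rows of at most `L + 2` steps; the closing scan of both
rows costs the same, which explains the extra unit in the first factor. -/
theorem pathProgramT_time_le (L : ℕ) (rowP rowM : List (ℕ × List ℤˣ))
    (Ws : List (DecodedComponent V)) (hP : rowP.length ≤ L + 1) (hM : rowM.length ≤ L + 1) :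
    (pathProgramT rowP rowM Ws).time ≤ (Ws.length + 1) * (2 * L + 5) := by
  induction Ws generalizing rowP rowM with
  | nil =>
    have h1 := lastEntryT_time_le rowP
    have h2 := lastEntryT_time_le rowM
    simp only [pathProgramT, Timed.time_bind, Timed.time_pure, tick_time, List.length_nil]
    omega
  | cons W Ws ih =>
    have hrow : ∀ (s : ℤˣ) (c : ℕ) (r r' : List (ℕ × List ℤˣ)), r.length ≤ L + 1 →
        (nextRowT s c r r' none).time ≤ L + 2 ∧ (nextRowT s c r r' none).val.length ≤ L + 1 :=
      fun s c r r' hr => ⟨(nextRowT_time_le s c r r' none).trans (by omega),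
        (length_nextRowT_le s c r r' none).trans hr⟩
    have h1 := hrow 1 W.costs.1 rowP rowM hP
    have h2 := hrow 1 W.costs.1 rowM rowP hM
    have h3 := hrow (-1) W.costs.2 rowP rowM hP
    have h4 := hrow (-1) W.costs.2 rowM rowP hM
    simp only [pathProgramT, Timed.time_bind, Timed.time_ite, tick_time, List.length_cons]
    rw [add_mul (Ws.length + 1) 1]
    split_ifs
    · have := ih _ _ h1.2 h4.2
      omega
    · have := ih _ _ h2.2 h3.2
      omega

theorem pathDecoderT_time_le (L : ℕ) (Ws : List (DecodedComponent V)) :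
    (pathDecoderT L Ws).time ≤ (Ws.length + 1) * (2 * L + 5) := by
  cases Ws with
  | nil =>
    simp only [pathDecoderT, Timed.time_bind, Timed.time_pure, tick_time, List.length_nil]
    omega
  | cons W Ws =>
    have hlen : ∀ (s : ℤˣ) (c : ℕ), (initialRowT s c L).val.length = L + 1 := fun s c => by
      induction L with
      | zero => rfl
      | succ L ih => simp only [initialRowT, Timed.val_bind, Timed.val_pure, List.length_cons, ih]
    have h := pathProgramT_time_le L (initialRowT 1 W.costs.1 L).val
      (initialRowT (-1) W.costs.2 L).val Ws (hlen _ _).le (hlen _ _).le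
    simp only [pathDecoderT, Timed.time_bind, tick_time, initialRowT_time, List.length_cons]
    rw [add_mul (Ws.length + 1) 1]
    omega

theorem reverseT_time (ss acc : List ℤˣ) : (reverseT ss acc).time = ss.length + 1 := by
  induction ss generalizing acc with
  | nil => rfl
  | cons s ss ih =>
    simp only [reverseT, Timed.time_bind, tick_time, ih, List.length_cons]
    omega

/-- Bounds for the lengths of the lists that describe a component. -/
structure ComponentData.Bounded (W : ComponentData V) (c a b : ℕ) : Prop where
  core_le : W.core.length ≤ c
  ext_le : W.ext.length ≤ a
  edges_le : W.edges.length ≤ b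

/-- The time per component of the program before the dynamic program. -/
def componentTime (c a b : ℕ) : ℕ :=
  1 + (a + 2 + 2 ^ (a + 1) * (b * (2 * a + 3) + 2)) + (c * (a + 2) + 1) + (c * (c + 2 * a + 4) + 1)

variable [DecidableEq V]

theorem lookupT_time_le (vs : List V) (ys : List ℤˣ) (v : V) :
    (lookupT vs ys v).time ≤ vs.length + 1 := by
  induction vs generalizing ys with
  | nil => simp [lookupT]
  | cons a vs ih =>
    cases ys with
    | nil => simp [lookupT]
    | cons y ys =>
      have := ih ys
      simp only [lookupT, Timed.time_bind, Timed.time_ite, Timed.time_pure, tick_time,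
        List.length_cons]
      split_ifs <;> omega

theorem edgeMismatchT_time_le (x : V → V → ℤˣ) (vs : List V) (ys : List ℤˣ) (es : List (V × V)) :
    (edgeMismatchT x vs ys es).time ≤ es.length * (2 * vs.length + 3) + 1 := by
  induction es with
  | nil => simp [edgeMismatchT]
  | cons e es ih =>
    have h1 := lookupT_time_le vs ys e.1
    have h2 := lookupT_time_le vs ys e.2
    simp only [edgeMismatchT, Timed.time_bind, Timed.time_pure, tick_time, List.length_cons]
    rw [add_mul es.length]
    omega

theorem localEstimateT_time_le (x : V → V → ℤˣ) {W : ComponentData V} {c a b : ℕ}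
    (hW : W.Bounded c a b) : (localEstimateT x W).time ≤
      a + 2 + 2 ^ (a + 1) * (b * (2 * a + 3) + 2) := by
  have hT : ∀ ys, (edgeMismatchT x W.ext ys W.edges).time ≤ b * (2 * a + 3) + 1 := fun ys =>
    (edgeMismatchT_time_le x W.ext ys W.edges).trans (Nat.add_le_add_right
      (Nat.mul_le_mul hW.edges_le (by have := hW.ext_le; omega)) 1)
  have h1 := bestLabelsT_time_le hT W.ext.length []
  have h2 : 2 ^ (W.ext.length + 1) * (b * (2 * a + 3) + 1 + 1) ≤
      2 ^ (a + 1) * (b * (2 * a + 3) + 2) :=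
    Nat.mul_le_mul_right _ (Nat.pow_le_pow_right two_pos (by have := hW.ext_le; omega))
  have h3 := hW.ext_le
  simp only [localEstimateT, Timed.time_bind, Timed.time_pure, tick_time, lengthT_time,
    lengthT_val]
  omega

theorem vertexCostsT_time_le (Z : V → ℤˣ) {W : ComponentData V} {c a b : ℕ}
    (hW : W.Bounded c a b) (ys : List ℤˣ) (vs : List V) :
    (vertexCostsT Z W ys vs).time ≤ vs.length * (a + 2) + 1 := by
  induction vs with
  | nil => simp [vertexCostsT]
  | cons v vs ih =>
    have h1 := lookupT_time_le W.ext ys v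
    have h2 := hW.ext_le
    simp only [vertexCostsT, Timed.time_bind, Timed.time_pure, tick_time, List.length_cons]
    rw [add_mul vs.length]
    omega

theorem memT_time_le (v : V) (ws : List V) : (memT v ws).time ≤ ws.length + 1 := by
  induction ws with
  | nil => simp [memT]
  | cons w ws ih =>
    simp only [memT, Timed.time_bind, Timed.time_ite, Timed.time_pure, tick_time, List.length_cons]
    split_ifs <;> omega

theorem linkT_time_le {W₁ W₂ : ComponentData V} {c a b : ℕ} (h₁ : W₁.Bounded c a b)
    (h₂ : W₂.Bounded c a b) (ys₁ ys₂ : List ℤˣ) (vs : List V) :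
    (linkT W₁ W₂ ys₁ ys₂ vs).time ≤ vs.length * (c + 2 * a + 4) + 1 := by
  induction vs with
  | nil => simp [linkT]
  | cons v vs ih =>
    have h3 := memT_time_le v W₂.core
    have h4 := lookupT_time_le W₁.ext ys₁ v
    have h5 := lookupT_time_le W₂.ext ys₂ v
    have h6 := h₁.ext_le
    have h7 := h₂.ext_le
    have h8 := h₂.core_le
    simp only [linkT, Timed.time_bind, Timed.time_ite, Timed.time_pure, tick_time,
      List.length_cons]
    rw [add_mul vs.length]
    split_ifs <;> omega

theorem decodeComponentsT_time_le (x : V → V → ℤˣ) (Z : V → ℤˣ) {c a b : ℕ}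
    (prev : Option (ComponentData V × List ℤˣ)) (Ws : List (ComponentData V))
    (hprev : ∀ P, prev = some P → P.1.Bounded c a b) (hWs : ∀ W ∈ Ws, W.Bounded c a b) :
    (decodeComponentsT x Z prev Ws).time ≤ Ws.length * componentTime c a b + 1 := by
  induction Ws generalizing prev with
  | nil => simp [decodeComponentsT]
  | cons W Ws ih =>
    have hW := hWs W List.mem_cons_self
    have h1 := localEstimateT_time_le x hW
    have h2 := vertexCostsT_time_le Z hW (localEstimateT x W).val W.core
    have h3 : W.core.length * (a + 2) ≤ c * (a + 2) := Nat.mul_le_mul_right _ hW.core_le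
    have h4 := ih (some (W, (localEstimateT x W).val))
      (fun P hP => by rw [← Option.some_inj.1 hP]; exact hW)
      fun W' hW' => hWs W' (List.mem_cons_of_mem _ hW')
    rw [List.length_cons, add_mul, one_mul]
    cases prev with
    | none =>
      simp only [decodeComponentsT, Timed.time_bind, Timed.time_pure, tick_time]
      have h5 := componentTime.eq_1 c a b
      omega
    | some P =>
      have hP := hprev P rfl
      have h5 := linkT_time_le hP hW P.2 (localEstimateT x W).val P.1.core
      have h6 : P.1.core.length * (c + 2 * a + 4) ≤ c * (c + 2 * a + 4) :=
        Nat.mul_le_mul_right _ hP.core_le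
      simp only [decodeComponentsT, Timed.time_bind, Timed.time_pure, tick_time]
      have h7 := componentTime.eq_1 c a b
      omega

theorem writeComponentT_time_le (s : ℤˣ) {W : ComponentData V} {c a b : ℕ}
    (hW : W.Bounded c a b) (ys : List ℤˣ) (vs : List V) (out : V → ℤˣ) :
    (writeComponentT s W ys vs out).time ≤ vs.length * (a + 2) + 1 := by
  induction vs generalizing out with
  | nil => simp [writeComponentT]
  | cons v vs ih =>
    have h1 := lookupT_time_le W.ext ys v
    have h2 := hW.ext_le
    have h3 := ih (Function.update out v (s * (lookupT W.ext ys v).val))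
    simp only [writeComponentT, Timed.time_bind, tick_time, List.length_cons]
    rw [add_mul vs.length]
    omega

theorem writeAllT_time_le {c a b : ℕ} (ss : List ℤˣ) (Ds : List (DecodedComponent V))
    (hDs : ∀ W ∈ Ds, W.comp.Bounded c a b) (out : V → ℤˣ) :
    (writeAllT ss Ds out).time ≤ Ds.length * (c * (a + 2) + 2) + 1 := by
  induction Ds generalizing ss out with
  | nil => cases ss <;> simp [writeAllT]
  | cons W Ds ih =>
    cases ss with
    | nil => simp [writeAllT]
    | cons s ss =>
      have hW := hDs W List.mem_cons_self
      have h1 := writeComponentT_time_le s hW W.labels W.comp.core out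
      have h2 : W.comp.core.length * (a + 2) ≤ c * (a + 2) := Nat.mul_le_mul_right _ hW.core_le
      have h3 := ih ss (fun W' hW' => hDs W' (List.mem_cons_of_mem _ hW'))
        (writeComponentT s W.comp W.labels W.comp.core out).val
      simp only [writeAllT, Timed.time_bind, tick_time, List.length_cons]
      rw [add_mul Ds.length]
      omega

/-- Only the dynamic program depends on the budget. All other phases are linear in the number of
components and are absorbed by `1 ≤ L + 1`. -/
theorem decoderT_time_le {c a b : ℕ} (L : ℕ) (Ws : List (ComponentData V)) (x : V → V → ℤˣ)
    (Z : V → ℤˣ) (hWs : ∀ W ∈ Ws, W.Bounded c a b) (hne : 0 < Ws.length) :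
    (decoderT L Ws x Z).time ≤
      (componentTime c a b + c * (a + 2) + 17) * (Ws.length * (L + 1)) := by
  have h1 := decodeComponentsT_time_le x Z none Ws (by simp) hWs
  have hlen := length_decodeComponentsT x Z none Ws
  have hcomp := map_comp_decodeComponentsT x Z none Ws
  set Ds := (decodeComponentsT x Z none Ws).val with hDs
  have hbd : ∀ W ∈ Ds, W.comp.Bounded c a b := fun W hW =>
    hWs _ (by rw [← hcomp]; exact List.mem_map_of_mem hW)
  have h2 := pathDecoderT_time_le L Ds
  have h3 : (pathDecoderT L Ds).val.length = Ds.length :=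
    (pathDecoderT_spec L Ds (carries_listCost_listLink Ds)).1
  have h4 := writeAllT_time_le (reverseT (pathDecoderT L Ds).val []).val Ds hbd (fun _ => 1)
  have h5 : (decoderT L Ws x Z).time = 1 + ((decodeComponentsT x Z none Ws).time +
      ((pathDecoderT L Ds).time + ((reverseT (pathDecoderT L Ds).val []).time +
        (writeAllT (reverseT (pathDecoderT L Ds).val []).val Ds fun _ => 1).time))) := rfl
  rw [h5, reverseT_time, h3]
  rw [hlen] at h2 h4 ⊢
  nlinarith [Nat.zero_le (Ws.length * L), Nat.zero_le (componentTime c a b * (Ws.length * L)),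
    Nat.zero_le (c * (a + 2) * (Ws.length * L)), Nat.mul_le_mul_right L hne]

end RunningTime

theorem Decomposition.length_componentList {V : Type} [Fintype V] {m : ℕ} (G : SimpleGraph V)
    (D : Decomposition V (Fin m)) : (D.componentList G).length = m := by
  rw [Decomposition.componentList, List.length_ofFn]

theorem Decomposition.componentData_bounded {V : Type} [Fintype V] {m : ℕ} {G : SimpleGraph V}
    {D : Decomposition V (Fin m)} {c a b : ℕ} {i : Fin m} (hc : (D.bag i).card ≤ c)
    (ha : (D.ext i).card ≤ a) (hb : (D.localEdges G i).card ≤ b) :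
    (D.componentData G i).Bounded c a b where
  core_le := by simpa [Decomposition.componentData] using hc
  ext_le := by simpa [Decomposition.componentData] using ha
  edges_le := by rwa [D.componentData_edges, List.length_map, Finset.length_toList]

theorem Decomposition.runDecoder_time_le {V : Type} [Fintype V] {m : ℕ} {G : SimpleGraph V}
    {D : Decomposition V (Fin m)} {c a b : ℕ} (hc : ∀ i, (D.bag i).card ≤ c)
    (ha : ∀ i, (D.ext i).card ≤ a) (hb : ∀ i, (D.localEdges G i).card ≤ b) (hm : 0 < m) (L : ℕ)
    (X : G.edgeSet → ℤˣ) (Z : V → ℤˣ) : (D.runDecoder G L X Z).time ≤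
      (componentTime c a b + c * (a + 2) + 17) * (m * (L + 1)) := by
  classical
  have h := decoderT_time_le L (D.componentList G) (edgeArray X) Z (c := c) (a := a) (b := b)
    (fun W hW => by
      obtain ⟨i, rfl⟩ := (List.mem_ofFn' _ _).1 hW
      exact Decomposition.componentData_bounded (hc i) (ha i) (hb i))
    (by rw [D.length_componentList]; exact hm)
  rw [D.length_componentList] at h
  exact h

/-! ### The program on the ring lattice. -/

section RingDecoder

variable {n k : ℕ}

theorem ringDecomposition_runDecoder_isDecoderOutput (hk : 1 ≤ k) (hn : 2 * k + 1 ≤ n) (L : ℕ)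
    (X : (ringLattice n k).edgeSet → ℤˣ) (Z : Fin n → ℤˣ) :
    (ringDecomposition n k).IsDecoderOutput (ringLattice n k) L X Z
      ((ringDecomposition n k).runDecoder (ringLattice n k) L X Z).val := by
  have : Nonempty (Fin n) := ⟨⟨0, by omega⟩⟩
  have hm := two_le_ringComponents hk hn
  exact (ringDecomposition n k).runDecoder_isDecoderOutput (by omega) rfl
    (exists_mem_bag le_rfl) (exists_mem_bag_inter hk le_rfl) L X Z

/-- The time of the program on the ring lattice, per component and unit of the budget. -/
def ringTime (k : ℕ) : ℕ :=
  componentTime (2 * k + 1) ((2 * k + 1) ^ 2) ((2 * k + 1) ^ 4) +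
    (2 * k + 1) * ((2 * k + 1) ^ 2 + 2) + 17

theorem ringDecomposition_runDecoder_time_le (hk : 1 ≤ k) (hn : 2 * k + 1 ≤ n) (L : ℕ)
    (X : (ringLattice n k).edgeSet → ℤˣ) (Z : Fin n → ℤˣ) :
    ((ringDecomposition n k).runDecoder (ringLattice n k) L X Z).time ≤
      ringTime k * (n * (L + 1)) := by
  have hm := two_le_ringComponents hk hn
  have hH := (ringProbed_le : ringProbed n k ≤ ringLattice n k)
  refine (Decomposition.runDecoder_time_le (card_latticeDecomposition_bag_le hn hH)
    (card_latticeDecomposition_ext_le hn hH)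
    (card_latticeDecomposition_localEdges_le hn hH _) (by omega) L X Z).trans ?_
  exact Nat.mul_le_mul_left _ (Nat.mul_le_mul_right _ (ringComponents_le hn))

/-- Since `p > 0`, the ceiling is at least `1`; it absorbs the additive `1` as well as the `log 2`
separating `log (2 / δ)` from `log (1 / δ)`. -/
theorem ringDecomposition_treeBudget_add_one_le (hk : 1 ≤ k) (hn : 2 * k + 1 ≤ n) {p δ : ℝ}
    (hp0 : 0 < p) (hp1 : p ≤ 1) (hδ0 : 0 < δ) (hδ1 : δ ≤ 1) :
    ((ringDecomposition n k).treeBudget (ringLattice n k) p δ : ℝ) + 1 ≤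
      (4 * budgetConst k + 1) * (⌈p ^ k * (n : ℝ)⌉₊ + Real.log (1 / δ)) := by
  have hb := budgetConst_pos hk
  have hn' : (0 : ℝ) < n := by exact_mod_cast (by omega : 0 < n)
  have h1 := componentBudget_le hk hn hp0.le hp1 hδ0 hδ1
  have h2 := (ringDecomposition n k).componentBudget_nonneg (G := ringLattice n k) hp0.le hδ0 hδ1
  have h3 : ((ringDecomposition n k).treeDegree : ℝ) ≤ 2 := by
    exact_mod_cast latticeDecomposition_treeDegree_le (H := ringProbed n k)
  have h4 : ((ringDecomposition n k).treeBudget (ringLattice n k) p δ : ℝ) ≤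
      2 * (ringDecomposition n k).componentBudget (ringLattice n k) p δ :=
    (Nat.floor_le (by positivity)).trans (mul_le_mul_of_nonneg_right h3 h2)
  have h5 : p ^ k * (n : ℝ) ≤ ⌈p ^ k * (n : ℝ)⌉₊ := Nat.le_ceil _
  have h6 : (1 : ℝ) ≤ ⌈p ^ k * (n : ℝ)⌉₊ := by
    exact_mod_cast Nat.ceil_pos.2 (by positivity : 0 < p ^ k * (n : ℝ))
  have h7 : Real.log (2 / δ) ≤ 1 + Real.log (1 / δ) := by
    rw [show (2 : ℝ) / δ = 2 * (1 / δ) by ring, Real.log_mul (by norm_num) (by positivity)]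
    linarith [Real.log_two_lt_d9]
  have h8 : 0 ≤ Real.log (1 / δ) := Real.log_nonneg (by rw [le_div_iff₀ hδ0]; linarith)
  have h9 : budgetConst k * (p ^ k * n + Real.log (2 / δ)) ≤
      budgetConst k * (2 * (⌈p ^ k * (n : ℝ)⌉₊ + Real.log (1 / δ))) :=
    mul_le_mul_of_nonneg_left (by linarith) hb.le
  linarith

end RingDecoder

theorem mainTheorem6 (k : ℕ) (hk : 1 ≤ k) :
    ∃ (C : ℝ) (B : ℕ), 0 < C ∧
      -- the optimal rate: lower bound
      (∀ (n : ℕ) (p q : ℝ), 2 * k + 1 ≤ n → 0 < p → p < q → q < 1 / 2 →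
        ENNReal.ofReal (q / C * (p ^ k * n)) ≤ minimaxHammingError (ringLattice n k) p q) ∧
      -- the optimal rate: upper bound
      (∀ q : ℝ, 0 < q → q < 1 / 2 → ∃ C' : ℝ, 0 < C' ∧
        ∀ (n : ℕ) (p : ℝ), 2 * k + 1 ≤ n → 1 / (n : ℝ) ≤ p → p < q →
          minimaxHammingError (ringLattice n k) p q ≤
            ENNReal.ofReal (C' * Real.log n * (p ^ k * n))) ∧
      -- the decoder: admissible decomposition, error with high probability, running time
      (∀ n : ℕ, 2 * k + 1 ≤ n →
        (ringDecomposition n k).IsAdmissible (ringLattice n k) B ∧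
        ∀ p q δ : ℝ, 0 < p → p < q → q < 1 / 2 → 0 < δ → δ < 1 →
          (∀ Y : Fin n → ℤˣ,
            observationLaw (ringLattice n k) p q Y
              {o | ∃ Yhat : Fin n → ℤˣ,
                (ringDecomposition n k).IsDecoderOutput (ringLattice n k)
                  ((ringDecomposition n k).treeBudget (ringLattice n k) p δ) o.1 o.2 Yhat ∧
                C / (1 / 2 - q) ^ 2 * (p ^ k * n + Real.log (2 / δ)) * Real.log n <
                  (hammingDist Yhat Y : ℝ)} ≤ ENNReal.ofReal δ) ∧
          (∀ (X : (ringLattice n k).edgeSet → ℤˣ) (Z : Fin n → ℤˣ),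
            (ringDecomposition n k).IsDecoderOutput (ringLattice n k)
              ((ringDecomposition n k).treeBudget (ringLattice n k) p δ) X Z
              ((ringDecomposition n k).runDecoder (ringLattice n k)
                ((ringDecomposition n k).treeBudget (ringLattice n k) p δ) X Z).val ∧
            (((ringDecomposition n k).runDecoder (ringLattice n k)
                ((ringDecomposition n k).treeBudget (ringLattice n k) p δ) X Z).time : ℝ) ≤
              C * ((⌈p ^ k * (n : ℝ)⌉₊ : ℝ) + Real.log (1 / δ)) * n)) := by
  have hE : (0 : ℝ) < 2 ^ k := by positivity
  -- The three entries serve the lower bound, the error of the decoder and its running time, in this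
  -- order.
  refine ⟨max (2 ^ k) (max (errorConst k) (ringTime k * (4 * budgetConst k + 1))),
    (2 * k + 1) ^ 4, lt_max_of_lt_left hE, ?_, fun q _ hq => minimaxHammingError_ringLattice_le hk hq,
    fun n hn => ⟨ringDecomposition_isAdmissible hk hn, fun p q δ hp0 hpq hq1 hδ0 hδ1 =>
      ⟨fun Y => observationLaw_decoder_error_le hk hn hp0 hpq hq1 hδ0 hδ1
        ((le_max_left _ _).trans (le_max_right _ _)) Y,
      fun X Z => ⟨ringDecomposition_runDecoder_isDecoderOutput hk hn _ X Z, ?_⟩⟩⟩⟩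
  · intro n p q hn hp0 hpq hq1
    refine le_trans (ENNReal.ofReal_le_ofReal ?_) (ringLattice_le_minimaxHammingError hn hp0.le
      (by linarith) (by linarith) hq1.le)
    -- As `p < 1 / 2`, the probability that the other `k` measurements at a vertex are correct is
    -- bounded below by a constant.
    have h1 : (1 / 2 : ℝ) ^ k ≤ (1 - p) ^ k := pow_le_pow_left₀ (by norm_num) (by linarith) k
    have hq0 : 0 < q := hp0.trans hpq
    calc q / max (2 ^ k) (max (errorConst k) (ringTime k * (4 * budgetConst k + 1))) * (p ^ k * n)
        ≤ q / 2 ^ k * (p ^ k * n) :=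
          mul_le_mul_of_nonneg_right (div_le_div_of_nonneg_left hq0.le hE (le_max_left _ _))
            (by positivity)
      _ = n * (p ^ k * (1 / 2) ^ k * q) := by rw [div_pow, one_pow]; ring
      _ ≤ n * (p ^ k * (1 - p) ^ k * q) := by gcongr
  · have h1 : (((ringDecomposition n k).runDecoder (ringLattice n k)
        ((ringDecomposition n k).treeBudget (ringLattice n k) p δ) X Z).time : ℝ) ≤
        ringTime k * (n * ((ringDecomposition n k).treeBudget (ringLattice n k) p δ + 1)) := by
      exact_mod_cast ringDecomposition_runDecoder_time_le hk hn _ X Z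
    have h2 := ringDecomposition_treeBudget_add_one_le hk hn hp0 (by linarith) hδ0 hδ1.le
    have h3 : 0 ≤ Real.log (1 / δ) := Real.log_nonneg (by rw [le_div_iff₀ hδ0]; linarith)
    calc _ ≤ _ := h1
      _ ≤ ringTime k * (n * ((4 * budgetConst k + 1) *
          (⌈p ^ k * (n : ℝ)⌉₊ + Real.log (1 / δ)))) := by gcongr
      _ = ringTime k * (4 * budgetConst k + 1) *
          (⌈p ^ k * (n : ℝ)⌉₊ + Real.log (1 / δ)) * n := by ring
      _ ≤ _ := by
          gcongr
          exact (le_max_right _ _).trans (le_max_right _ _)
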